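/- Let $\mathbb T^3=(\mathbb R/\mathbb Z)^3$. Let $\pi\in C^1([0,\infty))\cap C^2((0,\infty))$ satisfy $\pi(0)=0$, $\pi(r)>0$ for $r>0$, and, for some $\gamma>1$ and $a_1,a_2,C>0$, $$a_2r^\gamma-C\le \pi(r)\le C+a_1r^\gamma\quad (r\ge 0),\qquad |\pi'(r)|\le Cr^{\gamma-1},\quad |\pi''(r)|\le Cr^{\gamma-2}\quad (r>1).$$ Let $\Gamma>3$, $m\in(\tfrac52\Gamma+1,\tfrac52\Gamma+2)$ (for instance $m=\tfrac52\Gamma+\tfrac32$), let $\varepsilon,\delta,\mu,T>0$ be fixed and put $\pi_\mu(r)=\pi(r)+\mu r^\Gamma$. Let $\kappa\in C_c^\infty(\mathbb R^3)$ be nonnegative and even with $\int_{\mathbb R^3}\kappa=1$, let $\kappa_\varepsilon(y)=\varepsilon^{-3}\kappa(y/\varepsilon)$, and let $[f]_\varepsilon(x)=\int_{\mathbb R^3}\kappa_\varepsilon(y)f(x-y)\,dy$ be the mollification in space of a (scalar or vector valued) function $f$ on $\mathbb T^3$. Let $\rho^0\in C^2(\mathbb T^3)$ with $0<\underline\rho\le\rho^0(x)\le\overline\rho$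 for all $x\in\mathbb T^3$, and let $u^0\in C^2(\mathbb T^3;\mathbb R^3)$. Then there is a strong solution $(\rho,u)$ on $(0,T)\times\mathbb T^3$ of $$\partial_t\rho+\operatorname{div}(\rho[u]_\varepsilon)+\delta\rho^m=0,\qquad \partial_tu+\nabla[\pi_\mu(\rho)]_\varepsilon=\Delta u,\qquad \rho(0,\cdot)=\rho^0,\quad u(0,\cdot)=u^0,$$ such that, for every $1\le p<\infty$, $$u\in W^{1,p}(0,T;L^p(\mathbb T^3))\cap L^p(0,T;W^{2,p}(\mathbb T^3)),\qquad 0\le\rho\in W^{1,p}(0,T;L^p(\mathbb T^3))\cap L^p(0,T;W^{1,p}(\mathbb T^3)).$$ Here "strong solution" means that all derivatives in the equations exist as integrable weak derivatives, that the equations hold almost everywhere in $(0,T)\times\mathbb T^3$, and that $\rho$ and $u$, as functions in $C([0,T];L^p(\mathbb T^3))$ for all $1\le p<\infty$, take the prescribed values at $t=0$. -/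

import Mathlib

open MeasureTheory Filter Topology Set
open scoped ContDiff

noncomputable section

namespace RegularizedFlow

/-- The physical space `ℝ³`. -/
abbrev R3 : Type := EuclideanSpace ℝ (Fin 3)

/-- The flat torus `𝕋³ = (ℝ/ℤ)³`, with its Haar (Lebesgue) measure `volume`. -/
abbrev T3 : Type := UnitAddTorus (Fin 3)

/-- The projection `ℝ³ → 𝕋³`. -/
def toTorus (x : R3) : T3 := fun i => (x i : UnitAddCircle)

/-- `f` is of class `C^n` on the torus: its periodic lift to `ℝ³` is of class `C^n`. -/
def TorusContDiff {F : Type*} [NormedAddCommGroup F] [NormedSpace ℝ F]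
    (n : WithTop ℕ∞) (f : T3 → F) : Prop :=
  ContDiff ℝ n (fun x : R3 => f (toTorus x))

/-- The classical partial derivative `∂ᵢ f` on the torus (used for smooth `f` only). -/
def torusPartial (i : Fin 3) (f : T3 → ℝ) (x : T3) : ℝ :=
  deriv (fun s : ℝ => f (x + Pi.single i (s : UnitAddCircle))) 0

/-- `g` is the weak partial derivative `∂ᵢ f` on the torus. -/
def HasWeakPartial (i : Fin 3) (f g : T3 → ℝ) : Prop :=
  Integrable f volume ∧ Integrable g volume ∧
    ∀ φ : T3 → ℝ, TorusContDiff ∞ φ →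
      ∫ x, f x * torusPartial i φ x = - ∫ x, g x * φ x

/-- Lebesgue measure on the space-time cylinder `(0,T) × 𝕋³`. -/
def spaceTime (T : ℝ) : Measure (ℝ × T3) :=
  ((volume : Measure ℝ).restrict (Ioo 0 T)).prod (volume : Measure T3)

/-- `f ∈ L^p(0,T; L^p(𝕋³)) = L^p((0,T) × 𝕋³)`, for `1 ≤ p < ∞`. -/
def MemLpLp (T : ℝ) (p : ENNReal) (f : ℝ → T3 → ℝ) : Prop :=
  MemLp (fun z : ℝ × T3 => f z.1 z.2) p (spaceTime T)

/-- `g` is the weak derivative `∂ᵢ f` in space: `g(t)` is the weak derivative of `f(t)` on the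
torus for almost every `t ∈ (0,T)`, both functions being integrable on `(0,T) × 𝕋³`. -/
def HasWeakSpaceDeriv (T : ℝ) (i : Fin 3) (f g : ℝ → T3 → ℝ) : Prop :=
  MemLpLp T 1 f ∧ MemLpLp T 1 g ∧
    ∀ᵐ t ∂((volume : Measure ℝ).restrict (Ioo 0 T)), HasWeakPartial i (f t) (g t)

/-- `g` is the weak derivative `∂ₜ f` in time, `f` and `g` being regarded as `L¹(𝕋³)`-valued
functions on `(0,T)`: `∫ φ'(t) f(t) dt = - ∫ φ(t) g(t) dt` in `L¹(𝕋³)` for all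
`φ ∈ C_c^∞(0,T)`. -/
def HasWeakTimeDeriv (T : ℝ) (f g : ℝ → T3 → ℝ) : Prop :=
  MemLpLp T 1 f ∧ MemLpLp T 1 g ∧
    ∀ φ : ℝ → ℝ, ContDiff ℝ ∞ φ → HasCompactSupport φ → tsupport φ ⊆ Ioo 0 T →
      ∀ᵐ x ∂(volume : Measure T3),
        ∫ t in Ioo 0 T, deriv φ t * f t x = - ∫ t in Ioo 0 T, φ t * g t x

/-- `f ∈ L^p(0,T; W^{k,p}(𝕋³))`. -/
def MemLpW (T : ℝ) (p : ENNReal) : ℕ → (ℝ → T3 → ℝ) → Prop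
  | 0, f => MemLpLp T p f
  | k + 1, f => MemLpLp T p f ∧ ∀ i : Fin 3, ∃ g, HasWeakSpaceDeriv T i f g ∧ MemLpW T p k g

/-- `f ∈ W^{1,p}(0,T; L^p(𝕋³))`. -/
def MemW1Lp (T : ℝ) (p : ENNReal) (f : ℝ → T3 → ℝ) : Prop :=
  MemLpLp T p f ∧ ∃ g, HasWeakTimeDeriv T f g ∧ MemLpLp T p g

/-- `f ∈ C([0,T]; L^p(𝕋³))`. -/
def ContinuousInLp (T : ℝ) (p : ENNReal) (f : ℝ → T3 → ℝ) : Prop :=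
  ∀ t ∈ Icc 0 T, MemLp (f t) p volume ∧
    Tendsto (fun s => eLpNorm (fun x => f s x - f t x) p volume) (𝓝[Icc 0 T] t) (𝓝 0)

/-- `f` is the time-continuous representative and takes the initial value `f₀`. -/
def HasInitialValue (T : ℝ) (f : ℝ → T3 → ℝ) (f₀ : T3 → ℝ) : Prop :=
  (∀ p : ENNReal, 1 ≤ p → p ≠ ⊤ → ContinuousInLp T p f) ∧
    f 0 =ᵐ[(volume : Measure T3)] f₀

/-- The admissible mollifying kernels `κ = κ₁` on `ℝ³`. -/
structure IsMollifierKernel (κ : R3 → ℝ) : Prop where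
  smooth : ContDiff ℝ ∞ κ
  compactSupport : HasCompactSupport κ
  nonneg : ∀ y, 0 ≤ κ y
  even : ∀ y, κ (-y) = κ y
  integral_eq_one : ∫ y, κ y = 1

/-- `κ_ε(y) = ε⁻³ κ(y/ε)`. -/
def scaledKernel (κ : R3 → ℝ) (ε : ℝ) (y : R3) : ℝ := (ε ^ 3)⁻¹ * κ (ε⁻¹ • y)

/-- The space mollification `[f]_ε = κ_ε ∗ f` of a function on the torus. -/
def mollify (κ : R3 → ℝ) (ε : ℝ) (f : T3 → ℝ) (x : T3) : ℝ :=
  ∫ y : R3, scaledKernel κ ε y * f (x - toTorus y)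

/-- The assumptions on the pressure law `π : [0,∞) → [0,∞)` with growth exponent `γ`
(the values of `π` on the negative half-line are irrelevant). -/
structure IsPressureLaw (π : ℝ → ℝ) (γ : ℝ) : Prop where
  one_lt : 1 < γ
  contDiffOn_one : ContDiffOn ℝ 1 π (Ici 0)
  contDiffOn_two : ContDiffOn ℝ 2 π (Ioi 0)
  zero : π 0 = 0
  pos : ∀ r, 0 < r → 0 < π r
  growth : ∃ a₁ a₂ C : ℝ, 0 < a₁ ∧ 0 < a₂ ∧ 0 < C ∧
    (∀ r, 0 ≤ r → a₂ * r ^ γ - C ≤ π r ∧ π r ≤ C + a₁ * r ^ γ) ∧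
    ∀ r, 1 < r → |deriv π r| ≤ C * r ^ (γ - 1) ∧ |deriv (deriv π) r| ≤ C * r ^ (γ - 2)

/-- The modified pressure `π_μ(r) = π(r) + μ r^Γ`. -/
def modifiedPressure (π : ℝ → ℝ) (μ Γ r : ℝ) : ℝ := π r + μ * r ^ Γ

/-- `∂ₜρ + div(ρ [u]_ε) + δ ρ^m = 0` almost everywhere in `(0,T) × 𝕋³`. -/
def ContinuityEq (κ : R3 → ℝ) (ε δ m T : ℝ) (ρ : ℝ → T3 → ℝ) (u : ℝ → T3 → R3) : Prop :=
  ∃ (ρt : ℝ → T3 → ℝ) (F : Fin 3 → ℝ → T3 → ℝ),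
    HasWeakTimeDeriv T ρ ρt ∧
    (∀ i, HasWeakSpaceDeriv T i
      (fun t x => ρ t x * mollify κ ε (fun y => u t y i) x) (F i)) ∧
    ∀ᵐ z ∂(spaceTime T), ρt z.1 z.2 + ∑ i, F i z.1 z.2 + δ * ρ z.1 z.2 ^ m = 0

/-- `∂ₜu + ∇[P(ρ)]_ε = Δu` almost everywhere in `(0,T) × 𝕋³`, component by component. -/
def MomentumEq (κ : R3 → ℝ) (ε : ℝ) (P : ℝ → ℝ) (T : ℝ)
    (ρ : ℝ → T3 → ℝ) (u : ℝ → T3 → R3) : Prop :=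
  ∀ j : Fin 3, ∃ (ut G : ℝ → T3 → ℝ) (D D2 : Fin 3 → ℝ → T3 → ℝ),
    HasWeakTimeDeriv T (fun t x => u t x j) ut ∧
    HasWeakSpaceDeriv T j (fun t x => mollify κ ε (fun y => P (ρ t y)) x) G ∧
    (∀ i, HasWeakSpaceDeriv T i (fun t x => u t x j) (D i)) ∧
    (∀ i, HasWeakSpaceDeriv T i (D i) (D2 i)) ∧
    ∀ᵐ z ∂(spaceTime T), ut z.1 z.2 + G z.1 z.2 = ∑ i, D2 i z.1 z.2

/-- `(ρ,u)` is a strong solution on `(0,T) × 𝕋³` of the regularized system with pressure `P` and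
initial data `(ρ₀,u₀)`: `ρ ≥ 0`, all derivatives in the equations exist as integrable weak
derivatives, the equations hold almost everywhere, and the initial data are attained. -/
structure IsStrongSolution (κ : R3 → ℝ) (ε δ m : ℝ) (P : ℝ → ℝ) (T : ℝ)
    (ρ₀ : T3 → ℝ) (u₀ : T3 → R3) (ρ : ℝ → T3 → ℝ) (u : ℝ → T3 → R3) : Prop where
  nonneg : ∀ t ∈ Icc 0 T, ∀ᵐ x ∂(volume : Measure T3), 0 ≤ ρ t x
  continuity : ContinuityEq κ ε δ m T ρ u
  momentum : MomentumEq κ ε P T ρ u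
  initial_density : HasInitialValue T ρ ρ₀
  initial_velocity : ∀ j, HasInitialValue T (fun t x => u t x j) (fun x => u₀ x j)

end RegularizedFlow

end

noncomputable section

namespace RegularizedFlow

/-! The substitution w = ρ^(-k) with k = m - 1 makes the continuity equation linear: with v = [u]_ε
and d = div v it becomes ∂ₜw + v·∇w = k d w + k δ. Since v is smooth in space, w is given by an
explicit formula along characteristics, and an upper bound for ρ is the same thing as a positive
lower bound for w. The velocity solves a heat equation with force ∂ⱼ[q]_ε, q = P(ρ); spatial
derivatives of this force fall on the kernel and cost no regularity of q.

Truncated problem. If P(ρ) is replaced by a bounded Lipschitz function Q(w), then q ↦ u ↦ v ↦ w ↦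
Q(w) is a map of Volterra type on bounded continuous functions. It contracts in the norm weighted by
e^(-lt) for large l, hence has a fixed point on all of [0,T] (`exists_fixedPoint_of_volterra`,
`exists_coupled`).

Removing the truncation. Let h be the pressure potential, h + k r h' = -Q. Because the mollifier is
even, the work of the pressure cancels in the time derivative of ½∫|u|² + ∫h(w), and the damping
term adds at most a constant (`IsCoupled.energy_le`). So u is bounded in L² by a quantity that sees
Q only through bounds on the range w ≥ s₀ of the initial datum. Convolution turns this into a
uniform bound β for d (`exists_abs_transportDiv_le`), and the formula for w yields w ≥ s₀ e^(-kβT).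
As β does not depend on the cutoff, the cutoff can be placed exactly at this level, where it is
never active (`exists_isCoupled_of_pressure`).

Regularity. w is Lipschitz in space and time and lies between positive constants, so ρ = w^(-1/k) is
Lipschitz as well. Rademacher's theorem supplies bounded weak derivatives, and the equation along
characteristics becomes the equation almost everywhere (`IsCoupled.ae_renormalized`). For u,
Gaussian averages and Duhamel's formula with C² data give bounded classical derivatives. Every
exponent p is thus covered at once by boundedness. -/

/-! ### The torus as a quotient of ℝ³, and its measure. -/

lemma toTorus_add (x y : R3) : toTorus (x + y) = toTorus x + toTorus y := by
  ext i; simp [toTorus]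

lemma toTorus_zero : toTorus 0 = 0 := by
  ext i; simp [toTorus]

lemma toTorus_neg (x : R3) : toTorus (-x) = -toTorus x := by
  ext i; simp [toTorus]

lemma toTorus_sub (x y : R3) : toTorus (x - y) = toTorus x - toTorus y := by
  ext i; simp [toTorus]

@[fun_prop]
lemma continuous_toTorus : Continuous toTorus := by
  unfold toTorus
  refine continuous_pi fun i => (AddCircle.continuous_mk' 1).comp ?_
  fun_prop

/-- The `i`-th standard basis vector of `ℝ³`. -/
def unitVec (i : Fin 3) : R3 := EuclideanSpace.single i 1

lemma norm_unitVec (i : Fin 3) : ‖unitVec i‖ = 1 := by simp [unitVec]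

lemma eq_sum_unitVec (v : R3) : v = ∑ i, v i • unitVec i := by
  ext j
  simp [unitVec, Pi.single_apply]

lemma toTorus_smul_unitVec (i : Fin 3) (s : ℝ) :
    toTorus (s • unitVec i) = Pi.single i (s : UnitAddCircle) := by
  ext j
  by_cases h : j = i
  · subst h; simp [toTorus, unitVec]
  · simp [toTorus, unitVec, h]

lemma isOpenQuotientMap_toTorus : IsOpenQuotientMap toTorus := by
  have h1 : IsOpenQuotientMap (Pi.map (fun (_ : Fin 3) (x : ℝ) => (x : UnitAddCircle))) :=
    IsOpenQuotientMap.piMap fun _ => QuotientAddGroup.isOpenQuotientMap_mk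
  have h2 := (EuclideanSpace.equiv (Fin 3) ℝ).toHomeomorph.isOpenQuotientMap
  exact h1.comp h2

lemma toTorus_surjective : Function.Surjective toTorus := isOpenQuotientMap_toTorus.surjective

lemma continuous_comp_toTorus_iff {F : Type*} [TopologicalSpace F] {f : T3 → F} :
    Continuous (fun y => f (toTorus y)) ↔ Continuous f :=
  isOpenQuotientMap_toTorus.isQuotientMap.continuous_iff.symm

instance : (volume : Measure T3).IsAddHaarMeasure :=
  Measure.pi.isAddHaarMeasure fun _ : Fin 3 => (volume : Measure UnitAddCircle)

instance : IsProbabilityMeasure (volume : Measure T3) := by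
  constructor
  have h := Measure.pi_univ (fun _ : Fin 3 => (volume : Measure UnitAddCircle))
  rw [volume_pi, h]
  simp

instance : (volume : Measure T3).IsNegInvariant :=
  Measure.IsAddHaarMeasure.isNegInvariant_of_regular volume

/-- A measurable choice of representatives of the points of the torus in the unit cube. -/
def rep (x : T3) : R3 := WithLp.toLp 2 fun i => (AddCircle.measurableEquivIoc 1 0 (x i) : ℝ)

lemma toTorus_rep (x : T3) : toTorus (rep x) = x := by
  ext i
  exact (AddCircle.measurableEquivIoc 1 0).symm_apply_apply (x i)

/-- Null sets of ℝ³ thereby pull back to null sets of the torus, which is what transfers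
Rademacher's theorem from ℝ × ℝ³ to ℝ × 𝕋³. -/
lemma exists_measurePreserving_rep :
    ∃ s : Set R3, MeasurePreserving rep volume (volume.restrict s) := by
  have h1 : MeasurePreserving (fun x : UnitAddCircle =>
      (AddCircle.measurableEquivIoc 1 0 x : ℝ)) volume (volume.restrict (Ioc 0 (0 + 1))) :=
    (measurePreserving_subtype_coe measurableSet_Ioc).comp
      (AddCircle.measurePreserving_equivIoc (T := 1) (a := 0))
  have h2 := measurePreserving_pi (fun _ : Fin 3 => (volume : Measure UnitAddCircle))
    (fun _ => (volume : Measure ℝ).restrict (Ioc 0 (0 + 1))) (fun _ => h1)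
  rw [← Measure.restrict_pi_pi] at h2
  refine ⟨(fun y : R3 => WithLp.ofLp y) ⁻¹'
    (univ.pi fun _ => Ioc 0 (0 + 1)), ?_⟩
  have h3 := (PiLp.volume_preserving_ofLp (Fin 3)).restrict_preimage
    (MeasurableSet.univ_pi fun _ : Fin 3 => measurableSet_Ioc (a := (0 : ℝ)) (b := 0 + 1))
  have h4 : MeasurePreserving (MeasurableEquiv.toLp 2 (Fin 3 → ℝ)) _ _ :=
    MeasurePreserving.symm (MeasurableEquiv.toLp 2 (Fin 3 → ℝ)).symm h3
  exact h4.comp h2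

lemma measurable_rep : Measurable rep := exists_measurePreserving_rep.choose_spec.measurable

/-- Lets an integral over ℝ³ of a periodic function be cut into unit cells, each counting as one
copy of the torus. -/
lemma measurePreserving_toTorus_cell (a : Fin 3 → ℝ) :
    MeasurePreserving toTorus (volume.restrict ((fun y : R3 => WithLp.ofLp y) ⁻¹'
      (univ.pi fun i => Ioc (a i) (a i + 1)))) volume := by
  have h2 := measurePreserving_pi (fun i : Fin 3 => (volume : Measure ℝ).restrict
    (Ioc (a i) (a i + 1))) (fun _ => (volume : Measure UnitAddCircle))
    (fun i => UnitAddCircle.measurePreserving_mk (a i))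
  rw [← Measure.restrict_pi_pi] at h2
  exact h2.comp ((PiLp.volume_preserving_ofLp (Fin 3)).restrict_preimage
    (MeasurableSet.univ_pi fun i => measurableSet_Ioc))

/-! ### Classical derivatives on the torus. -/

/-- `f` is differentiable on the torus with partial derivatives `g i`. -/
def HasGrad (f : T3 → ℝ) (g : Fin 3 → T3 → ℝ) : Prop :=
  ∀ x, HasFDerivAt (fun y : R3 => f (x + toTorus y))
    (∑ i, g i x • (EuclideanSpace.proj i : R3 →L[ℝ] ℝ)) 0

section HasGrad

variable {f : T3 → ℝ} {g : Fin 3 → T3 → ℝ}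

lemma HasGrad.hasFDerivAt (h : HasGrad f g) (x : T3) (z : R3) :
    HasFDerivAt (fun y : R3 => f (x + toTorus y))
      (∑ i, g i (x + toTorus z) • (EuclideanSpace.proj i : R3 →L[ℝ] ℝ)) z := by
  have h1 := h (x + toTorus z)
  have h2 : HasFDerivAt (fun y : R3 => y - z) (ContinuousLinearMap.id ℝ R3) z :=
    (hasFDerivAt_id z).sub_const z
  rw [← sub_self z] at h1
  have h3 := HasFDerivAt.comp (f := fun y : R3 => y - z) z h1 h2
  rw [ContinuousLinearMap.comp_id] at h3
  refine h3.congr_of_eventuallyEq (Eventually.of_forall fun y => ?_)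
  simp [toTorus_sub]

lemma HasGrad.hasDerivAt_line (h : HasGrad f g) (x : T3) (v : R3) (s : ℝ) :
    HasDerivAt (fun s : ℝ => f (x + toTorus (s • v)))
      (∑ i, g i (x + toTorus (s • v)) * v i) s := by
  have h1 := h.hasFDerivAt x (s • v)
  have h2 : HasDerivAt (fun s : ℝ => s • v) v s := by
    simpa using (hasDerivAt_id s).smul_const v
  have h3 := h1.comp_hasDerivAt s h2
  simp only [sum_apply, smul_apply, smul_eq_mul,
    PiLp.proj_apply] at h3
  exact h3

lemma HasGrad.hasDerivAt_unitVec (h : HasGrad f g) (x : T3) (i : Fin 3) (s : ℝ) :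
    HasDerivAt (fun s : ℝ => f (x + toTorus (s • unitVec i)))
      (g i (x + toTorus (s • unitVec i))) s := by
  have h1 := h.hasDerivAt_line x (unitVec i) s
  have h2 : ∑ j, g j (x + toTorus (s • unitVec i)) * unitVec i j
      = g i (x + toTorus (s • unitVec i)) := by
    simp [unitVec]
  rwa [h2] at h1

lemma HasGrad.hasDerivAt_zero (h : HasGrad f g) (x : T3) (i : Fin 3) :
    HasDerivAt (fun s : ℝ => f (x + toTorus (s • unitVec i))) (g i x) 0 := by
  simpa [toTorus_zero] using h.hasDerivAt_unitVec x i 0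

lemma HasGrad.continuous (h : HasGrad f g) : Continuous f := by
  rw [← continuous_comp_toTorus_iff, continuous_iff_continuousAt]
  intro y
  simpa using (h.hasFDerivAt 0 y).continuousAt

lemma HasGrad.abs_sub_le (h : HasGrad f g) {C : ℝ} (hC : ∀ i x, |g i x| ≤ C) (x : T3) (y : R3) :
    |f (x + toTorus y) - f x| ≤ 3 * C * ‖y‖ := by
  have h1 := norm_image_sub_le_of_norm_deriv_le_segment_01' (E := ℝ)
    (f := fun s : ℝ => f (x + toTorus (s • y)))
    (f' := fun s => ∑ i, g i (x + toTorus (s • y)) * y i) (C := 3 * C * ‖y‖)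
    (fun s _ => (h.hasDerivAt_line x y s).hasDerivWithinAt) (fun s _ => by
      rw [Real.norm_eq_abs]
      refine (Finset.abs_sum_le_sum_abs _ _).trans ?_
      have : ∀ i ∈ (Finset.univ : Finset (Fin 3)), |g i (x + toTorus (s • y)) * y i| ≤ C * ‖y‖ := by
        intro i _
        rw [abs_mul]
        exact mul_le_mul (hC _ _) (PiLp.norm_apply_le y i) (abs_nonneg _)
          ((abs_nonneg _).trans (hC i x))
      refine (Finset.sum_le_sum this).trans ?_
      simp; linarith)
  simpa [toTorus_zero] using h1

end HasGrad

lemma TorusContDiff.exists_hasGrad {n : ℕ∞} {f : T3 → ℝ} (hf : TorusContDiff (n + 1) f) :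
    ∃ g : Fin 3 → T3 → ℝ, HasGrad f g ∧ ∀ i, TorusContDiff n (g i) := by
  -- Translation expresses the derivative at any base point through the derivative of one fixed
  -- lift, whose smoothness is known.
  have key : ∀ x y : R3, fderiv ℝ (fun z : R3 => f (toTorus x + toTorus z)) y
      = fderiv ℝ (fun z : R3 => f (toTorus z)) (x + y) := by
    intro x y
    have := fderiv_comp_add_left (𝕜 := ℝ) (f := fun z : R3 => f (toTorus z)) (x := y) x
    simpa [toTorus_add] using this
  have hd : Differentiable ℝ (fun z : R3 => f (toTorus z)) := hf.differentiable (by simp)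
  refine ⟨fun i x => fderiv ℝ (fun z : R3 => f (x + toTorus z)) 0 (unitVec i), ?_, ?_⟩
  · intro x
    obtain ⟨x, rfl⟩ := toTorus_surjective x
    have h1 : DifferentiableAt ℝ (fun y : R3 => f (toTorus x + toTorus y)) 0 := by
      simp_rw [← toTorus_add]
      exact (hd _).comp (0 : R3) (by fun_prop)
    convert h1.hasFDerivAt using 1
    ext v
    conv_rhs => rw [eq_sum_unitVec v, map_sum]
    simp [mul_comm]
  · intro i
    unfold TorusContDiff
    simp_rw [key, add_zero]
    have h2 : ContDiff ℝ n (fderiv ℝ (fun z : R3 => f (toTorus z))) :=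
      hf.fderiv_right (m := n) le_rfl
    exact h2.clm_apply contDiff_const

lemma TorusContDiff.continuous {n : WithTop ℕ∞} {f : T3 → ℝ} (hf : TorusContDiff n f) :
    Continuous f := continuous_comp_toTorus_iff.1 (ContDiff.continuous hf)

lemma exists_abs_le_of_continuous {f : T3 → ℝ} (hf : Continuous f) : ∃ C, 0 ≤ C ∧ ∀ x, |f x| ≤ C := by
  obtain ⟨C, hC⟩ := isCompact_univ.exists_bound_of_continuousOn hf.continuousOn
  exact ⟨C, (norm_nonneg _).trans (hC 0 (mem_univ _)), fun x => hC x (mem_univ _)⟩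

/-! ### Convolution of periodic functions with test kernels on ℝ³. -/

/-- The convolution of a kernel on `ℝ³` with a function on the torus. -/
def conv (K : R3 → ℝ) (f : T3 → ℝ) (x : T3) : ℝ := ∫ y : R3, K y * f (x - toTorus y)

/-- The `i`-th partial derivative of a function on `ℝ³`. -/
def pd (i : Fin 3) (K : R3 → ℝ) (y : R3) : ℝ := fderiv ℝ K y (unitVec i)

/-- Smooth compactly supported kernels. -/
structure IsTestKernel (K : R3 → ℝ) : Prop where
  contDiff : ContDiff ℝ ∞ K
  compactSupport : HasCompactSupport K

section conv

variable {K : R3 → ℝ} {f g : T3 → ℝ}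

lemma IsTestKernel.pd (hK : IsTestKernel K) (i : Fin 3) : IsTestKernel (pd i K) :=
  ⟨(hK.contDiff.fderiv_right (m := ∞) (by simp)).clm_apply contDiff_const,
    hK.compactSupport.fderiv_apply (𝕜 := ℝ) (unitVec i)⟩

lemma IsTestKernel.continuous (hK : IsTestKernel K) : Continuous K := hK.contDiff.continuous

lemma IsTestKernel.integrable (hK : IsTestKernel K) : Integrable K :=
  hK.continuous.integrable_of_hasCompactSupport hK.compactSupport

lemma IsTestKernel.integrable_mul (hK : IsTestKernel K) {h : R3 → ℝ} (hh : Continuous h) :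
    Integrable (fun y => K y * h y) :=
  (hK.continuous.mul hh).integrable_of_hasCompactSupport hK.compactSupport.mul_right

lemma conv_sub (hK : IsTestKernel K) (hf : Continuous f) (hg : Continuous g) (x : T3) :
    conv K (fun y => f y - g y) x = conv K f x - conv K g x := by
  unfold conv
  rw [← integral_sub (hK.integrable_mul (by fun_prop)) (hK.integrable_mul (by fun_prop))]
  simp_rw [mul_sub]

lemma abs_conv_le (hK : IsTestKernel K) {M : ℝ} (hM : ∀ x, |f x| ≤ M) (x : T3) :
    |conv K f x| ≤ (∫ y, |K y|) * M := by
  rw [conv, ← integral_mul_const, ← Real.norm_eq_abs]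
  refine norm_integral_le_of_norm_le (hK.integrable.abs.mul_const M) (Eventually.of_forall ?_)
  intro y
  rw [norm_mul]
  exact mul_le_mul_of_nonneg_left (hM _) (abs_nonneg _)

lemma abs_conv_sub_le (hK : IsTestKernel K) (hf : Continuous f) (hg : Continuous g)
    {M : ℝ} (hM : ∀ x, |f x - g x| ≤ M) (x : T3) :
    |conv K f x - conv K g x| ≤ (∫ y, |K y|) * M := by
  rw [← conv_sub hK hf hg]
  exact abs_conv_le hK hM x

lemma conv_shift (x : T3) (z : R3) :
    conv K f (x + toTorus z) = conv K (fun y => f (y + toTorus z)) x := by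
  unfold conv
  congr 1; ext y; congr 2; abel

lemma abs_conv_shift_le (hK : IsTestKernel K) (hf : Continuous f) {L : ℝ}
    (hL : ∀ x y, |f (x + toTorus y) - f x| ≤ L * ‖y‖) (x : T3) (y : R3) :
    |conv K f (x + toTorus y) - conv K f x| ≤ (∫ y, |K y|) * L * ‖y‖ := by
  rw [conv_shift, mul_assoc]
  exact abs_conv_sub_le hK (by fun_prop) hf (fun z => hL z y) x

lemma continuous_conv {X : Type*} [TopologicalSpace X] [FirstCountableTopology X]
    [LocallyCompactSpace X]
    (hK : IsTestKernel K) {F : X → T3 → ℝ} (hF : Continuous F.uncurry) :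
    Continuous fun p : X × T3 => conv K (F p.1) p.2 := by
  have h1 : ∀ p : X × T3, conv K (F p.1) p.2
      = ∫ y in tsupport K, K y * F p.1 (p.2 - toTorus y) := by
    intro p
    refine (setIntegral_eq_integral_of_forall_compl_eq_zero fun y hy => ?_).symm
    rw [image_eq_zero_of_notMem_tsupport hy, zero_mul]
  simp_rw [h1]
  refine continuous_parametric_integral_of_continuous ?_ hK.compactSupport
  refine (hK.continuous.comp continuous_snd).mul ?_
  exact hF.comp (f := fun a : (X × T3) × R3 => (a.1.1, a.1.2 - toTorus a.2)) (by fun_prop)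

lemma continuous_conv_apply (hK : IsTestKernel K) (hf : Continuous f) : Continuous (conv K f) := by
  have := continuous_conv (X := Unit) hK (F := fun _ => f) (hf.comp continuous_snd)
  exact this.comp (f := fun x => ((), x)) (by fun_prop)

-- The derivative falls on the kernel, so continuity of `f` suffices. All the regularity gained by
-- mollification comes from here.
open scoped Convolution in
lemma hasGrad_conv (hK : IsTestKernel K) (hf : Continuous f) :
    HasGrad (conv K f) fun i => conv (pd i K) f := by
  intro x
  have h0 : (fun y : R3 => conv K f (x + toTorus y))
      = (K ⋆[ContinuousLinearMap.mul ℝ ℝ, volume] fun z => f (x + toTorus z)) := by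
    ext y
    simp only [conv, convolution, ContinuousLinearMap.mul_apply', toTorus_sub]
    simp_rw [add_sub_assoc]
  have hg : Continuous fun z => f (x + toTorus z) := by fun_prop
  rw [h0]
  refine (hK.compactSupport.hasFDerivAt_convolution_left (ContinuousLinearMap.mul ℝ ℝ)
    (hK.contDiff.of_le (by simp)) (hg.locallyIntegrable) 0).congr_fderiv ?_
  symm
  refine ContinuousLinearMap.ext fun (v : R3) => ?_
  have hint : Integrable (fun t => ((ContinuousLinearMap.mul ℝ ℝ).precompL R3) (fderiv ℝ K t)
      (f (x + toTorus (0 - t)))) := by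
    have := (hK.compactSupport.fderiv (𝕜 := ℝ)).convolutionExists_left
      ((ContinuousLinearMap.mul ℝ ℝ).precompL R3) (hK.contDiff.continuous_fderiv (by simp))
      hg.locallyIntegrable (μ := volume) 0
    exact this
  rw [convolution_def, ContinuousLinearMap.integral_apply hint]
  simp only [ContinuousLinearMap.precompL_apply, ContinuousLinearMap.mul_apply']
  simp only [sum_apply, smul_apply, smul_eq_mul,
    PiLp.proj_apply, conv]
  simp_rw [← integral_mul_const]
  rw [← integral_finsetSum]
  · congr 1; ext t
    conv_rhs => rw [eq_sum_unitVec v, map_sum]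
    simp only [map_smul, smul_eq_mul, Finset.sum_mul, zero_sub, toTorus_neg, pd]
    refine Finset.sum_congr rfl fun i _ => ?_
    rw [sub_eq_add_neg]; ring
  · intro i _
    exact ((hK.pd i).integrable_mul (by fun_prop)).mul_const _

/-- Fubini and translation invariance: the adjoint of convolution is convolution with the reflected
kernel. -/
lemma integral_mul_conv (hK : IsTestKernel K) (hf : Continuous f) (hg : Continuous g) :
    ∫ x, g x * conv K f x = ∫ x, f x * conv (fun y => K (-y)) g x := by
  have hint : ∀ {f g : T3 → ℝ} {K : R3 → ℝ}, IsTestKernel K → Continuous f → Continuous g →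
      Integrable (fun p : T3 × R3 => g p.1 * (K p.2 * f (p.1 - toTorus p.2)))
        (volume.prod volume) := by
    intro f g K hK hf hg
    refine Continuous.integrable_of_hasCompactSupport
      (by have := hK.continuous; fun_prop) ?_
    refine HasCompactSupport.of_support_subset_isCompact
      (isCompact_univ.prod hK.compactSupport) ?_
    intro p hp
    refine ⟨mem_univ _, subset_tsupport _ ?_⟩
    simp only [Function.mem_support, ne_eq, mul_eq_zero, not_or] at hp
    exact hp.2.1
  have hK' : IsTestKernel fun y => K (-y) :=
    ⟨hK.contDiff.comp contDiff_neg, hK.compactSupport.comp_homeomorph (Homeomorph.neg R3)⟩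
  simp only [conv]
  simp_rw [← integral_const_mul]
  rw [integral_integral_swap (f := fun x y => g x * (K y * f (x - toTorus y))) (hint hK hf hg),
    integral_integral_swap (f := fun x y => f x * (K (-y) * g (x - toTorus y))) (hint hK' hg hf)]
  rw [← integral_neg_eq_self (fun y => ∫ x, g x * (K y * f (x - toTorus y)))]
  congr 1; ext y
  rw [← integral_sub_right_eq_self (fun x => g x * (K (-y) * f (x - toTorus (-y)))) (toTorus y)]
  congr 1; ext x
  simp [toTorus_neg]; ring

/-- The support of `K` is covered by finitely many unit cells, and each contributes at most sup |K|
times the L¹ norm of `f` on the torus. This L¹ to L^∞ bound later converts the energy estimate into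
a pointwise bound for the divergence. -/
lemma exists_abs_conv_le_integral (hK : IsTestKernel K) :
    ∃ C, 0 ≤ C ∧ ∀ f : T3 → ℝ, Continuous f → ∀ x, |conv K f x| ≤ C * ∫ y, |f y| := by
  obtain ⟨M, hM⟩ := hK.compactSupport.exists_bound_of_continuous hK.continuous
  obtain ⟨R, hR⟩ := hK.compactSupport.isBounded.subset_closedBall 0
  obtain ⟨N, hN⟩ := exists_nat_gt R
  have hM0 : 0 ≤ M := (norm_nonneg _).trans (hM 0)
  let I : Finset (Fin 3 → ℤ) := Fintype.piFinset fun _ => Finset.Icc (-(N : ℤ) - 1) N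
  let c : (Fin 3 → ℤ) → Set R3 := fun n =>
    (fun y : R3 => WithLp.ofLp y) ⁻¹' (univ.pi fun i => Ioc (n i : ℝ) (n i + 1))
  have hcm : ∀ n, MeasurableSet (c n) := fun n =>
    (PiLp.volume_preserving_ofLp (Fin 3)).measurable
      (MeasurableSet.univ_pi fun _ => measurableSet_Ioc)
  have hcov : tsupport K ⊆ ⋃ n ∈ I, c n := by
    intro y hy
    have hy' := hR hy
    rw [mem_closedBall_zero_iff] at hy'
    simp only [mem_iUnion]
    -- The cells are of the form (n, n + 1], hence the ceiling minus one rather than the floor.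
    refine ⟨fun i => ⌈y i⌉ - 1, ?_, ?_⟩
    · simp only [I, Fintype.mem_piFinset, Finset.mem_Icc]
      intro i
      have h1 : |y i| < N := ((PiLp.norm_apply_le y i).trans hy').trans_lt hN
      rw [abs_lt] at h1
      constructor
      · have : -(N : ℤ) ≤ ⌈y i⌉ := by
          have h2 : (-(N : ℤ) : ℝ) < ⌈y i⌉ := by
            push_cast; exact h1.1.trans_le (Int.le_ceil _)
          exact_mod_cast h2.le
        linarith
      · have : ⌈y i⌉ ≤ (N : ℤ) := Int.ceil_le.2 (by exact_mod_cast h1.2.le)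
        linarith
    · simp only [c, mem_preimage, mem_univ_pi, mem_Ioc]
      intro i
      push_cast
      exact ⟨by linarith [Int.ceil_lt_add_one (y i)], by linarith [Int.le_ceil (y i)]⟩
  refine ⟨M * I.card, by positivity, fun f hf x => ?_⟩
  have hcell : ∀ n, IntegrableOn (fun y => |f (x - toTorus y)|) (c n) ∧
      ∫ y in c n, |f (x - toTorus y)| = ∫ y, |f y| := by
    intro n
    have hmp := measurePreserving_toTorus_cell fun i => (n i : ℝ)
    have hc : Continuous fun z : T3 => |f (x - z)| := by fun_prop
    constructor
    · exact hmp.integrable_comp_of_integrable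
        (hc.integrable_of_hasCompactSupport (HasCompactSupport.of_compactSpace _))
    · have h1 := hmp.map_eq
      have h2 := integral_map (μ := volume.restrict (c n)) hmp.measurable.aemeasurable
        (f := fun z : T3 => |f (x - z)|) hc.aestronglyMeasurable
      rw [h1] at h2
      rw [← h2]
      exact integral_sub_left_eq_self (fun z => |f z|) volume x
  rw [conv]
  have h1 : |∫ y, K y * f (x - toTorus y)| ≤ ∫ y, |K y * f (x - toTorus y)| :=
    abs_integral_le_integral_abs
  have h2 : ∫ y, |K y * f (x - toTorus y)|
      = ∫ y in ⋃ n ∈ I, c n, |K y * f (x - toTorus y)| := by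
    refine (setIntegral_eq_integral_of_forall_compl_eq_zero fun y hy => ?_).symm
    rw [image_eq_zero_of_notMem_tsupport (fun h => hy (hcov h)), zero_mul, abs_zero]
  have hint : Integrable (fun y => |K y * f (x - toTorus y)|) :=
    (hK.integrable_mul (by fun_prop)).abs
  have h3 : ∫ y in ⋃ n ∈ I, c n, |K y * f (x - toTorus y)|
      = ∑ n ∈ I, ∫ y in c n, |K y * f (x - toTorus y)| := by
    refine integral_biUnion_finset I (fun n _ => hcm n) ?_ (fun n _ => hint.integrableOn)
    intro n _ n' _ hne
    rw [Function.onFun, Set.disjoint_left]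
    intro y hy hy'
    apply hne
    ext i
    simp only [c, mem_preimage, mem_univ_pi, mem_Ioc] at hy hy'
    have ha : (n i : ℝ) < n' i + 1 := (hy i).1.trans_le (hy' i).2
    have hb : (n' i : ℝ) < n i + 1 := (hy' i).1.trans_le (hy i).2
    have ha' : n i < n' i + 1 := by exact_mod_cast ha
    have hb' : n' i < n i + 1 := by exact_mod_cast hb
    omega
  have h4 : ∀ n ∈ I, ∫ y in c n, |K y * f (x - toTorus y)| ≤ M * ∫ y, |f y| := by
    intro n _
    rw [← (hcell n).2, ← integral_const_mul]
    refine integral_mono hint.integrableOn ((hcell n).1.const_mul M) fun y => ?_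
    simp only [abs_mul]
    exact mul_le_mul_of_nonneg_right (hM y) (abs_nonneg _)
  rw [h2, h3] at h1
  refine h1.trans ((Finset.sum_le_sum h4).trans ?_)
  rw [Finset.sum_const, nsmul_eq_mul]
  exact le_of_eq (by ring)

end conv

/-! ### Weak derivatives on the torus and on the space-time cylinder. -/

lemma HasGrad.torusPartial_eq {f : T3 → ℝ} {g : Fin 3 → T3 → ℝ} (h : HasGrad f g) (i : Fin 3) :
    torusPartial i f = g i := by
  ext x
  have := (h.hasDerivAt_zero x i).deriv
  simp_rw [toTorus_smul_unitVec] at this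
  exact this

lemma torusPartial_const (i : Fin 3) (c : ℝ) : torusPartial i (fun _ => c) = 0 := by
  ext x; simp [torusPartial]

lemma integrable_of_continuous {f : T3 → ℝ} (hf : Continuous f) : Integrable f :=
  hf.integrable_of_hasCompactSupport (HasCompactSupport.of_compactSpace _)

/-- A function which is Lipschitz continuous in the direction `i` is weakly differentiable in this
direction, with its almost everywhere defined derivative as weak derivative. -/
lemma hasWeakPartial_of_ae_hasDerivAt {f g : T3 → ℝ} {i : Fin 3} {L : ℝ} (hf : Continuous f)
    (hL : ∀ x (s : ℝ), |f (x + toTorus (s • unitVec i)) - f x| ≤ L * |s|)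
    (hg : AEStronglyMeasurable g volume)
    (hd : ∀ᵐ x, HasDerivAt (fun s : ℝ => f (x + toTorus (s • unitVec i))) (g x) 0) :
    HasWeakPartial i f g := by
  have hL0 : 0 ≤ L := by simpa using (abs_nonneg _).trans (hL 0 1)
  have hgb : ∀ᵐ x, ‖g x‖ ≤ L := by
    filter_upwards [hd] with x hx
    refine hx.le_of_lip' hL0 (Eventually.of_forall fun s => ?_)
    simpa [toTorus_zero] using hL x s
  have hgi : Integrable g := Integrable.of_bound hg L hgb
  refine ⟨integrable_of_continuous hf, hgi, fun φ hφ => ?_⟩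
  obtain ⟨ψ, hψ, hψs⟩ := TorusContDiff.exists_hasGrad (n := ⊤) (f := φ) hφ
  rw [hψ.torusPartial_eq]
  have hφc : Continuous φ := hψ.continuous
  obtain ⟨Cf, hCf0, hCf⟩ := exists_abs_le_of_continuous hf
  obtain ⟨Cφ, hCφ0, hCφ⟩ := exists_abs_le_of_continuous hφc
  choose Cψ hCψ0 hCψ using fun j => exists_abs_le_of_continuous (hψs j).continuous
  have hφL : ∀ x (s : ℝ), |φ (x + toTorus (s • unitVec i)) - φ x| ≤ 3 * (∑ j, Cψ j) * |s| := by
    intro x s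
    have := hψ.abs_sub_le (C := ∑ j, Cψ j) (fun j x => (hCψ j x).trans
      (Finset.single_le_sum (fun k _ => hCψ0 k) (Finset.mem_univ j))) x (s • unitVec i)
    simpa [norm_smul, norm_unitVec] using this
  have hA : Tendsto (fun s : ℝ => ∫ x, f x * (s⁻¹ * (φ (x + toTorus (s • unitVec i)) - φ x)))
      (𝓝[≠] 0) (𝓝 (∫ x, f x * ψ i x)) := by
    refine tendsto_integral_filter_of_dominated_convergence
      (fun _ => Cf * (3 * ∑ j, Cψ j)) (Eventually.of_forall fun s => ?_) ?_
      (integrable_const _) (Eventually.of_forall fun x => ?_)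
    · exact Continuous.aestronglyMeasurable (by fun_prop)
    · filter_upwards [self_mem_nhdsWithin] with s hs
      refine Eventually.of_forall fun x => ?_
      have hs' : 0 < |s| := abs_pos.2 hs
      rw [Real.norm_eq_abs, abs_mul, abs_mul, abs_inv]
      refine mul_le_mul (hCf x) ?_ (by positivity) hCf0
      rw [inv_mul_le_iff₀ hs', mul_comm]
      exact hφL x s
    · have := (hasDerivAt_iff_tendsto_slope_zero.1 (hψ.hasDerivAt_zero x i)).const_mul (f x)
      simpa [toTorus_zero] using this
  have hB : Tendsto (fun s : ℝ => ∫ x, s⁻¹ * (f (x - toTorus (s • unitVec i)) - f x) * φ x)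
      (𝓝[≠] 0) (𝓝 (∫ x, -g x * φ x)) := by
    refine tendsto_integral_filter_of_dominated_convergence
      (fun _ => L * Cφ) (Eventually.of_forall fun s => ?_) ?_
      (integrable_const _) ?_
    · exact Continuous.aestronglyMeasurable (by fun_prop)
    · filter_upwards [self_mem_nhdsWithin] with s hs
      refine Eventually.of_forall fun x => ?_
      have hs' : 0 < |s| := abs_pos.2 hs
      rw [Real.norm_eq_abs, abs_mul, abs_mul, abs_inv]
      refine mul_le_mul ?_ (hCφ x) (by positivity) hL0
      rw [inv_mul_le_iff₀ hs', mul_comm]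
      have := hL x (-s)
      rwa [abs_neg, neg_smul, toTorus_neg, ← sub_eq_add_neg] at this
    · filter_upwards [hd] with x hx
      have h1 : HasDerivAt (fun s : ℝ => f (x - toTorus (s • unitVec i))) (-g x) 0 := by
        have h2 : HasDerivAt (fun s : ℝ => f (x + toTorus (s • unitVec i))) (g x) (-0) := by
          simpa using hx
        have := h2.comp (0 : ℝ) (hasDerivAt_neg 0)
        simpa [Function.comp_def, neg_smul, toTorus_neg, ← sub_eq_add_neg] using this
      have := (hasDerivAt_iff_tendsto_slope_zero.1 h1).mul_const (φ x)
      simpa [toTorus_zero] using this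
  -- Discrete integration by parts: translation invariance moves the difference quotient from `φ` to
  -- `f`, reversing the step. Both sides converge by dominated convergence as `s` tends to 0.
  have hAB : ∀ s : ℝ, ∫ x, f x * (s⁻¹ * (φ (x + toTorus (s • unitVec i)) - φ x))
      = ∫ x, s⁻¹ * (f (x - toTorus (s • unitVec i)) - f x) * φ x := by
    intro s
    have h1 : ∀ x, f x * (s⁻¹ * (φ (x + toTorus (s • unitVec i)) - φ x))
        = s⁻¹ * (f x * φ (x + toTorus (s • unitVec i))) - s⁻¹ * (f x * φ x) := fun x => by ring
    have h2 : ∀ x, s⁻¹ * (f (x - toTorus (s • unitVec i)) - f x) * φ x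
        = s⁻¹ * (f (x - toTorus (s • unitVec i)) * φ x) - s⁻¹ * (f x * φ x) := fun x => by ring
    simp_rw [h1, h2]
    rw [integral_sub, integral_sub]
    · congr 1
      rw [integral_const_mul, integral_const_mul,
        ← integral_sub_right_eq_self _ (toTorus (s • unitVec i))]
      simp
    all_goals exact integrable_of_continuous (by fun_prop)
  simp_rw [hAB] at hA
  rw [tendsto_nhds_unique hA hB]
  simp [integral_neg]

/-- Test with the constant 1, which is admissible because the torus has no boundary. This removes
every flux term from the energy balance. -/
lemma HasWeakPartial.integral_eq_zero {f g : T3 → ℝ} {i : Fin 3} (h : HasWeakPartial i f g) :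
    ∫ x, g x = 0 := by
  have := h.2.2 (fun _ => 1) contDiff_const
  simpa [torusPartial_const] using this.symm

instance (T : ℝ) : IsFiniteMeasure (spaceTime T) := by
  unfold spaceTime; infer_instance

lemma spaceTime_eq (T : ℝ) :
    spaceTime T = ((volume : Measure ℝ).prod (volume : Measure T3)).restrict (Ioo 0 T ×ˢ univ) := by
  rw [spaceTime, ← Measure.prod_restrict, Measure.restrict_univ]

lemma ae_spaceTime_of_ae {T : ℝ} {p : ℝ × T3 → Prop}
    (h : ∀ᵐ z ∂((volume : Measure ℝ).prod (volume : Measure T3)), p z) :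
    ∀ᵐ z ∂(spaceTime T), p z := by
  rw [spaceTime_eq]; exact ae_restrict_of_ae h

lemma ae_spaceTime_mem (T : ℝ) : ∀ᵐ z ∂(spaceTime T), z.1 ∈ Ioo 0 T := by
  rw [spaceTime_eq]
  filter_upwards [ae_restrict_mem (measurableSet_Ioo.prod MeasurableSet.univ)] with z hz
  exact hz.1

lemma memLpLp_of_bound {T : ℝ} {p : ENNReal} {f : ℝ → T3 → ℝ} {C : ℝ}
    (hf : Measurable f.uncurry) (hC : ∀ t x, |f t x| ≤ C) : MemLpLp T p f :=
  MemLp.of_bound hf.aestronglyMeasurable C (Eventually.of_forall fun z => hC z.1 z.2)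

lemma hasWeakSpaceDeriv_of_hasDerivAt {T : ℝ} {i : Fin 3} {f g : ℝ → T3 → ℝ} {C C' : ℝ}
    (hf : Continuous f.uncurry) (hg : Continuous g.uncurry)
    (hC : ∀ t x, |f t x| ≤ C) (hC' : ∀ t x, |g t x| ≤ C')
    (hd : ∀ t x, HasDerivAt (fun s : ℝ => f t (x + toTorus (s • unitVec i))) (g t x) 0) :
    HasWeakSpaceDeriv T i f g := by
  refine ⟨memLpLp_of_bound hf.measurable hC, memLpLp_of_bound hg.measurable hC',
    Eventually.of_forall fun t => ?_⟩
  have hft : Continuous (f t) := hf.comp (f := fun x => (t, x)) (by fun_prop)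
  have hgt : Continuous (g t) := hg.comp (f := fun x => (t, x)) (by fun_prop)
  refine hasWeakPartial_of_ae_hasDerivAt (L := C') hft (fun x s => ?_) hgt.aestronglyMeasurable
    (Eventually.of_forall fun x => hd t x)
  have h1 : ∀ r : ℝ, HasDerivAt (fun s : ℝ => f t (x + toTorus (s • unitVec i)))
      (g t (x + toTorus (r • unitVec i))) r := by
    intro r
    have h2 := hd t (x + toTorus (r • unitVec i))
    rw [← sub_self r] at h2
    have h3 := HasDerivAt.comp (h := fun q : ℝ => q - r) r h2 ((hasDerivAt_id r).sub_const r)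
    rw [mul_one] at h3
    refine h3.congr_of_eventuallyEq (Eventually.of_forall fun q => ?_)
    simp only [Function.comp, add_assoc, ← toTorus_add, ← add_smul]
    congr; ring
  have h4 := Convex.norm_image_sub_le_of_norm_hasDerivWithin_le (s := univ) (x := (0 : ℝ)) (y := s)
    (fun r _ => (h1 r).hasDerivWithinAt) (fun r _ => hC' t _) convex_univ (mem_univ _) (mem_univ _)
  simpa [toTorus_zero] using h4

/-! ### Lipschitz functions of space and time and their almost everywhere derivatives. -/

/-- Lipschitz continuity in space and time. -/
def STLip (L : ℝ) (f : ℝ → T3 → ℝ) : Prop :=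
  ∀ s t x y, |f s (x + toTorus y) - f t x| ≤ L * (|s - t| + ‖y‖)

/-- The space-time derivative of a function on `ℝ × 𝕋³`. -/
def stDeriv (f : ℝ → T3 → ℝ) (t : ℝ) (x : T3) : ℝ × R3 →L[ℝ] ℝ :=
  fderiv ℝ (fun p : ℝ × R3 => f p.1 (toTorus p.2)) (t, rep x)

section STLip

variable {L : ℝ} {f : ℝ → T3 → ℝ}

lemma STLip.nonneg (hf : STLip L f) : 0 ≤ L := by
  simpa using (abs_nonneg _).trans (hf 1 0 0 0)

/-- The factor 2 comes from the maximum norm on ℝ × ℝ³: each of the two increments is at most the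
distance. -/
lemma STLip.lipschitzWith (hf : STLip L f) :
    LipschitzWith (2 * L).toNNReal (fun p : ℝ × R3 => f p.1 (toTorus p.2)) := by
  refine LipschitzWith.of_dist_le' fun p q => ?_
  have h := hf p.1 q.1 (toTorus q.2) (p.2 - q.2)
  rw [← toTorus_add, add_sub_cancel] at h
  rw [Real.dist_eq]
  refine h.trans ?_
  have h1 : |p.1 - q.1| ≤ dist p q := by rw [← Real.dist_eq]; exact le_max_left _ _
  have h2 : ‖p.2 - q.2‖ ≤ dist p q := by rw [← dist_eq_norm]; exact le_max_right _ _
  have := hf.nonneg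
  nlinarith

lemma STLip.continuous (hf : STLip L f) : Continuous f.uncurry := by
  have h1 : IsOpenQuotientMap (Prod.map (id : ℝ → ℝ) toTorus) :=
    IsOpenQuotientMap.id.prodMap isOpenQuotientMap_toTorus
  rw [h1.isQuotientMap.continuous_iff]
  exact hf.lipschitzWith.continuous

lemma STLip.abs_stDeriv_le (hf : STLip L f) (t : ℝ) (x : T3) (v : ℝ × R3) :
    |stDeriv f t x v| ≤ 2 * L * ‖v‖ := by
  have h1 : ‖stDeriv f t x‖ ≤ 2 * L := by
    have := norm_fderiv_le_of_lipschitz ℝ hf.lipschitzWith (x₀ := (t, rep x))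
    rwa [Real.coe_toNNReal _ (by linarith [hf.nonneg])] at this
  exact ((stDeriv f t x).le_opNorm v).trans (by gcongr)

lemma measurable_stDeriv (f : ℝ → T3 → ℝ) (v : ℝ × R3) :
    Measurable fun z : ℝ × T3 => stDeriv f z.1 z.2 v := by
  have h1 := measurable_fderiv_apply_const ℝ (fun p : ℝ × R3 => f p.1 (toTorus p.2)) v
  exact h1.comp (measurable_fst.prodMk (measurable_rep.comp measurable_snd))

/-- Rademacher's theorem for the lift to ℝ × ℝ³, pulled back along the section `rep` and recentred
at the point by a translation. -/
lemma STLip.ae_hasFDerivAt (hf : STLip L f) :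
    ∀ᵐ z ∂((volume : Measure ℝ).prod (volume : Measure T3)),
      HasFDerivAt (fun p : ℝ × R3 => f p.1 (z.2 + toTorus p.2)) (stDeriv f z.1 z.2) (z.1, 0) := by
  have h1 := hf.lipschitzWith.ae_differentiableAt
    (μ := (volume : Measure ℝ).prod (volume : Measure R3))
  have h2 : Measure.QuasiMeasurePreserving (Prod.map (id : ℝ → ℝ) rep)
      ((volume : Measure ℝ).prod (volume : Measure T3)) (volume.prod volume) := by
    obtain ⟨s, hs⟩ := exists_measurePreserving_rep
    have h3 := (MeasurePreserving.id (volume : Measure ℝ)).prod hs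
    refine ⟨h3.measurable, ?_⟩
    rw [h3.map_eq]
    exact Measure.AbsolutelyContinuous.rfl.prod Measure.restrict_le_self.absolutelyContinuous
  filter_upwards [h2.ae h1] with z hz
  have h4 : HasFDerivAt (fun p : ℝ × R3 => f p.1 (toTorus p.2)) (stDeriv f z.1 z.2)
      ((z.1, (0 : R3)) + (0, rep z.2)) := by
    rw [Prod.mk_add_mk, add_zero, zero_add]
    exact hz.hasFDerivAt
  have h5 := HasFDerivAt.comp (f := fun p : ℝ × R3 => p + (0, rep z.2)) (z.1, (0 : R3)) h4
    ((hasFDerivAt_id _).add_const _)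
  rw [ContinuousLinearMap.comp_id] at h5
  refine h5.congr_of_eventuallyEq (Eventually.of_forall fun p => ?_)
  simp [toTorus_add, toTorus_rep, add_comm]

lemma hasDerivAt_space_of_hasFDerivAt {t : ℝ} {x : T3} {D : ℝ × R3 →L[ℝ] ℝ}
    (h : HasFDerivAt (fun p : ℝ × R3 => f p.1 (x + toTorus p.2)) D (t, 0)) (i : Fin 3) :
    HasDerivAt (fun s : ℝ => f t (x + toTorus (s • unitVec i))) (D (0, unitVec i)) 0 := by
  have h2 : HasDerivAt (fun s : ℝ => ((t, s • unitVec i) : ℝ × R3)) (0, unitVec i) 0 := by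
    have := ((hasDerivAt_id (0 : ℝ)).smul_const (unitVec i))
    rw [one_smul] at this
    exact (hasDerivAt_const (0 : ℝ) t).prodMk this
  have h3 : HasFDerivAt (fun p : ℝ × R3 => f p.1 (x + toTorus p.2)) D (t, (0 : ℝ) • unitVec i) := by
    rwa [zero_smul]
  exact h3.comp_hasDerivAt (0 : ℝ) h2

lemma hasDerivAt_time_of_hasFDerivAt {t : ℝ} {x : T3} {D : ℝ × R3 →L[ℝ] ℝ}
    (h : HasFDerivAt (fun p : ℝ × R3 => f p.1 (x + toTorus p.2)) D (t, 0)) :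
    HasDerivAt (fun s : ℝ => f s x) (D (1, 0)) t := by
  have h2 : HasDerivAt (fun s : ℝ => ((s, 0) : ℝ × R3)) (1, 0) t :=
    (hasDerivAt_id t).prodMk (hasDerivAt_const t (0 : R3))
  have h3 := h.comp_hasDerivAt t h2
  simpa [Function.comp_def, toTorus_zero] using h3

lemma STLip.abs_le_of_memLp (hf : STLip L f) (T : ℝ) {C : ℝ} (hC : ∀ t x, |f t x| ≤ C)
    (p : ENNReal) : MemLpLp T p f := memLpLp_of_bound hf.continuous.measurable hC

lemma memLpLp_stDeriv (hf : STLip L f) (T : ℝ) (p : ENNReal) (v : ℝ × R3) :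
    MemLpLp T p fun t x => stDeriv f t x v :=
  memLpLp_of_bound (measurable_stDeriv f v) fun t x => hf.abs_stDeriv_le t x v

lemma STLip.hasWeakSpaceDeriv (hf : STLip L f) (T : ℝ) {C : ℝ} (hC : ∀ t x, |f t x| ≤ C)
    (i : Fin 3) : HasWeakSpaceDeriv T i f fun t x => stDeriv f t x (0, unitVec i) := by
  refine ⟨memLpLp_of_bound hf.continuous.measurable hC, memLpLp_stDeriv hf T 1 _, ?_⟩
  have h1 := Measure.ae_ae_of_ae_prod hf.ae_hasFDerivAt
  refine ae_restrict_of_ae ?_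
  filter_upwards [h1] with t ht
  refine hasWeakPartial_of_ae_hasDerivAt (L := L)
    (hf.continuous.comp (f := fun x => (t, x)) (by fun_prop)) (fun x s => ?_)
    ((measurable_stDeriv f _).comp (measurable_prodMk_left (x := t))).aestronglyMeasurable ?_
  · simpa [norm_smul, norm_unitVec] using hf t t x (s • unitVec i)
  · filter_upwards [ht] with x hx
    exact hasDerivAt_space_of_hasFDerivAt hx i

lemma STLip.ae_ae_hasDerivAt_time (hf : STLip L f) :
    ∀ᵐ x : T3, ∀ᵐ t : ℝ, HasDerivAt (fun s => f s x) (stDeriv f t x (1, 0)) t := by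
  have h1 := (Measure.measurePreserving_swap (μ := (volume : Measure T3))
    (ν := (volume : Measure ℝ))).quasiMeasurePreserving.ae hf.ae_hasFDerivAt
  filter_upwards [Measure.ae_ae_of_ae_prod h1] with x hx
  filter_upwards [hx] with t ht
  exact hasDerivAt_time_of_hasFDerivAt ht

lemma STLip.absolutelyContinuous (hf : STLip L f) (x : T3) (a b : ℝ) :
    AbsolutelyContinuousOnInterval (fun t => f t x) a b := by
  have : LipschitzWith L.toNNReal fun t => f t x := by
    refine LipschitzWith.of_dist_le' fun s t => ?_
    simpa [toTorus_zero, Real.dist_eq] using hf s t x 0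
  exact this.lipschitzOnWith.absolutelyContinuousOnInterval

/-- For almost every fixed `x` the function of time is absolutely continuous with the right
derivative. The exceptional null set does not depend on the endpoints `a`, `b`. -/
lemma STLip.ae_integral_stDeriv (hf : STLip L f) :
    ∀ᵐ x : T3, ∀ a b : ℝ, ∫ t in a..b, stDeriv f t x (1, 0) = f b x - f a x := by
  filter_upwards [hf.ae_ae_hasDerivAt_time] with x hx a b
  rw [← (hf.absolutelyContinuous x a b).integral_deriv_eq_sub]
  refine intervalIntegral.integral_congr_ae ?_
  filter_upwards [hx] with t ht _
  exact ht.deriv.symm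

/-- Integration by parts for absolutely continuous functions of time, at almost every fixed `x`. -/
lemma STLip.hasWeakTimeDeriv (hf : STLip L f) {T : ℝ} (hT : 0 ≤ T) {C : ℝ}
    (hC : ∀ t x, |f t x| ≤ C) : HasWeakTimeDeriv T f fun t x => stDeriv f t x (1, 0) := by
  refine ⟨memLpLp_of_bound hf.continuous.measurable hC, memLpLp_stDeriv hf T 1 _, ?_⟩
  intro φ hφ hφc hφs
  filter_upwards [hf.ae_ae_hasDerivAt_time] with x hx
  have hφac : AbsolutelyContinuousOnInterval φ 0 T := by
    obtain ⟨K, hK⟩ := (hφ.of_le (by simp : (1 : WithTop ℕ∞) ≤ ∞)).lipschitzWith_of_hasCompactSupport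
      hφc (by simp)
    exact hK.lipschitzOnWith.absolutelyContinuousOnInterval
  have h1 := (hf.absolutelyContinuous x 0 T).integral_mul_deriv_eq_deriv_mul hφac
  have h0 : φ 0 = 0 := image_eq_zero_of_notMem_tsupport fun h => by simpa using (hφs h).1
  have hT' : φ T = 0 := image_eq_zero_of_notMem_tsupport fun h => by simpa using (hφs h).2
  rw [h0, hT', mul_zero, mul_zero, sub_self, zero_sub] at h1
  have h2 : ∀ h : ℝ → ℝ, ∫ t in Ioo 0 T, h t = ∫ t in (0 : ℝ)..T, h t := by
    intro h
    rw [intervalIntegral.integral_of_le hT, integral_Ioc_eq_integral_Ioo]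
  rw [h2, h2]
  simp_rw [mul_comm (deriv φ _)]
  rw [h1]
  congr 1
  refine intervalIntegral.integral_congr_ae ?_
  filter_upwards [hx] with t ht _
  rw [ht.deriv, mul_comm]

end STLip

/-! ### The heat semigroup as a Gaussian average. -/

lemma integrable_exp_neg_mul_sq_norm {b : ℝ} (hb : 0 < b) :
    Integrable (fun z : R3 => Real.exp (-b * ‖z‖ ^ 2)) := by
  have h := (GaussianFourier.integrable_cexp_neg_mul_sq_norm_add (V := R3) (b := (b : ℂ))
    (by simpa using hb) 0 0).norm
  refine h.congr (Eventually.of_forall fun z => ?_)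
  simp only [Complex.norm_exp]
  norm_num
  left
  norm_cast

/-- The standard Gaussian density on `ℝ³`. -/
def gauss (z : R3) : ℝ :=
  (∫ z : R3, Real.exp (-(1 / 2) * ‖z‖ ^ 2))⁻¹ * Real.exp (-(1 / 2) * ‖z‖ ^ 2)

lemma gauss_nonneg (z : R3) : 0 ≤ gauss z :=
  mul_nonneg (inv_nonneg.2 (integral_nonneg fun _ => (Real.exp_pos _).le)) (Real.exp_pos _).le

lemma integrable_gauss : Integrable gauss :=
  (integrable_exp_neg_mul_sq_norm (by norm_num)).const_mul _

lemma integral_gauss : ∫ z, gauss z = 1 := by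
  unfold gauss
  rw [integral_const_mul, inv_mul_cancel₀]
  rw [GaussianFourier.integral_rexp_neg_mul_sq_norm (by norm_num)]
  positivity

lemma hasFDerivAt_gauss (z : R3) :
    HasFDerivAt gauss (-(gauss z) • (innerSL ℝ z)) z := by
  have h1 : HasFDerivAt (fun z : R3 => ‖z‖ ^ 2) (2 • (innerSL ℝ z)) z :=
    (hasStrictFDerivAt_norm_sq z).hasFDerivAt
  have h2 := ((h1.const_mul (-(1 / 2) : ℝ)).exp).const_mul
    (∫ z : R3, Real.exp (-(1 / 2) * ‖z‖ ^ 2))⁻¹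
  refine h2.congr_fderiv ?_
  ext v
  simp [gauss]
  ring

@[fun_prop]
lemma continuous_gauss : Continuous gauss := by unfold gauss; fun_prop

lemma integrable_norm_mul_gauss : Integrable fun z => ‖z‖ * gauss z := by
  have h1 := ((integrable_exp_neg_mul_sq_norm (b := 1 / 4) (by norm_num)).const_mul
    (∫ z : R3, Real.exp (-(1 / 2) * ‖z‖ ^ 2))⁻¹)
  refine h1.mono' (by fun_prop) (Eventually.of_forall fun z => ?_)
  rw [Real.norm_of_nonneg (mul_nonneg (norm_nonneg z) (gauss_nonneg z)), gauss]
  have h0 : (0 : ℝ) ≤ (∫ z : R3, Real.exp (-(1 / 2) * ‖z‖ ^ 2))⁻¹ :=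
    inv_nonneg.2 (integral_nonneg fun _ => (Real.exp_pos _).le)
  -- The linear factor is absorbed by giving up half of the Gaussian exponent.
  have h2 : ‖z‖ ≤ Real.exp (1 / 4 * ‖z‖ ^ 2) := by
    have := Real.add_one_le_exp (1 / 4 * ‖z‖ ^ 2)
    nlinarith [sq_nonneg (‖z‖ - 2)]
  have h3 : Real.exp (-(1 / 4) * ‖z‖ ^ 2)
      = Real.exp (1 / 4 * ‖z‖ ^ 2) * Real.exp (-(1 / 2) * ‖z‖ ^ 2) := by
    rw [← Real.exp_add]; congr 1; ring
  rw [h3]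
  have := mul_le_mul_of_nonneg_right h2 (Real.exp_pos (-(1 / 2) * ‖z‖ ^ 2)).le
  nlinarith

lemma integrable_gauss_mul {h : R3 → ℝ} {M : ℝ} (hh : Continuous h) (hM : ∀ z, |h z| ≤ M) :
    Integrable fun z => gauss z * h z :=
  integrable_gauss.mul_bdd (c := M) hh.aestronglyMeasurable (Eventually.of_forall hM)

/-- The heat semigroup on the torus, as a Gaussian average. -/
def heat (t : ℝ) (g : T3 → ℝ) (x : T3) : ℝ :=
  ∫ z, gauss z * g (x + toTorus (√(2 * t) • z))

section heat

variable {g : T3 → ℝ} {M : ℝ}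

lemma integrable_heat (hg : Continuous g) (t : ℝ) (x : T3) :
    Integrable fun z => gauss z * g (x + toTorus (√(2 * t) • z)) := by
  obtain ⟨M, -, hM⟩ := exists_abs_le_of_continuous hg
  exact integrable_gauss_mul (by fun_prop) fun z => hM _

lemma heat_sub {f : T3 → ℝ} (hf : Continuous f) (hg : Continuous g) (t : ℝ) (x : T3) :
    heat t (fun y => f y - g y) x = heat t f x - heat t g x := by
  unfold heat
  rw [← integral_sub (integrable_heat hf t x) (integrable_heat hg t x)]
  simp_rw [mul_sub]

lemma abs_heat_le (hM : ∀ x, |g x| ≤ M) (t : ℝ) (x : T3) : |heat t g x| ≤ M := by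
  have h1 : M = ∫ z, gauss z * M := by rw [integral_mul_const, integral_gauss, one_mul]
  rw [heat, ← Real.norm_eq_abs, h1]
  refine norm_integral_le_of_norm_le (integrable_gauss.mul_const M) (Eventually.of_forall ?_)
  intro z
  rw [norm_mul, Real.norm_of_nonneg (gauss_nonneg z)]
  exact mul_le_mul_of_nonneg_left (hM _) (gauss_nonneg z)

lemma abs_heat_sub_le {f : T3 → ℝ} (hf : Continuous f) (hg : Continuous g)
    (hM : ∀ x, |f x - g x| ≤ M) (t : ℝ) (x : T3) : |heat t f x - heat t g x| ≤ M := by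
  rw [← heat_sub hf hg]
  exact abs_heat_le hM t x

lemma heat_shift (t : ℝ) (x y : T3) : heat t g (x + y) = heat t (fun z => g (z + y)) x := by
  unfold heat
  congr 1; ext z; congr 2; abel

lemma abs_heat_shift_le (hg : Continuous g) {L : ℝ}
    (hL : ∀ x y, |g (x + toTorus y) - g x| ≤ L * ‖y‖) (t : ℝ) (x : T3) (y : R3) :
    |heat t g (x + toTorus y) - heat t g x| ≤ L * ‖y‖ := by
  rw [heat_shift]
  exact abs_heat_sub_le (by fun_prop) hg (fun z => hL z y) t x

/-- The square root of a negative number is 0 by convention, so the semigroup is extended by the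
identity to negative times and stays continuous across 0. -/
lemma heat_of_nonpos {t : ℝ} (ht : t ≤ 0) (x : T3) : heat t g x = g x := by
  have : √(2 * t) = 0 := Real.sqrt_eq_zero_of_nonpos (by linarith)
  simp [heat, this, toTorus_zero, integral_mul_const, integral_gauss]

/-- In the rescaled form the Gaussian weight does not depend on time, so nothing degenerates at time
0. Joint continuity is needed at the endpoint of the Duhamel integral. -/
lemma continuous_heat {X : Type*} [TopologicalSpace X] [FirstCountableTopology X]
    {F : X → T3 → ℝ} (hF : Continuous F.uncurry) (hM : ∀ p x, |F p x| ≤ M) :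
    Continuous fun q : ℝ × X × T3 => heat q.1 (F q.2.1) q.2.2 := by
  unfold heat
  have h1 : Continuous fun a : (ℝ × X × T3) × R3 =>
      F a.1.2.1 (a.1.2.2 + toTorus (√(2 * a.1.1) • a.2)) :=
    hF.comp (f := fun a : (ℝ × X × T3) × R3 =>
      (a.1.2.1, a.1.2.2 + toTorus (√(2 * a.1.1) • a.2))) (by fun_prop)
  refine continuous_of_dominated (bound := fun z => gauss z * M) (fun q => ?_) (fun q => ?_)
    (integrable_gauss.mul_const M) (Eventually.of_forall fun z => ?_)
  · exact (continuous_gauss.mul (h1.comp (Continuous.prodMk_right q))).aestronglyMeasurable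
  · refine Eventually.of_forall fun z => ?_
    rw [norm_mul, Real.norm_of_nonneg (gauss_nonneg z)]
    exact mul_le_mul_of_nonneg_left (hM _ _) (gauss_nonneg z)
  · exact continuous_const.mul (h1.comp (Continuous.prodMk_left z))

variable {G : Fin 3 → T3 → ℝ} {GG : Fin 3 → Fin 3 → T3 → ℝ}

lemma HasGrad.heat_space (h : HasGrad g G) (hG : ∀ i, Continuous (G i)) (t : ℝ) (x : T3)
    (i : Fin 3) :
    HasDerivAt (fun s : ℝ => heat t g (x + toTorus (s • unitVec i))) (heat t (G i) x) 0 := by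
  obtain ⟨C, hC0, hC⟩ := exists_abs_le_of_continuous (hG i)
  have hg := h.continuous
  have hGi := hG i
  unfold heat
  have := (hasDerivAt_integral_of_dominated_loc_of_deriv_le (μ := (volume : Measure R3))
    (F := fun (s : ℝ) z => gauss z * g (x + toTorus (s • unitVec i) + toTorus (√(2 * t) • z)))
    (F' := fun s z => gauss z * G i (x + toTorus (s • unitVec i) + toTorus (√(2 * t) • z)))
    (x₀ := 0) (s := univ) (bound := fun z => gauss z * C) univ_mem
    (Eventually.of_forall fun s => Continuous.aestronglyMeasurable (by fun_prop))
    (integrable_heat hg _ _) (Continuous.aestronglyMeasurable (by fun_prop))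
    (Eventually.of_forall fun z s _ => ?_) (integrable_gauss.mul_const C)
    (Eventually.of_forall fun z s _ => ?_)).2
  · simpa [toTorus_zero] using this
  · rw [norm_mul, Real.norm_of_nonneg (gauss_nonneg z)]
    exact mul_le_mul_of_nonneg_left (hC _) (gauss_nonneg z)
  · have := (h.hasDerivAt_unitVec (x + toTorus (√(2 * t) • z)) i s).const_mul (gauss z)
    simpa only [add_right_comm] using this

/-- Gaussian integration by parts: the i-th derivative of the Gaussian is -zᵢ times the Gaussian,
and differentiating z ↦ g(x + az) yields the factor `a`. -/
lemma integral_gauss_mul_coord (h : HasGrad g G) (hG : ∀ i, Continuous (G i)) (a : ℝ) (x : T3)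
    (i : Fin 3) :
    ∫ z, gauss z * (g (x + toTorus (a • z)) * z i)
      = a * ∫ z, gauss z * G i (x + toTorus (a • z)) := by
  have hg := h.continuous
  have hGi := hG i
  obtain ⟨M, hM0, hM⟩ := exists_abs_le_of_continuous hg
  obtain ⟨C, hC0, hC⟩ := exists_abs_le_of_continuous hGi
  have h1 : ∀ z, HasFDerivAt (fun z : R3 => g (x + toTorus (a • z)))
      (a • ∑ j, G j (x + toTorus (a • z)) • (EuclideanSpace.proj j : R3 →L[ℝ] ℝ)) z := by
    intro z
    have h2 : HasFDerivAt (fun z : R3 => a • z) (a • ContinuousLinearMap.id ℝ R3) z :=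
      (hasFDerivAt_id z).const_smul a
    refine (HasFDerivAt.comp (f := fun z : R3 => a • z) z
      (h.hasFDerivAt x (a • z)) h2).congr_fderiv ?_
    ext v
    simp [Finset.mul_sum]
  have h3 : ∀ z, fderiv ℝ (fun z : R3 => g (x + toTorus (a • z))) z (unitVec i)
      = a * G i (x + toTorus (a • z)) := by
    intro z
    rw [(h1 z).fderiv]
    simp [unitVec]
  have h4 : ∀ z, fderiv ℝ gauss z (unitVec i) = -(gauss z * z i) := by
    intro z
    rw [(hasFDerivAt_gauss z).fderiv]
    simp [unitVec, EuclideanSpace.inner_single_right]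
  have hi1 : Integrable fun z => gauss z * z i * g (x + toTorus (a • z)) := by
    refine (integrable_norm_mul_gauss.mul_const M).mono'
      (Continuous.aestronglyMeasurable (by fun_prop)) (Eventually.of_forall fun z => ?_)
    rw [norm_mul, norm_mul, Real.norm_of_nonneg (gauss_nonneg z), mul_comm (gauss z)]
    have h5 := PiLp.norm_apply_le z i
    have h6 := gauss_nonneg z
    have h7 := hM (x + toTorus (a • z))
    exact mul_le_mul (mul_le_mul_of_nonneg_right h5 h6) h7 (abs_nonneg _) (by positivity)
  have key := integral_mul_fderiv_eq_neg_fderiv_mul_of_integrable (μ := (volume : Measure R3))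
    (f := gauss) (g := fun z : R3 => g (x + toTorus (a • z))) (v := unitVec i)
    (by simp_rw [h4, neg_mul]; exact hi1.neg)
    (by
      simp_rw [h3]
      exact integrable_gauss_mul (M := |a| * C) (by fun_prop) fun z => by
        rw [abs_mul]; exact mul_le_mul_of_nonneg_left (hC _) (abs_nonneg _))
    (integrable_gauss_mul (by fun_prop) fun z => hM _)
    (fun z _ => (hasFDerivAt_gauss z).differentiableAt)
    (fun z _ => (h1 z).differentiableAt)
  simp_rw [h3, h4, neg_mul, integral_neg, neg_neg] at key
  have e1 : ∀ z : R3, gauss z * (g (x + toTorus (a • z)) * z i)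
      = gauss z * z i * g (x + toTorus (a • z)) := fun z => by ring
  simp_rw [e1, ← key, ← integral_const_mul]
  congr 1; ext z; ring

/-- Differentiating √(2τ) produces (√(2t))⁻¹ z·∇g inside the average. Gaussian integration by parts
replaces each factor zᵢ by √(2t) ∂ᵢ, so the square roots cancel and the Laplacian remains. -/
lemma HasGrad.heat_time (h : HasGrad g G) (hGG : ∀ i, HasGrad (G i) (GG i))
    (hc : ∀ i j, Continuous (GG i j)) (x : T3) {t : ℝ} (ht : 0 < t) :
    HasDerivAt (fun τ => heat τ g x) (∑ i, heat t (GG i i) x) t := by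
  have hg := h.continuous
  have hG : ∀ i, Continuous (G i) := fun i => (hGG i).continuous
  choose C hC0 hC using fun i => exists_abs_le_of_continuous (hG i)
  have hsq : ∀ τ, 0 < τ → HasDerivAt (fun τ : ℝ => √(2 * τ)) (√(2 * τ))⁻¹ τ := by
    intro τ hτ
    have h1 : HasDerivAt (fun τ : ℝ => 2 * τ) 2 τ := by
      simpa using (hasDerivAt_id τ).const_mul (2 : ℝ)
    have h2 := h1.sqrt (by positivity)
    convert h2 using 1
    field_simp
  have key := (hasDerivAt_integral_of_dominated_loc_of_deriv_le (μ := (volume : Measure R3))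
    (F := fun (τ : ℝ) z => gauss z * g (x + toTorus (√(2 * τ) • z)))
    (F' := fun τ z => gauss z * ((√(2 * τ))⁻¹ *
      ∑ i, G i (x + toTorus (√(2 * τ) • z)) * z i))
    -- The factor (√(2τ))⁻¹ blows up at 0; on τ > t/2 it is at most (√t)⁻¹, which gives the
    -- dominating function.
    (x₀ := t) (s := Ioi (t / 2)) (bound := fun z => ‖z‖ * gauss z * ((√t)⁻¹ * ∑ i, C i))
    (Ioi_mem_nhds (by linarith))
    (Eventually.of_forall fun s => Continuous.aestronglyMeasurable (by fun_prop))
    (integrable_heat hg _ _) (Continuous.aestronglyMeasurable (by fun_prop))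
    (Eventually.of_forall fun z τ hτ => ?_) (integrable_norm_mul_gauss.mul_const _)
    (Eventually.of_forall fun z τ hτ => ?_)).2
  · refine key.congr_deriv ?_
    have ha : 0 < √(2 * t) := Real.sqrt_pos.2 (by positivity)
    have hint : ∀ i, Integrable fun z : R3 =>
        gauss z * (G i (x + toTorus (√(2 * t) • z)) * z i) := by
      intro i
      refine (integrable_norm_mul_gauss.mul_const (C i)).mono'
        (Continuous.aestronglyMeasurable (by have := hG i; fun_prop))
        (Eventually.of_forall fun z => ?_)
      rw [norm_mul, norm_mul, Real.norm_of_nonneg (gauss_nonneg z)]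
      have h5 := PiLp.norm_apply_le z i
      have h6 := gauss_nonneg z
      have h7 : ‖G i (x + toTorus (√(2 * t) • z))‖ ≤ C i := hC i _
      calc gauss z * (‖G i (x + toTorus (√(2 * t) • z))‖ * ‖z i‖)
          ≤ gauss z * (C i * ‖z‖) := by gcongr; exact hC0 i
        _ = _ := by ring
    have e1 : ∀ z : R3, gauss z * ((√(2 * t))⁻¹ * ∑ i, G i (x + toTorus (√(2 * t) • z)) * z i)
        = ∑ i, (√(2 * t))⁻¹ * (gauss z * (G i (x + toTorus (√(2 * t) • z)) * z i)) := by
      intro z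
      rw [Finset.mul_sum, Finset.mul_sum]
      refine Finset.sum_congr rfl fun i _ => by ring
    simp_rw [e1]
    rw [integral_finsetSum _ fun i _ => (hint i).const_mul _]
    refine Finset.sum_congr rfl fun i _ => ?_
    rw [integral_const_mul, integral_gauss_mul_coord (hGG i) (hc i), ← mul_assoc,
      inv_mul_cancel₀ ha.ne', one_mul]
    rfl
  · have hτ' : t / 2 < τ := hτ
    rw [norm_mul, Real.norm_of_nonneg (gauss_nonneg z), norm_mul, norm_inv,
      Real.norm_of_nonneg (Real.sqrt_nonneg _)]
    have h1 : (√(2 * τ))⁻¹ ≤ (√t)⁻¹ :=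
      inv_anti₀ (Real.sqrt_pos.2 ht) (Real.sqrt_le_sqrt (by linarith))
    have h2 : ‖∑ i, G i (x + toTorus (√(2 * τ) • z)) * z i‖ ≤ (∑ i, C i) * ‖z‖ := by
      rw [Finset.sum_mul]
      refine (norm_sum_le _ _).trans (Finset.sum_le_sum fun i _ => ?_)
      rw [norm_mul]
      exact mul_le_mul (hC i _) (PiLp.norm_apply_le z i) (norm_nonneg _) (hC0 i)
    calc gauss z * ((√(2 * τ))⁻¹ * ‖∑ i, G i (x + toTorus (√(2 * τ) • z)) * z i‖)
        ≤ gauss z * ((√t)⁻¹ * ((∑ i, C i) * ‖z‖)) := by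
          have := gauss_nonneg z
          gcongr
      _ = _ := by ring
  · have hτ' : 0 < τ := by have : t / 2 < τ := hτ; linarith
    have h1 := (h.hasFDerivAt x (√(2 * τ) • z)).comp_hasDerivAt τ ((hsq τ hτ').smul_const z)
    refine (h1.const_mul (gauss z)).congr_deriv ?_
    simp only [sum_apply, smul_apply, smul_eq_mul, PiLp.proj_apply, PiLp.smul_apply, Finset.mul_sum]
    refine Finset.sum_congr rfl fun i _ => by ring

/-- The fundamental theorem of calculus needs the derivative only in the open interval, and
continuity at 0, where √(2τ) is not differentiable. -/
lemma HasGrad.heat_eq_add_integral (h : HasGrad g G) (hGG : ∀ i, HasGrad (G i) (GG i))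
    (hc : ∀ i j, Continuous (GG i j)) (x : T3) {t : ℝ} (ht : 0 ≤ t) :
    heat t g x = g x + ∫ τ in (0 : ℝ)..t, ∑ i, heat τ (GG i i) x := by
  have hcont : ∀ {f : T3 → ℝ}, Continuous f → Continuous fun τ => heat τ f x := by
    intro f hf
    obtain ⟨M, -, hM⟩ := exists_abs_le_of_continuous hf
    exact (continuous_heat (X := Unit) (F := fun _ => f) (hf.comp continuous_snd)
      (fun _ => hM)).comp (f := fun τ : ℝ => (τ, (), x)) (by fun_prop)
  rw [intervalIntegral.integral_eq_sub_of_hasDerivAt_of_le ht (hcont h.continuous).continuousOn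
    (fun τ hτ => h.heat_time hGG hc x hτ.1)
    ((continuous_finsetSum _ fun i _ => hcont (hc i i)).intervalIntegrable _ _)]
  rw [heat_of_nonpos le_rfl]
  ring

end heat

/-! ### Duhamel's formula for the inhomogeneous heat equation. -/

/-- Fubini on the triangle 0 < s < τ < t after the substitution a = τ - s. -/
lemma integral_triangle {h : ℝ → ℝ → ℝ} (hh : Continuous h.uncurry) {t : ℝ} (ht : 0 ≤ t) :
    ∫ s in (0 : ℝ)..t, ∫ a in (0 : ℝ)..(t - s), h a s
      = ∫ τ in (0 : ℝ)..t, ∫ s in (0 : ℝ)..τ, h (τ - s) s := by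
  have hH : Measurable fun p : ℝ × ℝ => if p.1 < p.2 then h (p.2 - p.1) p.1 else 0 := by
    refine Measurable.ite (measurableSet_lt measurable_fst measurable_snd) ?_ measurable_const
    exact (hh.comp (f := fun p : ℝ × ℝ => (p.2 - p.1, p.1)) (by fun_prop)).measurable
  obtain ⟨M, hM⟩ := ((isCompact_Icc (a := (0 : ℝ)) (b := t)).prod
    (isCompact_Icc (a := (0 : ℝ)) (b := t))).exists_bound_of_continuousOn
    (hh.comp (f := fun p : ℝ × ℝ => (p.2 - p.1, p.1)) (by fun_prop)).continuousOn
  have hint : IntegrableOn (fun p : ℝ × ℝ => if p.1 < p.2 then h (p.2 - p.1) p.1 else 0)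
      (uIoc 0 t ×ˢ uIoc 0 t) := by
    rw [uIoc_of_le ht]
    refine IntegrableOn.of_bound (C := |M|) ?_ hH.aestronglyMeasurable ?_
    · exact (measure_mono (Set.prod_mono Ioc_subset_Icc_self Ioc_subset_Icc_self)).trans_lt
        (isCompact_Icc.prod isCompact_Icc).measure_lt_top
    · filter_upwards [ae_restrict_mem (measurableSet_Ioc.prod measurableSet_Ioc)] with p hp
      split_ifs
      · exact (hM p ⟨⟨hp.1.1.le, hp.1.2⟩, ⟨hp.2.1.le, hp.2.2⟩⟩).trans (le_abs_self M)
      · simp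
  have hswap := intervalIntegral_intervalIntegral_swap
    (F := fun s τ => if s < τ then h (τ - s) s else 0) (a := 0) (b := t) (c := 0) (d := t) hint
  have hI : ∀ s ∈ uIcc (0 : ℝ) t, ∫ a in (0 : ℝ)..(t - s), h a s
      = ∫ τ in (0 : ℝ)..t, if s < τ then h (τ - s) s else 0 := by
    intro s hs
    rw [uIcc_of_le ht] at hs
    have h1 : ∫ τ in s..t, h (τ - s) s = ∫ a in (0 : ℝ)..(t - s), h a s := by
      rw [intervalIntegral.integral_comp_sub_right (fun a => h a s) s, sub_self]
    rw [← h1, intervalIntegral.integral_of_le hs.2, intervalIntegral.integral_of_le ht]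
    have h2 : ∀ τ : ℝ, (if s < τ then h (τ - s) s else 0)
        = (Ioi s).indicator (fun τ => h (τ - s) s) τ := fun τ => rfl
    simp_rw [h2]
    rw [setIntegral_indicator measurableSet_Ioi]
    congr 2
    ext τ
    simp only [mem_Ioc, mem_inter_iff, mem_Ioi]
    constructor
    · rintro ⟨ha, hb⟩; exact ⟨⟨hs.1.trans_lt ha, hb⟩, ha⟩
    · rintro ⟨⟨-, hb⟩, ha⟩; exact ⟨ha, hb⟩
  have hJ : ∀ τ ∈ uIcc (0 : ℝ) t, ∫ s in (0 : ℝ)..τ, h (τ - s) s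
      = ∫ s in (0 : ℝ)..t, if s < τ then h (τ - s) s else 0 := by
    intro τ hτ
    rw [uIcc_of_le ht] at hτ
    rw [intervalIntegral.integral_of_le hτ.1, intervalIntegral.integral_of_le ht,
      integral_Ioc_eq_integral_Ioo]
    have h2 : ∀ s : ℝ, (if s < τ then h (τ - s) s else 0)
        = (Iio τ).indicator (fun s => h (τ - s) s) s := fun s => rfl
    simp_rw [h2]
    rw [setIntegral_indicator measurableSet_Iio]
    congr 2
    ext s
    simp only [mem_Ioo, mem_Ioc, mem_inter_iff, mem_Iio]
    constructor
    · rintro ⟨ha, hb⟩; exact ⟨⟨ha, hb.le.trans hτ.2⟩, hb⟩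
    · rintro ⟨⟨ha, -⟩, hb⟩; exact ⟨ha, hb⟩
  rw [intervalIntegral.integral_congr hI, intervalIntegral.integral_congr hJ, hswap]

/-- Bounded continuous functions of space and time. -/
structure BddCont (f : ℝ → T3 → ℝ) : Prop where
  continuous : Continuous f.uncurry
  bounded : ∃ M, ∀ t x, |f t x| ≤ M

lemma BddCont.continuous_apply {f : ℝ → T3 → ℝ} (hf : BddCont f) (t : ℝ) : Continuous (f t) :=
  hf.continuous.comp (f := fun x => (t, x)) (by fun_prop)

lemma BddCont.conv {K : R3 → ℝ} (hK : IsTestKernel K) {q : ℝ → T3 → ℝ} (hq : BddCont q) :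
    BddCont fun t => conv K (q t) := by
  obtain ⟨M, hM⟩ := hq.bounded
  exact ⟨continuous_conv hK hq.continuous, _, fun t x => abs_conv_le hK (hM t) x⟩

/-- The solution `u` of `∂ₜu = Δu - f` with initial value `g`. -/
def duhamel (g : T3 → ℝ) (f : ℝ → T3 → ℝ) (t : ℝ) (x : T3) : ℝ :=
  heat t g x - ∫ s in (0 : ℝ)..t, heat (t - s) (f s) x

section duhamel

variable {g : T3 → ℝ} {f : ℝ → T3 → ℝ}

lemma BddCont.continuous_heat (hf : BddCont f) :
    Continuous fun q : ℝ × ℝ × T3 => heat q.1 (f q.2.1) q.2.2 := by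
  obtain ⟨M, hM⟩ := hf.bounded
  exact RegularizedFlow.continuous_heat hf.continuous hM

lemma BddCont.continuous_heat_sub (hf : BddCont f) :
    Continuous fun p : (ℝ × T3) × ℝ => heat (p.1.1 - p.2) (f p.2) p.1.2 :=
  hf.continuous_heat.comp (f := fun p : (ℝ × T3) × ℝ => (p.1.1 - p.2, p.2, p.1.2)) (by fun_prop)

lemma continuous_duhamel (hg : Continuous g) (hf : BddCont f) :
    Continuous (duhamel g f).uncurry := by
  obtain ⟨M, -, hM⟩ := exists_abs_le_of_continuous hg
  have h1 : Continuous fun p : ℝ × T3 => heat p.1 g p.2 :=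
    (RegularizedFlow.continuous_heat (X := Unit) (F := fun _ => g) (hg.comp continuous_snd)
      (fun _ => hM)).comp (f := fun p : ℝ × T3 => (p.1, (), p.2)) (by fun_prop)
  have h2 : Continuous fun p : ℝ × T3 => ∫ s in (0 : ℝ)..p.1, heat (p.1 - s) (f s) p.2 :=
    intervalIntegral.continuous_parametric_intervalIntegral_of_continuous
      (f := fun (p : ℝ × T3) s => heat (p.1 - s) (f s) p.2) hf.continuous_heat_sub continuous_fst
  exact h1.sub h2

lemma intervalIntegrable_heat (hf : BddCont f) (t : ℝ) (x : T3) (a b : ℝ) :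
    IntervalIntegrable (fun s => heat (t - s) (f s) x) volume a b :=
  (hf.continuous_heat_sub.comp (Continuous.prodMk_right (t, x))).intervalIntegrable a b

lemma abs_duhamel_le {M N t : ℝ} (hM : ∀ x, |g x| ≤ M) (hN : ∀ t x, |f t x| ≤ N) (ht : 0 ≤ t)
    (x : T3) : |duhamel g f t x| ≤ M + N * t := by
  refine (abs_sub _ _).trans (add_le_add (abs_heat_le hM t x) ?_)
  have := intervalIntegral.norm_integral_le_of_norm_le_const (a := (0 : ℝ)) (b := t)
    (f := fun s => heat (t - s) (f s) x) (C := N) (fun s _ => abs_heat_le (hN s) _ _)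
  simpa [abs_of_nonneg ht] using this

lemma abs_duhamel_shift_le {L L' t : ℝ} (hg : Continuous g) (hf : BddCont f)
    (hL : ∀ x y, |g (x + toTorus y) - g x| ≤ L * ‖y‖)
    (hL' : ∀ t x y, |f t (x + toTorus y) - f t x| ≤ L' * ‖y‖) (ht : 0 ≤ t) (x : T3) (y : R3) :
    |duhamel g f t (x + toTorus y) - duhamel g f t x| ≤ (L + L' * t) * ‖y‖ := by
  have h1 : duhamel g f t (x + toTorus y) - duhamel g f t x
      = (heat t g (x + toTorus y) - heat t g x)
        - ∫ s in (0 : ℝ)..t, (heat (t - s) (f s) (x + toTorus y) - heat (t - s) (f s) x) := by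
    rw [intervalIntegral.integral_sub (intervalIntegrable_heat hf t _ _ _)
      (intervalIntegrable_heat hf t _ _ _)]
    unfold duhamel
    ring
  rw [h1, add_mul]
  refine (abs_sub _ _).trans (add_le_add (abs_heat_shift_le hg hL t x y) ?_)
  have := intervalIntegral.norm_integral_le_of_norm_le_const (a := (0 : ℝ)) (b := t)
    (f := fun s => heat (t - s) (f s) (x + toTorus y) - heat (t - s) (f s) x) (C := L' * ‖y‖)
    (fun s _ => abs_heat_shift_le (hf.continuous_apply s) (hL' s) _ _ _)
  rw [sub_zero, abs_of_nonneg ht] at this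
  calc _ ≤ _ := this
    _ = _ := by ring

lemma abs_duhamel_sub_le {f' : ℝ → T3 → ℝ} (hf : BddCont f) (hf' : BddCont f') {t : ℝ}
    (ht : 0 ≤ t) {b : ℝ → ℝ} (hb : Continuous b)
    (h : ∀ s ∈ Icc 0 t, ∀ x, |f s x - f' s x| ≤ b s) (x : T3) :
    |duhamel g f t x - duhamel g f' t x| ≤ ∫ s in (0 : ℝ)..t, b s := by
  have h1 : duhamel g f t x - duhamel g f' t x
      = - ∫ s in (0 : ℝ)..t, (heat (t - s) (f s) x - heat (t - s) (f' s) x) := by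
    rw [intervalIntegral.integral_sub (intervalIntegrable_heat hf t _ _ _)
      (intervalIntegrable_heat hf' t _ _ _)]
    unfold duhamel
    ring
  rw [h1, abs_neg, ← Real.norm_eq_abs]
  refine intervalIntegral.norm_integral_le_of_norm_le ht (Eventually.of_forall fun s hs => ?_)
    (hb.intervalIntegrable (μ := volume) 0 t)
  exact abs_heat_sub_le (hf.continuous_apply s) (hf'.continuous_apply s)
    (h s ⟨hs.1.le, hs.2⟩) _ _

variable {G : Fin 3 → T3 → ℝ} {GG : Fin 3 → Fin 3 → T3 → ℝ}
  {F : Fin 3 → ℝ → T3 → ℝ} {FF : Fin 3 → Fin 3 → ℝ → T3 → ℝ}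

lemma hasDerivAt_duhamel_space (hg : HasGrad g G) (hG : ∀ i, Continuous (G i))
    (hf : BddCont f) (hF : ∀ i, BddCont (F i)) (h : ∀ t, HasGrad (f t) fun i => F i t)
    (t : ℝ) (x : T3) (i : Fin 3) :
    HasDerivAt (fun s : ℝ => duhamel g f t (x + toTorus (s • unitVec i)))
      (duhamel (G i) (F i) t x) 0 := by
  obtain ⟨M, hM⟩ := (hF i).bounded
  refine (hg.heat_space hG t x i).sub ?_
  have key := (intervalIntegral.hasDerivAt_integral_of_dominated_loc_of_deriv_le
    (μ := volume) (a := 0) (b := t)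
    (F := fun (s : ℝ) r => heat (t - r) (f r) (x + toTorus (s • unitVec i)))
    (F' := fun s r => heat (t - r) (F i r) (x + toTorus (s • unitVec i)))
    (x₀ := 0) (s := univ) (bound := fun _ : ℝ => M) univ_mem
    (Eventually.of_forall fun s => (hf.continuous_heat_sub.comp
      (Continuous.prodMk_right (t, x + toTorus (s • unitVec i)))).aestronglyMeasurable)
    (intervalIntegrable_heat hf _ _ _ _)
    (((hF i).continuous_heat_sub.comp
      (Continuous.prodMk_right (t, x + toTorus ((0 : ℝ) • unitVec i)))).aestronglyMeasurable)
    (Eventually.of_forall fun r _ s _ => abs_heat_le (hM r) _ _) intervalIntegrable_const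
    (Eventually.of_forall fun r _ s _ => ?_)).2
  · simpa [toTorus_zero] using key
  · have h1 := (h r).heat_space (fun j => (hF j).continuous_apply r) (t - r)
      (x + toTorus (s • unitVec i)) i
    rw [← sub_self s] at h1
    have h2 := HasDerivAt.comp (h := fun q : ℝ => q - s) s h1 ((hasDerivAt_id s).sub_const s)
    rw [mul_one] at h2
    refine h2.congr_of_eventuallyEq (Eventually.of_forall fun q => ?_)
    simp only [Function.comp, add_assoc, ← toTorus_add, ← add_smul, add_sub_cancel]

/-- Each heat evolution in the Duhamel integral is written in its integral form, and exchanging the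
integrals over the triangle collects the second derivatives into those of the solution. The
integrated form avoids differentiating at the moving endpoint s = t, where `HasGrad.heat_time` does
not apply. -/
lemma duhamel_eq_add_integral (hg : HasGrad g G) (hGG : ∀ i, HasGrad (G i) (GG i))
    (hc : ∀ i j, Continuous (GG i j)) (hf : BddCont f) (hF : ∀ t, HasGrad (f t) fun i => F i t)
    (hFF : ∀ t i, HasGrad (F i t) fun j => FF i j t) (hFc : ∀ i j, BddCont (FF i j))
    {t : ℝ} (ht : 0 ≤ t) (x : T3) :
    duhamel g f t x = g x + ∫ τ in (0 : ℝ)..t,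
      (∑ i, duhamel (GG i i) (FF i i) τ x - f τ x) := by
  have hh : Continuous fun p : ℝ × ℝ => ∑ i, heat p.1 (FF i i p.2) x :=
    continuous_finsetSum _ fun i _ => (hFc i i).continuous_heat.comp
      (f := fun p : ℝ × ℝ => (p.1, p.2, x)) (by fun_prop)
  have hfx : Continuous fun s => f s x := hf.continuous.comp (f := fun s => (s, x)) (by fun_prop)
  have h1 : ∫ s in (0 : ℝ)..t, heat (t - s) (f s) x
      = (∫ s in (0 : ℝ)..t, f s x)
        + ∫ τ in (0 : ℝ)..t, ∫ s in (0 : ℝ)..τ, ∑ i, heat (τ - s) (FF i i s) x := by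
    rw [← integral_triangle (h := fun a s => ∑ i, heat a (FF i i s) x) hh ht,
      ← intervalIntegral.integral_add (hfx.intervalIntegrable _ _)]
    · refine intervalIntegral.integral_congr fun s hs => ?_
      rw [uIcc_of_le ht] at hs
      exact (hF s).heat_eq_add_integral (hFF s) (fun i j => (hFc i j).continuous_apply s) x
        (sub_nonneg.2 hs.2)
    · refine Continuous.intervalIntegrable ?_ _ _
      exact intervalIntegral.continuous_parametric_intervalIntegral_of_continuous
        (f := fun s a => ∑ i, heat a (FF i i s) x)
        (hh.comp (f := fun p : ℝ × ℝ => (p.2, p.1)) (by fun_prop)) (by fun_prop)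
  have hcd : ∀ {g' : T3 → ℝ} {f' : ℝ → T3 → ℝ}, Continuous g' → BddCont f' →
      Continuous fun τ => duhamel g' f' τ x := fun hg' hf' =>
    (continuous_duhamel hg' hf').comp (f := fun τ => (τ, x)) (by fun_prop)
  have hch : ∀ {g' : T3 → ℝ}, Continuous g' → Continuous fun τ => heat τ g' x := by
    intro g' hg'
    have h0 : BddCont fun (_ : ℝ) (_ : T3) => (0 : ℝ) := ⟨continuous_const, 0, by simp⟩
    refine (hcd hg' h0).congr fun τ => ?_
    simp [duhamel, heat]
  rw [duhamel, hg.heat_eq_add_integral hGG hc x ht, h1,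
    intervalIntegral.integral_sub (Continuous.intervalIntegrable
      (continuous_finsetSum _ fun i _ => hcd (hc i i) (hFc i i)) _ _) (hfx.intervalIntegrable _ _)]
  have h2 : ∀ τ, ∑ i, duhamel (GG i i) (FF i i) τ x = (∑ i, heat τ (GG i i) x)
      - ∫ s in (0 : ℝ)..τ, ∑ i, heat (τ - s) (FF i i s) x := by
    intro τ
    rw [intervalIntegral.integral_finsetSum fun i _ => intervalIntegrable_heat (hFc i i) τ x 0 τ,
      ← Finset.sum_sub_distrib]
    rfl
  simp_rw [h2]
  rw [intervalIntegral.integral_sub]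
  · ring
  · exact (continuous_finsetSum _ fun i _ => hch (hc i i)).intervalIntegrable _ _
  · refine Continuous.intervalIntegrable ?_ _ _
    refine intervalIntegral.continuous_parametric_intervalIntegral_of_continuous
      (f := fun τ s => ∑ i, heat (τ - s) (FF i i s) x) ?_ continuous_id
    exact continuous_finsetSum _ fun i _ => (hFc i i).continuous_heat_sub.comp
      (f := fun p : ℝ × ℝ => ((p.1, x), p.2)) (by fun_prop)

lemma hasDerivAt_duhamel_time (hg : HasGrad g G) (hGG : ∀ i, HasGrad (G i) (GG i))
    (hc : ∀ i j, Continuous (GG i j)) (hf : BddCont f) (hF : ∀ t, HasGrad (f t) fun i => F i t)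
    (hFF : ∀ t i, HasGrad (F i t) fun j => FF i j t) (hFc : ∀ i j, BddCont (FF i j))
    {t : ℝ} (ht : 0 < t) (x : T3) :
    HasDerivAt (fun τ => duhamel g f τ x) (∑ i, duhamel (GG i i) (FF i i) t x - f t x) t := by
  have hcont : Continuous fun τ => ∑ i, duhamel (GG i i) (FF i i) τ x - f τ x := by
    refine (continuous_finsetSum _ fun i _ => ?_).sub
      (hf.continuous.comp (f := fun s => (s, x)) (by fun_prop))
    exact (continuous_duhamel (hc i i) (hFc i i)).comp (f := fun τ => (τ, x)) (by fun_prop)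
  have h1 := (intervalIntegral.integral_hasDerivAt_right (hcont.intervalIntegrable 0 t)
    hcont.stronglyMeasurable.stronglyMeasurableAtFilter hcont.continuousAt).const_add (g x)
  refine h1.congr_of_eventuallyEq ?_
  filter_upwards [Ioi_mem_nhds ht] with τ hτ
  exact duhamel_eq_add_integral hg hGG hc hf hF hFF hFc (le_of_lt hτ) x

end duhamel

/-! ### Characteristics of a bounded Lipschitz field. -/

/-- The nearest point of `[0,T]`. -/
def clamp (T t : ℝ) : ℝ := max 0 (min t T)

lemma clamp_mem {T : ℝ} (hT : 0 ≤ T) (t : ℝ) : clamp T t ∈ Icc 0 T :=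
  ⟨le_max_left _ _, max_le hT (min_le_right _ _)⟩

lemma clamp_eq {T t : ℝ} (ht : t ∈ Icc 0 T) : clamp T t = t := by
  rw [clamp, min_eq_left ht.2, max_eq_right ht.1]

@[fun_prop]
lemma continuous_clamp (T : ℝ) : Continuous (clamp T) := by unfold clamp; fun_prop

lemma abs_clamp_sub_le (T s t : ℝ) : |clamp T s - clamp T t| ≤ |s - t| := by
  unfold clamp
  rw [max_comm 0, max_comm 0]
  exact (abs_max_sub_max_le_abs _ _ _).trans ((abs_min_sub_min_le_max _ _ _ _).trans (by simp))

/-- Bounded Lipschitz vector fields `v` together with a bounded Lipschitz function `d`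
(in the application the divergence of `v`). -/
structure IsField (B L : ℝ) (v : ℝ → T3 → R3) (d : ℝ → T3 → ℝ) : Prop where
  continuous_v : Continuous v.uncurry
  continuous_d : Continuous d.uncurry
  norm_v_le : ∀ t x, ‖v t x‖ ≤ B
  abs_d_le : ∀ t x, |d t x| ≤ B
  lip_v : ∀ t x y, ‖v t (x + toTorus y) - v t x‖ ≤ L * ‖y‖
  lip_d : ∀ t x y, |d t (x + toTorus y) - d t x| ≤ L * ‖y‖

/-- The right-hand side of the characteristic equations, seen from the point `x`. -/
def charField (v : ℝ → T3 → R3) (d : ℝ → T3 → ℝ) (x : T3) (s : ℝ) (Y : R3 × ℝ) : R3 × ℝ :=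
  (v s (x + toTorus Y.1), -d s (x + toTorus Y.1))

/-- `Y` solves the characteristic equations on `[0,T]`. -/
def IsChar (v : ℝ → T3 → R3) (d : ℝ → T3 → ℝ) (T : ℝ) (x : T3) (Y : ℝ → R3 × ℝ) : Prop :=
  ∀ s ∈ Icc 0 T, HasDerivAt Y (charField v d x s (Y s)) s

section characteristics

variable {B L T : ℝ} {v : ℝ → T3 → R3} {d : ℝ → T3 → ℝ}

lemma IsField.nonneg_B (h : IsField B L v d) : 0 ≤ B := (norm_nonneg _).trans (h.norm_v_le 0 0)

lemma IsField.nonneg_L (h : IsField B L v d) : 0 ≤ L := by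
  have := (norm_nonneg _).trans (h.lip_v 0 0 (unitVec 0))
  simpa [norm_unitVec] using this

lemma IsField.lipschitz_charField (h : IsField B L v d) (x : T3) (s : ℝ) :
    LipschitzWith L.toNNReal (charField v d x s) := by
  refine LipschitzWith.of_dist_le' fun Y Y' => ?_
  have e : x + toTorus Y.1 = x + toTorus Y'.1 + toTorus (Y.1 - Y'.1) := by
    rw [toTorus_sub]; abel
  have h1 : ‖Y.1 - Y'.1‖ ≤ dist Y Y' := by rw [← dist_eq_norm]; exact le_max_left _ _
  have h2 : L * ‖Y.1 - Y'.1‖ ≤ L * dist Y Y' := mul_le_mul_of_nonneg_left h1 h.nonneg_L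
  unfold charField
  rw [e]
  refine max_le ?_ ?_
  · rw [dist_eq_norm]
    exact (h.lip_v s _ _).trans h2
  · simp only [dist_neg_neg, Real.dist_eq]
    exact (h.lip_d s _ _).trans h2

lemma IsField.norm_charField_le (h : IsField B L v d) (x : T3) (s : ℝ) (Y : R3 × ℝ) :
    ‖charField v d x s Y‖ ≤ B := by
  refine max_le (h.norm_v_le _ _) ?_
  simp only [charField, norm_neg]
  exact h.abs_d_le _ _

/-- The field is bounded and globally Lipschitz in the displacement, so one Picard-Lindelöf ball of
radius B(T + 2) covers the whole time interval. -/
lemma IsField.exists_isChar (h : IsField B L v d) {t : ℝ} (ht : t ∈ Icc 0 T)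
    (x : T3) : ∃ Y : ℝ → R3 × ℝ, Y t = 0 ∧ IsChar v d T x Y := by
  have hT : 0 ≤ T := ht.1.trans ht.2
  have hB := h.nonneg_B
  -- The interval is enlarged so that two-sided derivatives exist at 0 and T.
  have ht' : t ∈ Icc (-1) (T + 1) := ⟨by linarith [ht.1], by linarith [ht.2]⟩
  have hPL : IsPicardLindelof (charField v d x) (⟨t, ht'⟩ : Icc (-1) (T + 1)) 0
      (B * (T + 2)).toNNReal 0 B.toNNReal L.toNNReal := by
    refine ⟨fun s _ => (h.lipschitz_charField x s).lipschitzOnWith, fun Y _ => ?_, fun s _ Y _ => ?_,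
      ?_⟩
    · refine Continuous.continuousOn ?_
      exact (h.continuous_v.comp (f := fun s : ℝ => (s, x + toTorus Y.1)) (by fun_prop)).prodMk
        (h.continuous_d.comp (f := fun s : ℝ => (s, x + toTorus Y.1)) (by fun_prop)).neg
    · rw [Real.coe_toNNReal _ hB]
      exact h.norm_charField_le x s Y
    · rw [Real.coe_toNNReal _ hB, Real.coe_toNNReal _ (by positivity), NNReal.coe_zero, sub_zero]
      refine mul_le_mul_of_nonneg_left (max_le ?_ ?_) hB
      · simp only; linarith [ht.1]
      · simp only; linarith [ht.2]
  obtain ⟨Y, hY0, hY⟩ := hPL.exists_eq_forall_mem_Icc_hasDerivWithinAt₀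
  refine ⟨Y, hY0, fun s hs => ?_⟩
  exact (hY s ⟨by linarith [hs.1], by linarith [hs.2]⟩).hasDerivAt
    (Icc_mem_nhds (by linarith [hs.1]) (by linarith [hs.2]))

lemma IsChar.norm_sub_le (h : IsField B L v d) {x : T3} {Y : ℝ → R3 × ℝ} (hY : IsChar v d T x Y)
    {s t : ℝ} (hs : s ∈ Icc 0 T) (ht : t ∈ Icc 0 T) : ‖Y s - Y t‖ ≤ B * |s - t| :=
  Convex.norm_image_sub_le_of_norm_hasDerivWithin_le
    (fun r hr => (hY r hr).hasDerivWithinAt) (fun r _ => h.norm_charField_le x r _)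
    (convex_Icc 0 T) ht hs

lemma IsChar.continuousOn {x : T3} {Y : ℝ → R3 × ℝ} (hY : IsChar v d T x Y) :
    ContinuousOn Y (Icc 0 T) := fun s hs => (hY s hs).continuousAt.continuousWithinAt

/-- The constant in the Grönwall estimate for characteristics. -/
def charConst (L T : ℝ) : ℝ :=
  Real.exp (L.toNNReal * T) + gronwallBound 0 L.toNNReal 1 T

lemma gronwallBound_nonneg {K x : ℝ} (hK : 0 ≤ K) (hx : 0 ≤ x) : 0 ≤ gronwallBound 0 K 1 x := by
  have := gronwallBound_mono (δ := 0) (ε := 1) (K := K) le_rfl zero_le_one hK hx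
  rwa [gronwallBound_x0] at this

lemma charConst_nonneg (L : ℝ) (hT : 0 ≤ T) : 0 ≤ charConst L T :=
  add_nonneg (Real.exp_pos _).le (gronwallBound_nonneg NNReal.zero_le_coe hT)

lemma gronwallBound_eq (δ K ε x : ℝ) :
    gronwallBound δ K ε x = δ * Real.exp (K * x) + ε * gronwallBound 0 K 1 x := by
  by_cases hK : K = 0
  · subst hK; simp [gronwallBound_K0]
  · simp only [gronwallBound_of_K_ne_0 hK]; ring

/-- Stability of characteristics, backwards in time. -/
lemma IsChar.norm_sub_le_of_approx {v' : ℝ → T3 → R3} {d' : ℝ → T3 → ℝ}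
    (h : IsField B L v d) {x x' : T3} {Y Y' : ℝ → R3 × ℝ}
    (hY : IsChar v d T x Y) (hY' : IsChar v' d' T x' Y') {t : ℝ}
    (ht : t ∈ Icc 0 T) {δ η : ℝ} (hη : 0 ≤ η) (h0 : ‖Y t - Y' t‖ ≤ δ)
    (hd : ∀ s ∈ Icc 0 t, ‖charField v' d' x' s (Y' s) - charField v d x s (Y' s)‖ ≤ η)
    {s : ℝ} (hs : s ∈ Icc 0 t) : ‖Y s - Y' s‖ ≤ charConst L T * (δ + η) := by
  have hT : 0 ≤ T := ht.1.trans ht.2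
  have hδ : 0 ≤ δ := (norm_nonneg _).trans h0
  -- Grönwall's inequality runs forwards, whereas the data are prescribed at the final time; the
  -- curves are reversed by σ ↦ t - σ.
  have hrev : ∀ {v : ℝ → T3 → R3} {d : ℝ → T3 → ℝ} {x : T3} {Y : ℝ → R3 × ℝ},
      IsChar v d T x Y → ∀ σ ∈ Icc 0 t,
      HasDerivAt (fun σ => Y (t - σ)) (-charField v d x (t - σ) (Y (t - σ))) σ := by
    intro v d x Y hY σ hσ
    have h1 := hY (t - σ) ⟨by linarith [hσ.2], by linarith [hσ.1, ht.2]⟩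
    have h2 : HasDerivAt (fun σ : ℝ => t - σ) (-1) σ := by
      simpa using (hasDerivAt_id σ).const_sub t
    have h3 := h1.scomp σ h2
    rw [neg_one_smul] at h3
    exact h3
  have key := dist_le_of_approx_trajectories_ODE (K := L.toNNReal)
    (v := fun σ Z => -charField v d x (t - σ) Z)
    (f := fun σ => Y (t - σ)) (g := fun σ => Y' (t - σ))
    (f' := fun σ => -charField v d x (t - σ) (Y (t - σ)))
    (g' := fun σ => -charField v' d' x' (t - σ) (Y' (t - σ)))
    (a := 0) (b := t) (εf := 0) (εg := η) (δ := δ)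
    (fun σ => (h.lipschitz_charField x (t - σ)).neg)
    (fun σ hσ => (hrev hY σ hσ).continuousAt.continuousWithinAt)
    (fun σ hσ => (hrev hY σ ⟨hσ.1, hσ.2.le⟩).hasDerivWithinAt)
    (fun σ _ => by simp)
    (fun σ hσ => (hrev hY' σ hσ).continuousAt.continuousWithinAt)
    (fun σ hσ => (hrev hY' σ ⟨hσ.1, hσ.2.le⟩).hasDerivWithinAt)
    (fun σ hσ => by
      rw [dist_neg_neg, dist_eq_norm]
      exact hd (t - σ) ⟨by linarith [hσ.2], by linarith [hσ.1]⟩)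
    (by simpa [dist_eq_norm] using h0) (t - s) ⟨by linarith [hs.2], by linarith [hs.1]⟩
  rw [dist_eq_norm, sub_sub_cancel, zero_add, sub_zero] at key
  refine key.trans ?_
  have h3 := gronwallBound_mono hδ hη (K := L.toNNReal) NNReal.zero_le_coe
    (show t - s ≤ T by linarith [hs.1, ht.2])
  refine h3.trans ?_
  rw [gronwallBound_eq, charConst]
  have h4 := (Real.exp_pos (L.toNNReal * T)).le
  have h5 := gronwallBound_nonneg (K := L.toNNReal) NNReal.zero_le_coe hT
  nlinarith

end characteristics

/-! ### The linear transport equation, solved along characteristics. -/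

open Classical in
/-- The characteristic of `(v,d)` through the point `x` at time `t`. -/
def charCurve (v : ℝ → T3 → R3) (d : ℝ → T3 → ℝ) (T t : ℝ) (x : T3) : ℝ → R3 × ℝ :=
  if h : ∃ Y : ℝ → R3 × ℝ, Y t = 0 ∧ IsChar v d T x Y then h.choose else 0

/-- The value of the solution of `∂ₜw + v·∇w = k d w + k δ`, computed along a characteristic. -/
def charValue (k δ : ℝ) (w₀ : T3 → ℝ) (t : ℝ) (x : T3) (Y : ℝ → R3 × ℝ) : ℝ :=
  w₀ (x + toTorus (Y 0).1) * Real.exp (k * (Y 0).2)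
    + k * δ * ∫ s in (0 : ℝ)..t, Real.exp (k * (Y s).2)

/-- The solution of the linear transport equation `∂ₜw + v·∇w = k d w + k δ`. -/
def transport (k δ T : ℝ) (w₀ : T3 → ℝ) (v : ℝ → T3 → R3) (d : ℝ → T3 → ℝ) (t : ℝ) (x : T3) : ℝ :=
  charValue k δ w₀ (clamp T t) x (charCurve v d T (clamp T t) x)

lemma abs_exp_sub_exp_le {k a b R : ℝ} (hk : 0 ≤ k) (ha : a ≤ R) (hb : b ≤ R) :
    |Real.exp (k * a) - Real.exp (k * b)| ≤ k * Real.exp (k * R) * |a - b| := by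
  have hd : ∀ r ∈ Iic R, HasDerivWithinAt (fun r => Real.exp (k * r)) (Real.exp (k * r) * k)
      (Iic R) r := fun r _ => by
    have h1 : HasDerivAt (fun r : ℝ => k * r) k r := by simpa using (hasDerivAt_id r).const_mul k
    exact h1.exp.hasDerivWithinAt
  refine Convex.norm_image_sub_le_of_norm_hasDerivWithin_le hd (fun r hr => ?_) (convex_Iic R)
    hb ha
  rw [Real.norm_of_nonneg (by positivity), mul_comm]
  have : r ≤ R := hr
  gcongr

section transport

variable {B L T k δ W Lw : ℝ} {v : ℝ → T3 → R3} {d : ℝ → T3 → ℝ} {w₀ : T3 → ℝ}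

lemma charCurve_spec (h : IsField B L v d) {t : ℝ} (ht : t ∈ Icc 0 T) (x : T3) :
    charCurve v d T t x t = 0 ∧ IsChar v d T x (charCurve v d T t x) := by
  unfold charCurve
  rw [dif_pos (h.exists_isChar ht x)]
  exact (h.exists_isChar ht x).choose_spec

lemma norm_charCurve_le (h : IsField B L v d) {t s : ℝ} (ht : t ∈ Icc 0 T) (hs : s ∈ Icc 0 T)
    (x : T3) : ‖charCurve v d T t x s‖ ≤ B * |s - t| := by
  have h1 := charCurve_spec h ht x
  simpa [h1.1] using h1.2.norm_sub_le h hs ht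

lemma norm_charCurve_le' (h : IsField B L v d) {t s : ℝ} (ht : t ∈ Icc 0 T) (hs : s ∈ Icc 0 T)
    (x : T3) : ‖charCurve v d T t x s‖ ≤ B * T := by
  refine (norm_charCurve_le h ht hs x).trans (mul_le_mul_of_nonneg_left ?_ h.nonneg_B)
  exact abs_le.2 ⟨by linarith [ht.2, hs.1], by linarith [hs.2, ht.1]⟩

lemma transport_zero (h : IsField B L v d) (hT : 0 ≤ T) (x : T3) :
    transport k δ T w₀ v d 0 x = w₀ x := by
  have h0 : (0 : ℝ) ∈ Icc 0 T := ⟨le_rfl, hT⟩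
  have h1 := (charCurve_spec h h0 x).1
  simp [transport, clamp_eq h0, charValue, h1, toTorus_zero]

/-- The three summands of the constant come from the initial datum (`Lw`), from the exponential
weight in front of it (`W * k`) and from the source integral. -/
lemma charValue_sub_le (hk : 0 ≤ k) (hδ : 0 ≤ δ) (hW : ∀ x, |w₀ x| ≤ W)
    (hLw : ∀ x y, |w₀ (x + toTorus y) - w₀ x| ≤ Lw * ‖y‖) {R η : ℝ} {t : ℝ} (ht : t ∈ Icc 0 T)
    (x : T3) {Y Y' : ℝ → R3 × ℝ} (hY : ContinuousOn Y (Icc 0 t)) (hY' : ContinuousOn Y' (Icc 0 t))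
    (hR : ∀ s ∈ Icc 0 t, (Y s).2 ≤ R) (hR' : ∀ s ∈ Icc 0 t, (Y' s).2 ≤ R)
    (hη : ∀ s ∈ Icc 0 t, ‖Y s - Y' s‖ ≤ η) :
    |charValue k δ w₀ t x Y - charValue k δ w₀ t x Y'|
      ≤ (Lw + W * k + k * δ * k * T) * Real.exp (k * R) * η := by
  have h0 : (0 : ℝ) ∈ Icc 0 t := ⟨le_rfl, ht.1⟩
  have hη0 : 0 ≤ η := (norm_nonneg _).trans (hη 0 h0)
  have hW0 : 0 ≤ W := (abs_nonneg _).trans (hW 0)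
  have hLw0 : 0 ≤ Lw := by
    simpa [norm_unitVec] using (abs_nonneg _).trans (hLw 0 (unitVec 0))
  have hexp : ∀ s ∈ Icc 0 t, |Real.exp (k * (Y s).2) - Real.exp (k * (Y' s).2)|
      ≤ k * Real.exp (k * R) * η := fun s hs =>
    (abs_exp_sub_exp_le hk (hR s hs) (hR' s hs)).trans (mul_le_mul_of_nonneg_left
      ((norm_snd_le (Y s - Y' s)).trans (hη s hs)) (by positivity))
  have hint : ∀ {Y : ℝ → R3 × ℝ}, ContinuousOn Y (Icc 0 t) →
      IntervalIntegrable (fun s => Real.exp (k * (Y s).2)) volume 0 t := by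
    intro Y hY
    refine ContinuousOn.intervalIntegrable ?_
    rw [uIcc_of_le ht.1]
    fun_prop
  have e : charValue k δ w₀ t x Y - charValue k δ w₀ t x Y'
      = (w₀ (x + toTorus (Y 0).1) - w₀ (x + toTorus (Y' 0).1)) * Real.exp (k * (Y 0).2)
        + w₀ (x + toTorus (Y' 0).1) * (Real.exp (k * (Y 0).2) - Real.exp (k * (Y' 0).2))
        + k * δ * ∫ s in (0 : ℝ)..t, (Real.exp (k * (Y s).2) - Real.exp (k * (Y' s).2)) := by
    rw [intervalIntegral.integral_sub (hint hY) (hint hY')]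
    unfold charValue
    ring
  have h1 : |w₀ (x + toTorus (Y 0).1) - w₀ (x + toTorus (Y' 0).1)| ≤ Lw * η := by
    have h2 := hLw (x + toTorus (Y' 0).1) ((Y 0).1 - (Y' 0).1)
    rw [add_assoc, ← toTorus_add, add_sub_cancel] at h2
    exact h2.trans (mul_le_mul_of_nonneg_left ((norm_fst_le (Y 0 - Y' 0)).trans (hη 0 h0)) hLw0)
  have h3 : |∫ s in (0 : ℝ)..t, (Real.exp (k * (Y s).2) - Real.exp (k * (Y' s).2))|
      ≤ k * Real.exp (k * R) * η * T := by
    have := intervalIntegral.norm_integral_le_of_norm_le_const (a := (0 : ℝ)) (b := t)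
      (f := fun s => Real.exp (k * (Y s).2) - Real.exp (k * (Y' s).2))
      (C := k * Real.exp (k * R) * η)
      (fun s hs => hexp s (by rw [uIoc_of_le ht.1] at hs; exact ⟨hs.1.le, hs.2⟩))
    rw [sub_zero, abs_of_nonneg ht.1] at this
    exact this.trans (mul_le_mul_of_nonneg_left ht.2 (by positivity))
  have h4 : Real.exp (k * (Y 0).2) ≤ Real.exp (k * R) :=
    Real.exp_le_exp.2 (mul_le_mul_of_nonneg_left (hR 0 h0) hk)
  rw [e]
  refine (abs_add_three _ _ _).trans ?_
  rw [abs_mul, abs_mul, abs_mul (k * δ), abs_of_nonneg (mul_nonneg hk hδ), Real.abs_exp]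
  calc _ ≤ Lw * η * Real.exp (k * R) + W * (k * Real.exp (k * R) * η)
        + k * δ * (k * Real.exp (k * R) * η * T) := by
        gcongr
        · exact hW _
        · exact hexp 0 h0
    _ = _ := by ring

lemma abs_charValue_le (hk : 0 ≤ k) (hδ : 0 ≤ δ) (hW : ∀ x, |w₀ x| ≤ W) {R : ℝ} {t : ℝ}
    (ht : t ∈ Icc 0 T) (x : T3) {Y : ℝ → R3 × ℝ} (hR : ∀ s ∈ Icc 0 t, (Y s).2 ≤ R) :
    |charValue k δ w₀ t x Y| ≤ (W + k * δ * T) * Real.exp (k * R) := by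
  have h0 : (0 : ℝ) ∈ Icc 0 t := ⟨le_rfl, ht.1⟩
  have hW0 : 0 ≤ W := (abs_nonneg _).trans (hW 0)
  have hexp : ∀ s ∈ Icc 0 t, Real.exp (k * (Y s).2) ≤ Real.exp (k * R) := fun s hs =>
    Real.exp_le_exp.2 (mul_le_mul_of_nonneg_left (hR s hs) hk)
  have h3 : |∫ s in (0 : ℝ)..t, Real.exp (k * (Y s).2)| ≤ Real.exp (k * R) * T := by
    have := intervalIntegral.norm_integral_le_of_norm_le_const (a := (0 : ℝ)) (b := t)
      (f := fun s => Real.exp (k * (Y s).2)) (C := Real.exp (k * R))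
      (fun s hs => by
        rw [Real.norm_of_nonneg (Real.exp_pos _).le]
        exact hexp s (by rw [uIoc_of_le ht.1] at hs; exact ⟨hs.1.le, hs.2⟩))
    rw [sub_zero, abs_of_nonneg ht.1] at this
    exact this.trans (mul_le_mul_of_nonneg_left ht.2 (by positivity))
  refine (abs_add_le _ _).trans ?_
  rw [abs_mul, abs_mul (k * δ), abs_of_nonneg (mul_nonneg hk hδ), Real.abs_exp]
  calc _ ≤ W * Real.exp (k * R) + k * δ * (Real.exp (k * R) * T) := by
        gcongr
        · exact hW _
        · exact hR 0 h0
    _ = _ := by ring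

lemma snd_le_of_norm_le {Y : R3 × ℝ} {R : ℝ} (h : ‖Y‖ ≤ R) : Y.2 ≤ R :=
  (le_abs_self _).trans ((norm_snd_le Y).trans h)

lemma charCurve_snd_le (h : IsField B L v d) {t : ℝ} (ht : t ∈ Icc 0 T) (x : T3) :
    ∀ s ∈ Icc 0 t, (charCurve v d T t x s).2 ≤ B * T := fun _ hs =>
  snd_le_of_norm_le (norm_charCurve_le' h ht ⟨hs.1, hs.2.trans ht.2⟩ x)

lemma charCurve_continuousOn (h : IsField B L v d) {t : ℝ} (ht : t ∈ Icc 0 T) (x : T3) :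
    ContinuousOn (charCurve v d T t x) (Icc 0 t) :=
  (charCurve_spec h ht x).2.continuousOn.mono (Icc_subset_Icc_right ht.2)

lemma abs_transport_le (h : IsField B L v d) (hT : 0 ≤ T) (hk : 0 ≤ k) (hδ : 0 ≤ δ)
    (hW : ∀ x, |w₀ x| ≤ W) (t : ℝ) (x : T3) :
    |transport k δ T w₀ v d t x| ≤ (W + k * δ * T) * Real.exp (k * (B * T)) :=
  abs_charValue_le hk hδ hW (clamp_mem hT t) x (charCurve_snd_le h (clamp_mem hT t) x)

/-- Stability of the transport equation with respect to the velocity field. -/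
lemma abs_transport_sub_le {v' : ℝ → T3 → R3} {d' : ℝ → T3 → ℝ}
    (h : IsField B L v d) (h' : IsField B L v' d') (hk : 0 ≤ k) (hδ : 0 ≤ δ)
    (hW : ∀ x, |w₀ x| ≤ W) (hLw : ∀ x y, |w₀ (x + toTorus y) - w₀ x| ≤ Lw * ‖y‖)
    {t η : ℝ} (ht : t ∈ Icc 0 T) (hη : 0 ≤ η)
    (hv : ∀ s ∈ Icc 0 t, ∀ x, ‖v s x - v' s x‖ ≤ η)
    (hd : ∀ s ∈ Icc 0 t, ∀ x, |d s x - d' s x| ≤ η) (x : T3) :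
    |transport k δ T w₀ v d t x - transport k δ T w₀ v' d' t x|
      ≤ (Lw + W * k + k * δ * k * T) * Real.exp (k * (B * T)) * (charConst L T * η) := by
  unfold transport
  rw [clamp_eq ht]
  refine charValue_sub_le hk hδ hW hLw ht x (charCurve_continuousOn h ht x)
    (charCurve_continuousOn h' ht x) (charCurve_snd_le h ht x) (charCurve_snd_le h' ht x) ?_
  intro s hs
  have h1 := charCurve_spec h ht x
  have h2 := charCurve_spec h' ht x
  have := h1.2.norm_sub_le_of_approx h h2.2 ht (δ := 0) hη
    (by rw [h1.1, h2.1]; simp) (fun s hs => ?_) hs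
  · simpa using this
  · refine max_le ?_ ?_
    · rw [Prod.fst_sub, norm_sub_rev]
      exact hv s hs _
    · rw [Prod.snd_sub]
      simp only [charField, neg_sub_neg]
      exact hd s hs _

lemma abs_transport_shift_le (h : IsField B L v d) (hT : 0 ≤ T) (hk : 0 ≤ k) (hδ : 0 ≤ δ)
    (hW : ∀ x, |w₀ x| ≤ W) (hLw : ∀ x y, |w₀ (x + toTorus y) - w₀ x| ≤ Lw * ‖y‖)
    (t : ℝ) (x : T3) (y : R3) :
    |transport k δ T w₀ v d t (x + toTorus y) - transport k δ T w₀ v d t x|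
      ≤ (Lw + W * k + k * δ * k * T) * Real.exp (k * (B * T)) * charConst L T * ‖y‖ := by
  unfold transport
  have ht := clamp_mem hT t
  set τ := clamp T t
  set Y' := charCurve v d T τ (x + toTorus y) with hY'
  have h1 := charCurve_spec h ht x
  have h2 := charCurve_spec h ht (x + toTorus y)
  -- The base point is shifted back to `x`; the characteristic then ends at displacement `y` instead
  -- of 0, and the stability estimate applies to one and the same field.
  have e : charValue k δ w₀ τ (x + toTorus y) Y'
      = charValue k δ w₀ τ x (fun s => Y' s + (y, 0)) := by
    simp [charValue, toTorus_add, add_assoc, add_comm (toTorus y)]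
  have h3 : IsChar v d T x (fun s => Y' s + (y, 0)) := by
    intro s hs
    have := (h2.2 s hs).add_const ((y, 0) : R3 × ℝ)
    refine this.congr_deriv ?_
    simp [charField, toTorus_add, ← hY', add_assoc, add_comm (toTorus y)]
  rw [e, mul_assoc _ (charConst L T)]
  refine charValue_sub_le hk hδ hW hLw ht x
    (h3.continuousOn.mono (Icc_subset_Icc_right ht.2)) (charCurve_continuousOn h ht x)
    (fun s hs => by simpa using charCurve_snd_le h ht (x + toTorus y) s hs)
    (charCurve_snd_le h ht x) ?_
  intro s hs
  have := h3.norm_sub_le_of_approx h h1.2 ht (δ := ‖y‖) le_rfl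
    (by
      rw [h1.1]
      simp only [hY', h2.1]
      simp [Prod.norm_def]) (fun s hs => by simp) hs
  simpa using this

/-- The solution of the transport equation along a characteristic. -/
lemma transport_along (h : IsField B L v d) {t t' : ℝ} (ht : t ∈ Icc 0 T) (ht' : t' ∈ Icc 0 T)
    (x : T3) :
    transport k δ T w₀ v d t' (x + toTorus (charCurve v d T t x t').1)
      = Real.exp (-(k * (charCurve v d T t x t').2)) * charValue k δ w₀ t' x (charCurve v d T t x) := by
  unfold transport
  rw [clamp_eq ht']
  set Y := charCurve v d T t x with hY
  have h1 := charCurve_spec h ht x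
  rw [← hY] at h1
  have h2 := charCurve_spec h ht' (x + toTorus (Y t').1)
  set Y' := charCurve v d T t' (x + toTorus (Y t').1) with hY'
  -- The original curve recentred at its value at time `t'` solves the same equations, so by
  -- uniqueness it is the characteristic through the new point.
  have h3 : IsChar v d T (x + toTorus (Y t').1) (fun s => Y s - Y t') := by
    intro s hs
    have := (h1.2 s hs).sub_const (Y t')
    refine this.congr_deriv ?_
    simp [charField, toTorus_sub, add_assoc]
  have h4 : ∀ s ∈ Icc 0 t', Y' s = Y s - Y t' := by
    intro s hs
    have := h2.2.norm_sub_le_of_approx h h3 ht' (δ := 0) (η := 0) le_rfl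
      (by rw [h2.1]; simp) (fun s hs => by simp) hs
    rw [add_zero, mul_zero] at this
    exact sub_eq_zero.1 (norm_le_zero_iff.1 this)
  have h5 : ∫ s in (0 : ℝ)..t', Real.exp (k * (Y' s).2)
      = Real.exp (-(k * (Y t').2)) * ∫ s in (0 : ℝ)..t', Real.exp (k * (Y s).2) := by
    rw [← intervalIntegral.integral_const_mul]
    refine intervalIntegral.integral_congr fun s hs => ?_
    rw [uIcc_of_le ht'.1] at hs
    simp only [h4 s hs, ← Real.exp_add, Prod.snd_sub]
    congr 1; ring
  unfold charValue
  rw [h5, h4 0 ⟨le_rfl, ht'.1⟩]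
  have h6 : x + toTorus (Y t').1 + toTorus (Y 0 - Y t').1 = x + toTorus (Y 0).1 := by
    rw [Prod.fst_sub, toTorus_sub]; abel
  have h7 : Real.exp (k * (Y 0 - Y t').2)
      = Real.exp (-(k * (Y t').2)) * Real.exp (k * (Y 0).2) := by
    rw [← Real.exp_add, Prod.snd_sub]; congr 1; ring
  rw [h6, h7]
  ring

/-- In the product of `transport_along`, the exponential factor contributes k d w, and the upper
limit of the source integral contributes k δ once the two exponentials cancel. -/
lemma hasDerivAt_transport_along (h : IsField B L v d) {t t' : ℝ} (ht : t ∈ Icc 0 T)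
    (ht' : t' ∈ Ioo 0 T) (x : T3) :
    HasDerivAt (fun s => transport k δ T w₀ v d s (x + toTorus (charCurve v d T t x s).1))
      (k * d t' (x + toTorus (charCurve v d T t x t').1)
        * transport k δ T w₀ v d t' (x + toTorus (charCurve v d T t x t').1) + k * δ) t' := by
  have ht'' : t' ∈ Icc 0 T := ⟨ht'.1.le, ht'.2.le⟩
  have h1 := (charCurve_spec h ht x).2
  have e := fun s (hs : s ∈ Icc 0 T) => transport_along (k := k) (δ := δ) (w₀ := w₀) h ht hs x
  set Y := charCurve v d T t x with hY
  have h2 : HasDerivAt (fun s => (Y s).2) (-d t' (x + toTorus (Y t').1)) t' :=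
    (ContinuousLinearMap.snd ℝ R3 ℝ).hasFDerivAt.comp_hasDerivAt t' (h1 t' ht'')
  have h3 : HasDerivAt (fun s => charValue k δ w₀ s x Y)
      (k * δ * Real.exp (k * (Y t').2)) t' := by
    refine HasDerivAt.const_add _ (HasDerivAt.const_mul _ ?_)
    have hc : ContinuousOn (fun s => Real.exp (k * (Y s).2)) (Icc 0 T) := by
      have := h1.continuousOn
      fun_prop
    refine intervalIntegral.integral_hasDerivAt_right ?_ ?_ ?_
    · refine ContinuousOn.intervalIntegrable ?_
      rw [uIcc_of_le ht'.1.le]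
      exact hc.mono (Icc_subset_Icc_right ht'.2.le)
    · exact ContinuousOn.stronglyMeasurableAtFilter isOpen_Ioo (hc.mono Ioo_subset_Icc_self) t' ht'
    · exact hc.continuousAt (Icc_mem_nhds ht'.1 ht'.2)
  have h4 := ((h2.const_mul k).neg.exp).mul h3
  refine (h4.congr_of_eventuallyEq ?_).congr_deriv ?_
  · filter_upwards [Icc_mem_nhds ht'.1 ht'.2] with s hs
    exact e s hs
  · rw [e t' ht'']
    have h5 : Real.exp (-(k * (Y t').2)) * Real.exp (k * (Y t').2) = 1 := by
      rw [← Real.exp_add]; simp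
    linear_combination (k * δ) * h5

/-- The differential form of the transport equation. -/
lemma exists_curve_transport (h : IsField B L v d) {t : ℝ} (ht : t ∈ Ioo 0 T) (x : T3) :
    ∃ ξ : ℝ → R3, ξ t = 0 ∧ HasDerivAt ξ (v t x) t ∧
      HasDerivAt (fun s => transport k δ T w₀ v d s (x + toTorus (ξ s)))
        (k * d t x * transport k δ T w₀ v d t x + k * δ) t := by
  have ht' : t ∈ Icc 0 T := ⟨ht.1.le, ht.2.le⟩
  have h1 := charCurve_spec h ht' x
  have h2 := hasDerivAt_transport_along (k := k) (δ := δ) (w₀ := w₀) h ht' ht x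
  have h3 := h1.2 t ht'
  have h4 := (ContinuousLinearMap.fst ℝ R3 ℝ).hasFDerivAt.comp_hasDerivAt t h3
  rw [h1.1] at h2 h4
  refine ⟨fun s => (charCurve v d T t x s).1, by simp only [h1.1]; rfl, ?_, ?_⟩
  · refine h4.congr_deriv ?_
    simp [charField, toTorus_zero]
  · simpa [toTorus_zero] using h2

/-- The source is nonnegative and can be dropped; the second component of the characteristic at time
0 is at least -βT. The bound `β` is kept apart from the field bound `B`, because later `β` is
independent of the pressure cutoff and `B` is not. -/
lemma le_transport (h : IsField B L v d) (hT : 0 ≤ T) (hk : 0 ≤ k) (hδ : 0 ≤ δ) {c β : ℝ}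
    (hc : 0 ≤ c) (hw₀ : ∀ x, c ≤ w₀ x) (hβ : ∀ t x, |d t x| ≤ β) (t : ℝ) (x : T3) :
    c * Real.exp (-(k * (β * T))) ≤ transport k δ T w₀ v d t x := by
  have hβ0 : 0 ≤ β := (abs_nonneg _).trans (hβ 0 0)
  have ht := clamp_mem hT t
  have h0 : (0 : ℝ) ∈ Icc 0 T := ⟨le_rfl, hT⟩
  unfold transport
  set τ := clamp T t
  have h1 := charCurve_spec h ht x
  set Y := charCurve v d T τ x
  have h2 : |(Y 0).2 - (Y τ).2| ≤ β * |0 - τ| := by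
    refine Convex.norm_image_sub_le_of_norm_hasDerivWithin_le (f := fun s => (Y s).2)
      (f' := fun s => -d s (x + toTorus (Y s).1)) (s := Icc 0 T) (fun s hs => ?_)
      (fun s _ => ?_) (convex_Icc 0 T) ht h0
    · exact ((ContinuousLinearMap.snd ℝ R3 ℝ).hasFDerivAt.comp_hasDerivAt s
        (h1.2 s hs)).hasDerivWithinAt
    · rw [norm_neg]; exact hβ _ _
  rw [h1.1, zero_sub, abs_neg, abs_of_nonneg ht.1] at h2
  have h3 : -(β * T) ≤ (Y 0).2 := by
    have := (abs_le.1 h2).1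
    simp only [Prod.snd_zero, sub_zero] at this
    nlinarith [ht.2]
  have h4 : 0 ≤ k * δ * ∫ s in (0 : ℝ)..τ, Real.exp (k * (Y s).2) :=
    mul_nonneg (mul_nonneg hk hδ)
      (intervalIntegral.integral_nonneg ht.1 fun s _ => (Real.exp_pos _).le)
  have h5 : c * Real.exp (-(k * (β * T))) ≤ w₀ (x + toTorus (Y 0).1) * Real.exp (k * (Y 0).2) := by
    refine mul_le_mul (hw₀ _) (Real.exp_le_exp.2 ?_) (Real.exp_pos _).le (hc.trans (hw₀ _))
    nlinarith
  unfold charValue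
  linarith

/-- The solution of the transport equation is Lipschitz continuous in space and time. -/
lemma exists_stLip_transport (hT : 0 ≤ T) (hk : 0 ≤ k) (hδ : 0 ≤ δ) (B L : ℝ)
    (hW : ∀ x, |w₀ x| ≤ W) (hLw : ∀ x y, |w₀ (x + toTorus y) - w₀ x| ≤ Lw * ‖y‖) :
    ∃ Λ, ∀ v d, IsField B L v d → STLip Λ (transport k δ T w₀ v d) := by
  set Lx := (Lw + W * k + k * δ * k * T) * Real.exp (k * (B * T)) * charConst L T with hLx
  set M := (W + k * δ * T) * Real.exp (k * (B * T)) with hM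
  refine ⟨Lx + (Lx * B + (k * B * M + k * δ)), fun v d h => ?_⟩
  have hB := h.nonneg_B
  have hsp : ∀ t x y, |transport k δ T w₀ v d t (x + toTorus y) - transport k δ T w₀ v d t x|
      ≤ Lx * ‖y‖ := fun t x y => abs_transport_shift_le h hT hk hδ hW hLw t x y
  have hbd := fun t x => abs_transport_le (k := k) (δ := δ) h hT hk hδ hW t x
  have hLx0 : 0 ≤ Lx := by
    simpa [norm_unitVec] using (abs_nonneg _).trans (hsp 0 0 (unitVec 0))
  have hM0 : 0 ≤ M := (abs_nonneg _).trans (hbd 0 0)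
  have hcl : ∀ t x, transport k δ T w₀ v d (clamp T t) x = transport k δ T w₀ v d t x := by
    intro t x
    unfold transport
    rw [clamp_eq (clamp_mem hT t)]
  have hder : ∀ t ∈ Icc 0 T, ∀ x, ∀ a ∈ Icc 0 T, ∀ b ∈ Icc 0 T, a ≤ b →
      |transport k δ T w₀ v d b (x + toTorus (charCurve v d T t x b).1)
        - transport k δ T w₀ v d a (x + toTorus (charCurve v d T t x a).1)|
        ≤ (k * B * M + k * δ) * |b - a| := by
    intro t ht x a ha b hb hab
    rcases hab.eq_or_lt with rfl | hab
    · simp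
    have hYc := (charCurve_spec h ht x).2.continuousOn
    have hcont : ContinuousOn (fun s => transport k δ T w₀ v d s
        (x + toTorus (charCurve v d T t x s).1)) (Icc a b) := by
      have hc1 : ContinuousOn (fun s => Real.exp (-(k * (charCurve v d T t x s).2))
          * charValue k δ w₀ s x (charCurve v d T t x)) (Icc 0 T) := by
        refine ContinuousOn.mul (by fun_prop) (ContinuousOn.add continuousOn_const
          (continuousOn_const.mul ?_))
        have := intervalIntegral.continuousOn_primitive_interval (μ := volume)
          (f := fun s => Real.exp (k * (charCurve v d T t x s).2)) (a := 0) (b := T) ?_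
        · rwa [uIcc_of_le hT] at this
        · rw [uIcc_of_le hT]
          exact ContinuousOn.integrableOn_Icc (by fun_prop)
      refine (hc1.congr fun s hs => transport_along h ht hs x).mono (Icc_subset_Icc ha.1 hb.2)
    obtain ⟨c, hc, hc'⟩ := exists_hasDerivAt_eq_slope _ _ hab hcont fun s hs =>
      hasDerivAt_transport_along (k := k) (δ := δ) (w₀ := w₀) h ht
        ⟨ha.1.trans_lt hs.1, hs.2.trans_le hb.2⟩ x
    rw [eq_div_iff (sub_pos.2 hab).ne'] at hc'
    rw [← hc', abs_mul]
    refine mul_le_mul_of_nonneg_right ?_ (abs_nonneg _)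
    refine (abs_add_le _ _).trans ?_
    rw [abs_mul, abs_mul, abs_of_nonneg hk, abs_of_nonneg (mul_nonneg hk hδ)]
    gcongr
    · exact h.abs_d_le _ _
    · exact hbd _ _
  have hder' : ∀ t ∈ Icc 0 T, ∀ x, ∀ a ∈ Icc 0 T,
      |transport k δ T w₀ v d a (x + toTorus (charCurve v d T t x a).1)
        - transport k δ T w₀ v d t x| ≤ (k * B * M + k * δ) * |a - t| := by
    intro t ht x a ha
    have e : x + toTorus (charCurve v d T t x t).1 = x := by
      rw [(charCurve_spec h ht x).1]; simp [toTorus_zero]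
    rcases le_total a t with hat | hat
    · have := hder t ht x a ha t ht hat
      rwa [abs_sub_comm, abs_sub_comm t a, e] at this
    · have := hder t ht x t ht a ha hat
      rwa [e] at this
  -- A time increment is split into a step along the characteristic, controlled by the equation, and
  -- a spatial step of length at most `B` times the elapsed time.
  have htime : ∀ s t x, |transport k δ T w₀ v d s x - transport k δ T w₀ v d t x|
      ≤ (Lx * B + (k * B * M + k * δ)) * |s - t| := by
    intro s t x
    rw [← hcl s, ← hcl t]
    have hs := clamp_mem hT s
    have ht := clamp_mem hT t
    have h1 := abs_clamp_sub_le T s t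
    set s' := clamp T s
    set t' := clamp T t
    have h2 := hder' t' ht x s' hs
    have h3 := hsp s' x (charCurve v d T t' x s').1
    have h4 : ‖(charCurve v d T t' x s').1‖ ≤ B * |s' - t'| :=
      (norm_fst_le _).trans (norm_charCurve_le h ht hs x)
    rw [abs_sub_comm] at h3
    have h5 := abs_sub_le (transport k δ T w₀ v d s' x)
      (transport k δ T w₀ v d s' (x + toTorus (charCurve v d T t' x s').1))
      (transport k δ T w₀ v d t' x)
    calc _ ≤ Lx * (B * |s' - t'|) + (k * B * M + k * δ) * |s' - t'| :=
          h5.trans (add_le_add (h3.trans (mul_le_mul_of_nonneg_left h4 hLx0)) h2)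
      _ = (Lx * B + (k * B * M + k * δ)) * |s' - t'| := by ring
      _ ≤ _ := mul_le_mul_of_nonneg_left h1 (by positivity)
  intro s t x y
  have h1 := abs_sub_le (transport k δ T w₀ v d s (x + toTorus y)) (transport k δ T w₀ v d s x)
    (transport k δ T w₀ v d t x)
  have h2 := hsp s x y
  have h3 := htime s t x
  have h4 : 0 ≤ Lx * B + (k * B * M + k * δ) := by positivity
  calc _ ≤ Lx * ‖y‖ + (Lx * B + (k * B * M + k * δ)) * |s - t| := h1.trans (add_le_add h2 h3)
    _ ≤ _ := by
      have h5 := mul_nonneg hLx0 (abs_nonneg (s - t))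
      have h6 := mul_nonneg h4 (norm_nonneg y)
      linarith

end transport

/-! ### A fixed point theorem in exponentially weighted norms. -/

/-- The weight e^(lt) turns the memory of a Volterra map into the factor C/l, so no smallness of `T`
is required. The clamping hypothesis reduces all times to [0,T]. -/
lemma exists_fixedPoint_of_volterra {T M C : ℝ} (hT : 0 ≤ T) (hM : 0 ≤ M) (hC : 0 ≤ C)
    (Φ : (ℝ → T3 → ℝ) → ℝ → T3 → ℝ)
    (hΦ : ∀ q : ℝ → T3 → ℝ, Continuous q.uncurry → (∀ t x, |q t x| ≤ M) →
      Continuous (Φ q).uncurry ∧ ∀ t x, |Φ q t x| ≤ M)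
    (hclamp : ∀ q t x, Φ q (clamp T t) x = Φ q t x)
    (hcontr : ∀ q q' : ℝ → T3 → ℝ, Continuous q.uncurry → (∀ t x, |q t x| ≤ M) →
      Continuous q'.uncurry → (∀ t x, |q' t x| ≤ M) → ∀ l D : ℝ, 0 < l → 0 ≤ D →
      (∀ t ∈ Icc 0 T, ∀ x, |q t x - q' t x| ≤ D * Real.exp (l * t)) →
      ∀ t ∈ Icc 0 T, ∀ x, |Φ q t x - Φ q' t x| ≤ C / l * (D * Real.exp (l * t))) :
    ∃ q : ℝ → T3 → ℝ, Continuous q.uncurry ∧ (∀ t x, |q t x| ≤ M) ∧ Φ q = q := by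
  -- This choice makes C/l at most 1/2.
  set l := 2 * C + 1 with hl
  have hl0 : 0 < l := by positivity
  have hCl : C / l ≤ 1 / 2 := by rw [div_le_iff₀ hl0]; linarith
  let a : ℕ → ℝ → T3 → ℝ := fun n => Φ^[n] (fun _ _ => 0)
  have ha_succ : ∀ n, a (n + 1) = Φ (a n) := fun n => Function.iterate_succ_apply' _ _ _
  have ha : ∀ n, Continuous (a n).uncurry ∧ ∀ t x, |a n t x| ≤ M := by
    intro n
    induction n with
    | zero => exact ⟨continuous_const, fun t x => by simpa [a] using hM⟩
    | succ n ih => rw [ha_succ]; exact hΦ _ ih.1 ih.2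
  have hac : ∀ n t x, a n (clamp T t) x = a n t x := by
    intro n t x
    cases n with
    | zero => simp [a]
    | succ n => rw [ha_succ]; exact hclamp _ _ _
  have hdiff : ∀ n, ∀ t ∈ Icc 0 T, ∀ x,
      |a n t x - a (n + 1) t x| ≤ 2 * M * (1 / 2) ^ n * Real.exp (l * t) := by
    intro n
    induction n with
    | zero =>
      intro t ht x
      have h1 := (ha 0).2 t x
      have h2 := (ha 1).2 t x
      have h3 : 1 ≤ Real.exp (l * t) := Real.one_le_exp (mul_nonneg hl0.le ht.1)
      have h4 := abs_sub (a 0 t x) (a 1 t x)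
      rw [zero_add, pow_zero, mul_one]
      nlinarith
    | succ n ih =>
      intro t ht x
      have h1 := hcontr (a n) (a (n + 1)) (ha _).1 (ha _).2 (ha _).1 (ha _).2 l
        (2 * M * (1 / 2) ^ n) hl0 (by positivity) ih t ht x
      rw [ha_succ n, ha_succ (n + 1)]
      refine h1.trans ?_
      calc _ ≤ 1 / 2 * (2 * M * (1 / 2) ^ n * Real.exp (l * t)) := by gcongr
        _ = _ := by ring
  set R := 2 * M * Real.exp (l * T) with hR
  have hgeo : ∀ t x n, dist (a n t x) (a (n + 1) t x) ≤ R * (1 / 2) ^ n := by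
    intro t x n
    rw [Real.dist_eq, ← hac n, ← hac (n + 1)]
    have ht := clamp_mem hT t
    refine (hdiff n _ ht x).trans ?_
    calc _ ≤ 2 * M * (1 / 2) ^ n * Real.exp (l * T) := by gcongr; exact ht.2
      _ = _ := by rw [hR]; ring
  have hlim : ∀ t x, ∃ y, Tendsto (fun n => a n t x) atTop (𝓝 y) := fun t x =>
    cauchySeq_tendsto_of_complete (cauchySeq_of_le_geometric (1 / 2) R (by norm_num) (hgeo t x))
  choose q hq using hlim
  have hrate : ∀ n t x, |a n t x - q t x| ≤ 2 * R * (1 / 2) ^ n := by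
    intro n t x
    have := dist_le_of_le_geometric_of_tendsto (1 / 2) R (by norm_num) (hgeo t x) (hq t x) n
    rw [Real.dist_eq] at this
    refine this.trans (le_of_eq ?_)
    ring
  have hpow : Tendsto (fun n : ℕ => 2 * R * (1 / 2 : ℝ) ^ n) atTop (𝓝 0) := by
    simpa using (tendsto_pow_atTop_nhds_zero_of_lt_one (r := (1 / 2 : ℝ)) (by norm_num)
      (by norm_num)).const_mul (2 * R)
  have hqc : Continuous q.uncurry := by
    have hu : TendstoUniformly (fun n => (a n).uncurry) q.uncurry atTop := by
      rw [Metric.tendstoUniformly_iff]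
      intro ε hε
      filter_upwards [hpow.eventually (gt_mem_nhds hε)] with n hn z
      rw [dist_comm, Real.dist_eq]
      exact (hrate n z.1 z.2).trans_lt hn
    exact hu.continuous (Frequently.of_forall fun n => (ha n).1)
  have hqM : ∀ t x, |q t x| ≤ M := fun t x =>
    le_of_tendsto (hq t x).abs (Eventually.of_forall fun n => (ha n).2 t x)
  refine ⟨q, hqc, hqM, ?_⟩
  ext t x
  have hR0 : 0 ≤ R := by positivity
  -- The contraction estimate, applied to the iterate and the limit, also gives the continuity of
  -- `Φ` needed to pass to the limit.
  have h1 : Tendsto (fun n => a (n + 1) t x) atTop (𝓝 (Φ q t x)) := by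
    rw [tendsto_iff_dist_tendsto_zero]
    have h2 : Tendsto (fun n : ℕ => C / l * (2 * R * (1 / 2 : ℝ) ^ n * Real.exp (l * T))) atTop
        (𝓝 0) := by
      simpa using (hpow.mul_const (Real.exp (l * T))).const_mul (C / l)
    refine squeeze_zero (fun _ => dist_nonneg) (fun n => ?_) h2
    rw [Real.dist_eq, ha_succ, ← hclamp, ← hclamp q]
    have ht := clamp_mem hT t
    refine (hcontr (a n) q (ha _).1 (ha _).2 hqc hqM l (2 * R * (1 / 2) ^ n) hl0 (by positivity)
      (fun s hs y => (hrate n s y).trans ?_) _ ht x).trans ?_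
    · exact le_mul_of_one_le_right (by positivity) (Real.one_le_exp (mul_nonneg hl0.le hs.1))
    · gcongr; exact ht.2
  exact tendsto_nhds_unique h1 ((tendsto_add_atTop_iff_nat 1).2 (hq t x))

/-! ### The velocity generated by a bounded pressure, and the coupled system with truncated
pressure. -/

lemma STLip.conv {K : R3 → ℝ} (hK : IsTestKernel K) {f : ℝ → T3 → ℝ} {L : ℝ} (hf : STLip L f) :
    STLip ((∫ y, |K y|) * L) fun t => conv K (f t) := by
  intro s t x y
  have hc : ∀ t, Continuous (f t) := fun t =>
    hf.continuous.comp (f := fun x => (t, x)) (by fun_prop)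
  simp only
  rw [conv_shift, mul_assoc]
  exact abs_conv_sub_le hK ((hc s).comp (by fun_prop)) (hc t) (fun z => hf s t z y) x

/-- `g` is twice continuously differentiable with first derivatives `G` and second
derivatives `GG`. -/
structure IsC2 (g : T3 → ℝ) (G : Fin 3 → T3 → ℝ) (GG : Fin 3 → Fin 3 → T3 → ℝ) : Prop where
  grad : HasGrad g G
  grad_grad : ∀ i, HasGrad (G i) (GG i)
  continuous : ∀ i j, Continuous (GG i j)

lemma TorusContDiff.exists_isC2 {g : T3 → ℝ} (hg : TorusContDiff 2 g) : ∃ G GG, IsC2 g G GG := by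
  obtain ⟨G, hG, hG'⟩ := TorusContDiff.exists_hasGrad (n := 1) (f := g) hg
  have h1 : ∀ i, TorusContDiff (((0 : ℕ∞) : WithTop ℕ∞) + 1) (G i) := fun i => by
    have := hG' i
    simpa using this
  choose GG hGG hGG' using fun i => (h1 i).exists_hasGrad
  exact ⟨G, GG, hG, hGG, fun i j => (hGG' i j).continuous⟩

/-- The force `∂ⱼ[q]` in the momentum equation. -/
def force (K : R3 → ℝ) (q : ℝ → T3 → ℝ) (j : Fin 3) (t : ℝ) (x : T3) : ℝ := conv (pd j K) (q t) x

/-- The velocity generated by the pressure `q`. -/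
def velocity (K : R3 → ℝ) (T : ℝ) (u₀ : Fin 3 → T3 → ℝ) (q : ℝ → T3 → ℝ) (j : Fin 3) (t : ℝ)
    (x : T3) : ℝ :=
  duhamel (u₀ j) (force K q j) (clamp T t) x

/-- The mollified velocity field. -/
def transportVelocity (K : R3 → ℝ) (T : ℝ) (u₀ : Fin 3 → T3 → ℝ) (q : ℝ → T3 → ℝ) (t : ℝ)
    (x : T3) : R3 :=
  WithLp.toLp 2 fun i => conv K (velocity K T u₀ q i t) x

/-- The divergence of the mollified velocity field. -/
def transportDiv (K : R3 → ℝ) (T : ℝ) (u₀ : Fin 3 → T3 → ℝ) (q : ℝ → T3 → ℝ) (t : ℝ)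
    (x : T3) : ℝ :=
  ∑ i, conv (pd i K) (velocity K T u₀ q i t) x

section velocity

variable {K : R3 → ℝ} {T M : ℝ} {u₀ : Fin 3 → T3 → ℝ} {q : ℝ → T3 → ℝ}
  {G : Fin 3 → Fin 3 → T3 → ℝ} {GG : Fin 3 → Fin 3 → Fin 3 → T3 → ℝ}

lemma BddCont.force (hK : IsTestKernel K) (hq : BddCont q) (j : Fin 3) : BddCont (force K q j) :=
  hq.conv (hK.pd j)

lemma continuous_velocity (hK : IsTestKernel K) (hu : ∀ j, Continuous (u₀ j)) (hq : BddCont q)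
    (j : Fin 3) : Continuous (velocity K T u₀ q j).uncurry :=
  (continuous_duhamel (hu j) (hq.force hK j)).comp
    (f := fun p : ℝ × T3 => (clamp T p.1, p.2)) (by fun_prop)

lemma abs_velocity_le (hK : IsTestKernel K) (hT : 0 ≤ T) {C : ℝ} (hC : ∀ j x, |u₀ j x| ≤ C)
    (hM : ∀ t x, |q t x| ≤ M) (j : Fin 3) (t : ℝ) (x : T3) :
    |velocity K T u₀ q j t x| ≤ C + (∑ i, ∫ y, |pd i K y|) * M * T := by
  have hM0 : 0 ≤ M := (abs_nonneg _).trans (hM 0 0)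
  have ht := clamp_mem hT t
  have h1 : ∀ t x, |force K q j t x| ≤ (∑ i, ∫ y, |pd i K y|) * M := by
    intro t x
    refine (abs_conv_le (hK.pd j) (hM t) x).trans (mul_le_mul_of_nonneg_right ?_ hM0)
    exact Finset.single_le_sum (f := fun i => ∫ y, |pd i K y|)
      (fun i _ => integral_nonneg fun y => abs_nonneg _) (Finset.mem_univ j)
  refine (abs_duhamel_le (hC j) h1 ht.1 x).trans ?_
  have : 0 ≤ (∑ i, ∫ y, |pd i K y|) * M := (abs_nonneg _).trans (h1 0 0)
  have := mul_le_mul_of_nonneg_left ht.2 this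
  linarith

lemma norm_le_sum_abs (v : R3) : ‖v‖ ≤ ∑ i, |v i| := by
  conv_lhs => rw [eq_sum_unitVec v]
  refine (norm_sum_le _ _).trans (Finset.sum_le_sum fun i _ => ?_)
  rw [norm_smul, norm_unitVec, mul_one, Real.norm_eq_abs]

lemma sum_fin_three_le {a : Fin 3 → ℝ} {c : ℝ} (h : ∀ i, a i ≤ c) : ∑ i, a i ≤ 3 * c := by
  refine (Finset.sum_le_sum fun i _ => h i).trans (le_of_eq ?_)
  simp

/-- The spatial derivative of the force falls on the kernel, so the constant depends on `q` only
through its bound `M`. -/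
lemma exists_lip_velocity (hK : IsTestKernel K) (hT : 0 ≤ T) (M : ℝ)
    (hu : ∀ j, IsC2 (u₀ j) (G j) (GG j)) :
    ∃ L, 0 ≤ L ∧ ∀ q : ℝ → T3 → ℝ, Continuous q.uncurry → (∀ t x, |q t x| ≤ M) →
      ∀ j t x y, |velocity K T u₀ q j t (x + toTorus y) - velocity K T u₀ q j t x| ≤ L * ‖y‖ := by
  choose C hC0 hC using fun j i => exists_abs_le_of_continuous ((hu j).grad_grad i).continuous
  set C₁ := ∑ j, ∑ i, C j i with hC₁
  have hCle : ∀ j i, C j i ≤ C₁ := fun j i =>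
    (Finset.single_le_sum (fun i _ => hC0 j i) (Finset.mem_univ i)).trans
      (Finset.single_le_sum (f := fun j => ∑ i, C j i)
        (fun j _ => Finset.sum_nonneg fun i _ => hC0 j i) (Finset.mem_univ j))
  have hC₁0 : 0 ≤ C₁ := (hC0 0 0).trans (hCle 0 0)
  set A := ∑ j, ∑ i, ∫ y, |pd i (pd j K) y| with hA
  have hI : ∀ j i, 0 ≤ ∫ y, |pd i (pd j K) y| := fun j i => integral_nonneg fun y => abs_nonneg _
  have hAle : ∀ j i, ∫ y, |pd i (pd j K) y| ≤ A := fun j i =>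
    (Finset.single_le_sum (fun i _ => hI j i) (Finset.mem_univ i)).trans
      (Finset.single_le_sum (f := fun j => ∑ i, ∫ y, |pd i (pd j K) y|)
        (fun j _ => Finset.sum_nonneg fun i _ => hI j i) (Finset.mem_univ j))
  have hA0 : 0 ≤ A := (hI 0 0).trans (hAle 0 0)
  refine ⟨3 * C₁ + 3 * (A * |M|) * T, by positivity, fun q hqc hM j t x y => ?_⟩
  have hq : BddCont q := ⟨hqc, M, hM⟩
  have ht := clamp_mem hT t
  have h1 : ∀ x y, |u₀ j (x + toTorus y) - u₀ j x| ≤ 3 * C₁ * ‖y‖ := fun x y =>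
    (hu j).grad.abs_sub_le (fun i x => (hC j i x).trans (hCle j i)) x y
  have h2 : ∀ t x y, |force K q j t (x + toTorus y) - force K q j t x|
      ≤ 3 * (A * |M|) * ‖y‖ := fun t x y => by
    refine (hasGrad_conv (hK.pd j) (hq.continuous_apply t)).abs_sub_le (fun i x => ?_) x y
    refine (abs_conv_le ((hK.pd j).pd i) (fun x => (hM t x).trans (le_abs_self M)) x).trans ?_
    exact mul_le_mul_of_nonneg_right (hAle j i) (abs_nonneg _)
  refine (abs_duhamel_shift_le (hu j).grad.continuous (hq.force hK j) h1 h2 ht.1 x y).trans ?_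
  have := ht.2
  gcongr

/-- Uniformity over all pressures bounded by `M` gives the fixed point map one set of constants for
characteristics and transport. -/
lemma exists_isField (hK : IsTestKernel K) (hT : 0 ≤ T) (M : ℝ)
    (hu : ∀ j, IsC2 (u₀ j) (G j) (GG j)) :
    ∃ B L, ∀ q : ℝ → T3 → ℝ, Continuous q.uncurry → (∀ t x, |q t x| ≤ M) →
      IsField B L (transportVelocity K T u₀ q) (transportDiv K T u₀ q) := by
  obtain ⟨Lu, hLu0, hLu⟩ := exists_lip_velocity hK hT M hu
  choose C hC0 hC using fun j => exists_abs_le_of_continuous (hu j).grad.continuous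
  have hC' : ∀ j x, |u₀ j x| ≤ ∑ i, C i := fun j x =>
    (hC j x).trans (Finset.single_le_sum (fun i _ => hC0 i) (Finset.mem_univ j))
  set Bu := (∑ i, C i) + (∑ i, ∫ y, |pd i K y|) * M * T with hBu
  set A := (∫ y, |K y|) + ∑ i, ∫ y, |pd i K y| with hA
  have hI0 : 0 ≤ ∫ y, |K y| := integral_nonneg fun y => abs_nonneg _
  have hIi : ∀ i, 0 ≤ ∫ y, |pd i K y| := fun i => integral_nonneg fun y => abs_nonneg _
  have hAK : ∫ y, |K y| ≤ A := le_add_of_nonneg_right (Finset.sum_nonneg fun i _ => hIi i)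
  have hAi : ∀ i, ∫ y, |pd i K y| ≤ A := fun i =>
    (Finset.single_le_sum (fun i _ => hIi i) (Finset.mem_univ i)).trans
      (le_add_of_nonneg_left hI0)
  refine ⟨3 * (A * Bu), 3 * (A * Lu), fun q hqc hM => ?_⟩
  have hq : BddCont q := ⟨hqc, M, hM⟩
  have hcu := fun j => continuous_velocity (T := T) hK (fun j => (hu j).grad.continuous) hq j
  have hcut : ∀ j t, Continuous (velocity K T u₀ q j t) := fun j t =>
    (hcu j).comp (f := fun x => (t, x)) (by fun_prop)
  have hbu := fun j t x => abs_velocity_le (T := T) hK hT hC' hM j t x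
  have hBu0 : 0 ≤ Bu := (abs_nonneg _).trans (hbu 0 0 0)
  refine ⟨?_, ?_, fun t x => ?_, fun t x => ?_, fun t x y => ?_, fun t x y => ?_⟩
  · exact (PiLp.continuous_toLp 2 _).comp (continuous_pi fun i => continuous_conv hK (hcu i))
  · exact continuous_finsetSum Finset.univ fun i _ => continuous_conv (hK.pd i) (hcu i)
  · refine (norm_le_sum_abs _).trans (sum_fin_three_le fun i => ?_)
    exact (abs_conv_le hK (hbu i t) x).trans (mul_le_mul_of_nonneg_right hAK hBu0)
  · refine (Finset.abs_sum_le_sum_abs _ _).trans (sum_fin_three_le fun i => ?_)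
    exact (abs_conv_le (hK.pd i) (hbu i t) x).trans (mul_le_mul_of_nonneg_right (hAi i) hBu0)
  · rw [mul_assoc]
    refine (norm_le_sum_abs _).trans (sum_fin_three_le fun i => ?_)
    refine (abs_conv_shift_le hK (hcut i t) (hLu q hqc hM i t) x y).trans ?_
    gcongr
  · rw [mul_assoc]
    unfold transportDiv
    rw [← Finset.sum_sub_distrib]
    refine (Finset.abs_sum_le_sum_abs _ _).trans (sum_fin_three_le fun i => ?_)
    refine (abs_conv_shift_le (hK.pd i) (hcut i t) (hLu q hqc hM i t) x y).trans ?_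
    have := hAi i
    gcongr

lemma integral_exp_le {l t : ℝ} (hl : 0 < l) :
    ∫ s in (0 : ℝ)..t, Real.exp (l * s) ≤ Real.exp (l * t) / l := by
  rw [intervalIntegral.integral_comp_mul_left (fun s => Real.exp s) hl.ne', integral_exp]
  rw [smul_eq_mul, div_eq_inv_mul]
  refine mul_le_mul_of_nonneg_left ?_ (by positivity)
  have := Real.exp_pos (l * 0)
  linarith

/-- The time integral in Duhamel's formula gains the factor 1/l, since ∫₀ᵗ e^(ls) ds ≤ e^(lt)/l.
This is the only source of contraction. -/
lemma abs_velocity_sub_le (hK : IsTestKernel K)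
    {q' : ℝ → T3 → ℝ} (hq : BddCont q) (hq' : BddCont q') {l D : ℝ} (hl : 0 < l) (hD : 0 ≤ D)
    (h : ∀ t ∈ Icc 0 T, ∀ x, |q t x - q' t x| ≤ D * Real.exp (l * t)) (j : Fin 3)
    {t : ℝ} (ht : t ∈ Icc 0 T) (x : T3) :
    |velocity K T u₀ q j t x - velocity K T u₀ q' j t x|
      ≤ (∑ i, ∫ y, |pd i K y|) / l * (D * Real.exp (l * t)) := by
  set A := ∑ i, ∫ y, |pd i K y| with hA
  have hAi : ∫ y, |pd j K y| ≤ A := Finset.single_le_sum (f := fun i => ∫ y, |pd i K y|)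
    (fun i _ => integral_nonneg fun y => abs_nonneg _) (Finset.mem_univ j)
  have hA0 : 0 ≤ A := (integral_nonneg fun y => abs_nonneg _).trans hAi
  unfold velocity
  rw [clamp_eq ht]
  refine (abs_duhamel_sub_le (hq.force hK j) (hq'.force hK j) ht.1
    (b := fun s => A * D * Real.exp (l * s)) (by fun_prop) (fun s hs x => ?_) x).trans ?_
  · refine (abs_conv_sub_le (hK.pd j) (hq.continuous_apply s) (hq'.continuous_apply s)
      (h s ⟨hs.1, hs.2.trans ht.2⟩) x).trans ?_
    rw [mul_assoc]
    exact mul_le_mul_of_nonneg_right hAi (by positivity)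
  · rw [intervalIntegral.integral_const_mul]
    refine (mul_le_mul_of_nonneg_left (integral_exp_le hl) (by positivity)).trans (le_of_eq ?_)
    field_simp

/-- Existence for the coupled system with a bounded Lipschitz pressure `Q(w)`. -/
theorem exists_coupled {k δ W Lw LQ : ℝ} {w₀ : T3 → ℝ} {Q : ℝ → ℝ} (hK : IsTestKernel K)
    (hT : 0 ≤ T) (hk : 0 ≤ k) (hδ : 0 ≤ δ) (hu : ∀ j, IsC2 (u₀ j) (G j) (GG j))
    (hW : ∀ x, |w₀ x| ≤ W) (hLw : ∀ x y, |w₀ (x + toTorus y) - w₀ x| ≤ Lw * ‖y‖)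
    (hQM : ∀ r, |Q r| ≤ M) (hQL : ∀ r s, |Q r - Q s| ≤ LQ * |r - s|) :
    ∃ q : ℝ → T3 → ℝ, Continuous q.uncurry ∧ (∀ t x, |q t x| ≤ M) ∧
      ∀ t x, q t x = Q (transport k δ T w₀ (transportVelocity K T u₀ q)
        (transportDiv K T u₀ q) t x) := by
  obtain ⟨B, L, hF⟩ := exists_isField hK hT M hu
  obtain ⟨Λ, hΛ⟩ := exists_stLip_transport (w₀ := w₀) hT hk hδ B L hW hLw
  have hLQ : 0 ≤ LQ := by simpa using (abs_nonneg _).trans (hQL 1 0)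
  have hQc : Continuous Q := by
    have : LipschitzWith LQ.toNNReal Q := LipschitzWith.of_dist_le' hQL
    exact this.continuous
  have hM0 : 0 ≤ M := (abs_nonneg _).trans (hQM 0)
  have hW0 : 0 ≤ W := (abs_nonneg _).trans (hW 0)
  have hLw0 : 0 ≤ Lw := by
    simpa [norm_unitVec] using (abs_nonneg _).trans (hLw 0 (unitVec 0))
  set A := ∑ i, ∫ y, |pd i K y| with hA
  set A' := (∫ y, |K y|) + A with hA'
  have hI0 : 0 ≤ ∫ y, |K y| := integral_nonneg fun y => abs_nonneg _
  have hIi : ∀ i, 0 ≤ ∫ y, |pd i K y| := fun i => integral_nonneg fun y => abs_nonneg _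
  have hA0 : 0 ≤ A := Finset.sum_nonneg fun i _ => hIi i
  have hAK : ∫ y, |K y| ≤ A' := le_add_of_nonneg_right hA0
  have hAi : ∀ i, ∫ y, |pd i K y| ≤ A' := fun i =>
    (Finset.single_le_sum (fun i _ => hIi i) (Finset.mem_univ i)).trans
      (le_add_of_nonneg_left hI0)
  have hA'0 : 0 ≤ A' := hI0.trans hAK
  set S := (Lw + W * k + k * δ * k * T) * Real.exp (k * (B * T)) with hS
  have hS0 : 0 ≤ S := by positivity
  have hcc := charConst_nonneg L hT
  obtain ⟨q, hqc, hqM, hq⟩ := exists_fixedPoint_of_volterra (T := T) (M := M)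
    (C := LQ * (S * (charConst L T * (3 * (A' * A))))) hT hM0 (by positivity)
    (fun q t x => Q (transport k δ T w₀ (transportVelocity K T u₀ q) (transportDiv K T u₀ q) t x))
    (fun q hqc hqM => ⟨hQc.comp (hΛ _ _ (hF q hqc hqM)).continuous, fun t x => hQM _⟩)
    (fun q t x => by
      unfold transport
      rw [clamp_eq (clamp_mem hT t)])
    (fun q q' hqc hqM hqc' hqM' l D hl hD h t ht x => by
      have hq : BddCont q := ⟨hqc, M, hqM⟩
      have hq' : BddCont q' := ⟨hqc', M, hqM'⟩
      -- By monotonicity of the exponential, `E` bounds the velocity difference at all times up to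
      -- `t`, which is the uniform input the transport estimate needs.
      set E := A / l * (D * Real.exp (l * t)) with hE
      have hE0 : 0 ≤ E := by positivity
      have hcu := fun {q : ℝ → T3 → ℝ} (hq : BddCont q) j s =>
        (continuous_velocity (T := T) hK (fun j => (hu j).grad.continuous) hq j).comp
          (f := fun x => (s, x)) (by fun_prop)
      have hvel : ∀ s ∈ Icc 0 t, ∀ j x,
          |velocity K T u₀ q j s x - velocity K T u₀ q' j s x| ≤ E := fun s hs j x => by
        refine (abs_velocity_sub_le hK hq hq' hl hD h j
          ⟨hs.1, hs.2.trans ht.2⟩ x).trans ?_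
        have h1 : Real.exp (l * s) ≤ Real.exp (l * t) :=
          Real.exp_le_exp.2 (mul_le_mul_of_nonneg_left hs.2 hl.le)
        exact mul_le_mul_of_nonneg_left (mul_le_mul_of_nonneg_left h1 hD) (by positivity)
      refine (hQL _ _).trans ?_
      have key := abs_transport_sub_le (k := k) (δ := δ) (w₀ := w₀) (hF q hqc hqM)
        (hF q' hqc' hqM') hk hδ hW hLw ht (η := 3 * (A' * E)) (by positivity)
        (fun s hs x => (norm_le_sum_abs _).trans (sum_fin_three_le fun i =>
          (abs_conv_sub_le hK (hcu hq i s) (hcu hq' i s) (hvel s hs i) x).trans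
            (mul_le_mul_of_nonneg_right hAK hE0)))
        (fun s hs x => by
          unfold transportDiv
          rw [← Finset.sum_sub_distrib]
          exact (Finset.abs_sum_le_sum_abs _ _).trans (sum_fin_three_le fun i =>
            (abs_conv_sub_le (hK.pd i) (hcu hq i s) (hcu hq' i s) (hvel s hs i) x).trans
              (mul_le_mul_of_nonneg_right (hAi i) hE0))) x
      refine (mul_le_mul_of_nonneg_left key hLQ).trans (le_of_eq ?_)
      rw [hE]
      ring)
  exact ⟨q, hqc, hqM, fun t x => (congr_fun (congr_fun hq t) x).symm⟩

end velocity

/-! ### Calculus with almost everywhere space-time derivatives. -/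

section STLipAlgebra

variable {L L' : ℝ} {f g : ℝ → T3 → ℝ}

lemma stLip_of_space_of_time {Lx Lt : ℝ} (hLt : 0 ≤ Lt)
    (hx : ∀ t x y, |f t (x + toTorus y) - f t x| ≤ Lx * ‖y‖)
    (ht : ∀ s t x, |f s x - f t x| ≤ Lt * |s - t|) : STLip (Lx + Lt) f := by
  have hLx : 0 ≤ Lx := by
    simpa [norm_unitVec] using (abs_nonneg _).trans (hx 0 0 (unitVec 0))
  intro s t x y
  have h1 := abs_sub_le (f s (x + toTorus y)) (f s x) (f t x)
  have h2 := hx s x y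
  have h3 := ht s t x
  have h4 := mul_nonneg hLx (abs_nonneg (s - t))
  have h5 := mul_nonneg hLt (norm_nonneg y)
  linarith

lemma STLip.mul {C C' : ℝ} (hf : STLip L f) (hg : STLip L' g) (hC : ∀ t x, |f t x| ≤ C)
    (hC' : ∀ t x, |g t x| ≤ C') : STLip (C' * L + C * L') fun t x => f t x * g t x := by
  intro s t x y
  have e : f s (x + toTorus y) * g s (x + toTorus y) - f t x * g t x
      = g s (x + toTorus y) * (f s (x + toTorus y) - f t x)
        + f t x * (g s (x + toTorus y) - g t x) := by ring
  simp only
  rw [e, add_mul]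
  refine (abs_add_le _ _).trans ?_
  rw [abs_mul, abs_mul, mul_assoc, mul_assoc]
  have h0 : 0 ≤ C := (abs_nonneg _).trans (hC 0 0)
  have h0' : 0 ≤ C' := (abs_nonneg _).trans (hC' 0 0)
  exact add_le_add (mul_le_mul (hC' _ _) (hf s t x y) (abs_nonneg _) h0')
    (mul_le_mul (hC _ _) (hg s t x y) (abs_nonneg _) h0)

lemma STLip.exists_comp (hf : STLip L f) {a b : ℝ} (hab : ∀ t x, f t x ∈ Icc a b) {φ φ' : ℝ → ℝ}
    (hφ : ∀ r ∈ Icc a b, HasDerivAt φ (φ' r) r) (hφ' : ContinuousOn φ' (Icc a b)) :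
    (∃ L', STLip L' fun t x => φ (f t x)) ∧ ∃ C, ∀ t x, |φ (f t x)| ≤ C := by
  constructor
  · obtain ⟨C, hC⟩ := isCompact_Icc.exists_bound_of_continuousOn hφ'
    have hC0 : 0 ≤ C := (norm_nonneg _).trans (hC _ (hab 0 0))
    refine ⟨C * L, fun s t x y => ?_⟩
    have := Convex.norm_image_sub_le_of_norm_hasDerivWithin_le
      (fun r hr => (hφ r hr).hasDerivWithinAt) hC (convex_Icc a b) (hab t x)
      (hab s (x + toTorus y))
    rw [mul_assoc]
    exact this.trans (mul_le_mul_of_nonneg_left (hf s t x y) hC0)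
  · obtain ⟨C, hC⟩ := isCompact_Icc.exists_bound_of_continuousOn
      (fun r hr => (hφ r hr).continuousAt.continuousWithinAt : ContinuousOn φ (Icc a b))
    exact ⟨C, fun t x => hC _ (hab t x)⟩

/-- The function `f` is differentiable in space and time at `(t,x)`, with derivative `stDeriv`. -/
def STDiffAt (f : ℝ → T3 → ℝ) (z : ℝ × T3) : Prop :=
  HasFDerivAt (fun p : ℝ × R3 => f p.1 (z.2 + toTorus p.2)) (stDeriv f z.1 z.2) (z.1, 0)

lemma STLip.ae_stDiffAt (hf : STLip L f) :
    ∀ᵐ z ∂((volume : Measure ℝ).prod (volume : Measure T3)), STDiffAt f z := hf.ae_hasFDerivAt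

variable {z : ℝ × T3}

lemma STDiffAt.stDeriv_comp (hf : STDiffAt f z) {φ φ' : ℝ → ℝ}
    (hφ : HasDerivAt φ (φ' (f z.1 z.2)) (f z.1 z.2))
    (hc : STDiffAt (fun t x => φ (f t x)) z) :
    stDeriv (fun t x => φ (f t x)) z.1 z.2 = φ' (f z.1 z.2) • stDeriv f z.1 z.2 := by
  have hφ' : HasDerivAt φ (φ' (f z.1 z.2))
      ((fun p : ℝ × R3 => f p.1 (z.2 + toTorus p.2)) (z.1, 0)) := by
    simpa only [toTorus_zero, add_zero] using hφ
  exact hc.unique (HasDerivAt.comp_hasFDerivAt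
    (f := fun p : ℝ × R3 => f p.1 (z.2 + toTorus p.2)) (z.1, (0 : R3)) hφ' hf)

lemma STDiffAt.stDeriv_mul (hf : STDiffAt f z) (hg : STDiffAt g z)
    (hc : STDiffAt (fun t x => f t x * g t x) z) :
    stDeriv (fun t x => f t x * g t x) z.1 z.2
      = f z.1 z.2 • stDeriv g z.1 z.2 + g z.1 z.2 • stDeriv f z.1 z.2 := by
  have h1 := HasFDerivAt.mul hf hg
  have h2 := hc.unique h1
  simpa [toTorus_zero] using h2

lemma STDiffAt.stDeriv_space_eq (hf : STDiffAt f z) {i : Fin 3} {c : ℝ}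
    (h : HasDerivAt (fun s : ℝ => f z.1 (z.2 + toTorus (s • unitVec i))) c 0) :
    stDeriv f z.1 z.2 (0, unitVec i) = c :=
  (hasDerivAt_space_of_hasFDerivAt hf i).unique h

lemma STDiffAt.stDeriv_time_eq (hf : STDiffAt f z) {c : ℝ}
    (h : HasDerivAt (fun s : ℝ => f s z.2) c z.1) : stDeriv f z.1 z.2 (1, 0) = c :=
  (hasDerivAt_time_of_hasFDerivAt hf).unique h

/-- The transport formula is differentiable along characteristics at every point, but in general in
no other direction. At a point of full differentiability the chain rule turns this into the operator
∂ₜ + V·∇. -/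
lemma STDiffAt.stDeriv_curve_eq (hf : STDiffAt f z) {ξ : ℝ → R3} {V : R3} {c : ℝ}
    (h0 : ξ z.1 = 0) (hξ : HasDerivAt ξ V z.1)
    (h : HasDerivAt (fun s : ℝ => f s (z.2 + toTorus (ξ s))) c z.1) :
    stDeriv f z.1 z.2 (1, 0) + ∑ i, V i * stDeriv f z.1 z.2 (0, unitVec i) = c := by
  have h1 : HasDerivAt (fun s : ℝ => ((s, ξ s) : ℝ × R3)) (1, V) z.1 := (hasDerivAt_id _).prodMk hξ
  have h2 : HasFDerivAt (fun p : ℝ × R3 => f p.1 (z.2 + toTorus p.2)) (stDeriv f z.1 z.2)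
      (z.1, ξ z.1) := by rw [h0]; exact hf
  have h3 : HasDerivAt (fun s : ℝ => f s (z.2 + toTorus (ξ s))) (stDeriv f z.1 z.2 (1, V)) z.1 :=
    HasFDerivAt.comp_hasDerivAt (f := fun s : ℝ => ((s, ξ s) : ℝ × R3)) z.1 h2 h1
  rw [← h3.unique h]
  have e : ((1, V) : ℝ × R3) = (1, 0) + ∑ i, V i • ((0 : ℝ), unitVec i) := by
    ext1
    · simp [Prod.fst_sum]
    · simp only [Prod.snd_add, Prod.snd_sum, Prod.smul_snd, zero_add]
      exact eq_sum_unitVec V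
  rw [e, map_add, map_sum]
  simp only [map_smul, smul_eq_mul]

end STLipAlgebra

/-! ### Classical regularity of the velocity. -/

lemma bddCont_duhamel_clamp {T : ℝ} (hT : 0 ≤ T) {g : T3 → ℝ} {f : ℝ → T3 → ℝ} (hg : Continuous g)
    (hf : BddCont f) : BddCont fun t x => duhamel g f (clamp T t) x := by
  obtain ⟨M, hM0, hM⟩ := exists_abs_le_of_continuous hg
  obtain ⟨N, hN⟩ := hf.bounded
  have hN0 : 0 ≤ N := (abs_nonneg _).trans (hN 0 0)
  refine ⟨(continuous_duhamel hg hf).comp (f := fun p : ℝ × T3 => (clamp T p.1, p.2))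
    (by fun_prop), M + N * T, fun t x => ?_⟩
  have ht := clamp_mem hT t
  refine (abs_duhamel_le hM hN ht.1 x).trans ?_
  have := mul_le_mul_of_nonneg_left ht.2 hN0
  linarith

/-- The first spatial derivatives of the velocity. -/
def velocityGrad (K : R3 → ℝ) (T : ℝ) (G : Fin 3 → Fin 3 → T3 → ℝ) (q : ℝ → T3 → ℝ) (j i : Fin 3)
    (t : ℝ) (x : T3) : ℝ :=
  duhamel (G j i) (fun t => conv (pd i (pd j K)) (q t)) (clamp T t) x

/-- The second spatial derivatives of the velocity. -/
def velocityHess (K : R3 → ℝ) (T : ℝ) (GG : Fin 3 → Fin 3 → Fin 3 → T3 → ℝ) (q : ℝ → T3 → ℝ)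
    (j i l : Fin 3) (t : ℝ) (x : T3) : ℝ :=
  duhamel (GG j i l) (fun t => conv (pd l (pd i (pd j K))) (q t)) (clamp T t) x

section velocity

variable {K : R3 → ℝ} {T : ℝ} {u₀ : Fin 3 → T3 → ℝ} {q : ℝ → T3 → ℝ}
  {G : Fin 3 → Fin 3 → T3 → ℝ} {GG : Fin 3 → Fin 3 → Fin 3 → T3 → ℝ}

lemma bddCont_velocity (hK : IsTestKernel K) (hT : 0 ≤ T) (hu : ∀ j, IsC2 (u₀ j) (G j) (GG j))
    (hq : BddCont q) (j : Fin 3) : BddCont (velocity K T u₀ q j) :=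
  bddCont_duhamel_clamp hT (hu j).grad.continuous (hq.force hK j)

lemma bddCont_velocityGrad (hK : IsTestKernel K) (hT : 0 ≤ T)
    (hu : ∀ j, IsC2 (u₀ j) (G j) (GG j)) (hq : BddCont q) (j i : Fin 3) :
    BddCont (velocityGrad K T G q j i) :=
  bddCont_duhamel_clamp hT ((hu j).grad_grad i).continuous (hq.conv ((hK.pd j).pd i))

lemma bddCont_velocityHess (hK : IsTestKernel K) (hT : 0 ≤ T)
    (hu : ∀ j, IsC2 (u₀ j) (G j) (GG j)) (hq : BddCont q) (j i l : Fin 3) :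
    BddCont (velocityHess K T GG q j i l) :=
  bddCont_duhamel_clamp hT ((hu j).continuous i l) (hq.conv (((hK.pd j).pd i).pd l))

lemma hasDerivAt_velocity (hK : IsTestKernel K) (hu : ∀ j, IsC2 (u₀ j) (G j) (GG j))
    (hq : BddCont q) (j i : Fin 3) (t : ℝ) (x : T3) :
    HasDerivAt (fun s : ℝ => velocity K T u₀ q j t (x + toTorus (s • unitVec i)))
      (velocityGrad K T G q j i t x) 0 :=
  hasDerivAt_duhamel_space (F := fun i t => conv (pd i (pd j K)) (q t)) (hu j).grad
    (fun i => ((hu j).grad_grad i).continuous)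
    (hq.force hK j) (fun i => hq.conv ((hK.pd j).pd i))
    (fun t => hasGrad_conv (hK.pd j) (hq.continuous_apply t)) _ x i

lemma hasDerivAt_velocityGrad (hK : IsTestKernel K) (hu : ∀ j, IsC2 (u₀ j) (G j) (GG j))
    (hq : BddCont q) (j i l : Fin 3) (t : ℝ) (x : T3) :
    HasDerivAt (fun s : ℝ => velocityGrad K T G q j i t (x + toTorus (s • unitVec l)))
      (velocityHess K T GG q j i l t x) 0 :=
  hasDerivAt_duhamel_space (F := fun l t => conv (pd l (pd i (pd j K))) (q t))
    ((hu j).grad_grad i) (fun l => (hu j).continuous i l)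
    (hq.conv ((hK.pd j).pd i)) (fun l => hq.conv (((hK.pd j).pd i).pd l))
    (fun t => hasGrad_conv ((hK.pd j).pd i) (hq.continuous_apply t)) _ x l

lemma hasDerivAt_velocity_time (hK : IsTestKernel K) (hu : ∀ j, IsC2 (u₀ j) (G j) (GG j))
    (hq : BddCont q) (j : Fin 3) {t : ℝ} (ht : t ∈ Ioo 0 T) (x : T3) :
    HasDerivAt (fun s : ℝ => velocity K T u₀ q j s x)
      (∑ i, velocityHess K T GG q j i i t x - force K q j t x) t := by
  have ht' : t ∈ Icc 0 T := ⟨ht.1.le, ht.2.le⟩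
  have h1 := hasDerivAt_duhamel_time (F := fun i t => conv (pd i (pd j K)) (q t))
    (FF := fun i l t => conv (pd l (pd i (pd j K))) (q t)) (hu j).grad (hu j).grad_grad
    (hu j).continuous (hq.force hK j)
    (fun t => hasGrad_conv (hK.pd j) (hq.continuous_apply t))
    (fun t i => hasGrad_conv ((hK.pd j).pd i) (hq.continuous_apply t))
    (fun i l => hq.conv (((hK.pd j).pd i).pd l)) ht.1 x
  refine (h1.congr_of_eventuallyEq ?_).congr_deriv ?_
  · filter_upwards [Icc_mem_nhds ht.1 ht.2] with s hs
    simp only [velocity, clamp_eq hs]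
  · simp only [velocityHess, clamp_eq ht']

/-- By the heat equation the time derivative is a combination of bounded functions on (0,T);
clamping makes the velocity constant in time outside [0,T]. -/
lemma exists_stLip_velocity (hK : IsTestKernel K) (hT : 0 ≤ T)
    (hu : ∀ j, IsC2 (u₀ j) (G j) (GG j)) (hq : BddCont q) (j : Fin 3) :
    ∃ L, STLip L (velocity K T u₀ q j) := by
  obtain ⟨M, hM⟩ := hq.bounded
  obtain ⟨Lx, -, hLx⟩ := exists_lip_velocity hK hT M hu
  choose N hN using fun i => (bddCont_velocityHess hK hT hu hq j i i).bounded
  obtain ⟨N', hN'⟩ := (hq.force hK j).bounded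
  have hder : ∀ t x, |∑ i, velocityHess K T GG q j i i t x - force K q j t x| ≤ (∑ i, N i) + N' :=
    fun t x => (abs_sub _ _).trans (add_le_add ((Finset.abs_sum_le_sum_abs _ _).trans
      (Finset.sum_le_sum fun i _ => hN i t x)) (hN' t x))
  have hN0 : 0 ≤ (∑ i, N i) + N' := (abs_nonneg _).trans (hder 0 0)
  refine ⟨_, stLip_of_space_of_time hN0 (hLx q hq.continuous hM j) ?_⟩
  have hcl : ∀ t x, velocity K T u₀ q j (clamp T t) x = velocity K T u₀ q j t x := by
    intro t x
    simp only [velocity, clamp_eq (clamp_mem hT t)]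
  have hlt : ∀ a ∈ Icc 0 T, ∀ b ∈ Icc 0 T, a < b → ∀ x,
      |velocity K T u₀ q j b x - velocity K T u₀ q j a x| ≤ ((∑ i, N i) + N') * |b - a| := by
    intro a ha b hb hab x
    obtain ⟨c, hc, hc'⟩ := exists_hasDerivAt_eq_slope _ _ hab
      ((bddCont_velocity hK hT hu hq j).continuous.comp (f := fun s => (s, x))
        (by fun_prop)).continuousOn fun s hs =>
      hasDerivAt_velocity_time hK hu hq j ⟨ha.1.trans_lt hs.1, hs.2.trans_le hb.2⟩ x
    rw [eq_div_iff (sub_pos.2 hab).ne'] at hc'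
    have : velocity K T u₀ q j b x - velocity K T u₀ q j a x
        = (∑ i, velocityHess K T GG q j i i c x - force K q j c x) * (b - a) := hc'.symm
    rw [this, abs_mul]
    exact mul_le_mul_of_nonneg_right (hder c x) (abs_nonneg _)
  intro s t x
  rw [← hcl s, ← hcl t]
  refine le_trans ?_ (mul_le_mul_of_nonneg_left (abs_clamp_sub_le T s t) hN0)
  have hs := clamp_mem hT s
  have ht := clamp_mem hT t
  rcases lt_trichotomy (clamp T s) (clamp T t) with h | h | h
  · rw [abs_sub_comm, abs_sub_comm (clamp T s)]
    exact hlt _ hs _ ht h x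
  · rw [h]; simp
  · exact hlt _ ht _ hs h x

end velocity

/-! ### Solutions of the truncated coupled system. -/

/-- A solution of the coupled system with pressure `Q(w)`, where `w = ρ^(-k)`. -/
structure IsCoupled (K : R3 → ℝ) (k δ T : ℝ) (u₀ : Fin 3 → T3 → ℝ) (w₀ : T3 → ℝ) (Q : ℝ → ℝ)
    (q w : ℝ → T3 → ℝ) : Prop where
  bddCont : BddCont q
  pressure : ∀ t x, q t x = Q (w t x)
  stLip : ∃ L, STLip L w
  bounds : ∃ a b, 0 < a ∧ ∀ t x, w t x ∈ Icc a b
  initial : w 0 = w₀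
  curve : ∀ t ∈ Ioo 0 T, ∀ x, ∃ ξ : ℝ → R3, ξ t = 0 ∧
    HasDerivAt ξ (transportVelocity K T u₀ q t x) t ∧
    HasDerivAt (fun s => w s (x + toTorus (ξ s)))
      (k * transportDiv K T u₀ q t x * w t x + k * δ) t
  lower : ∀ c β, 0 ≤ c → (∀ x, c ≤ w₀ x) → (∀ t x, |transportDiv K T u₀ q t x| ≤ β) →
    ∀ t x, c * Real.exp (-(k * (β * T))) ≤ w t x

theorem exists_isCoupled {K : R3 → ℝ} {T M k δ Lw LQ c : ℝ} {u₀ : Fin 3 → T3 → ℝ}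
    {G : Fin 3 → Fin 3 → T3 → ℝ} {GG : Fin 3 → Fin 3 → Fin 3 → T3 → ℝ} {w₀ : T3 → ℝ} {Q : ℝ → ℝ}
    (hK : IsTestKernel K) (hT : 0 ≤ T) (hk : 0 ≤ k) (hδ : 0 ≤ δ)
    (hu : ∀ j, IsC2 (u₀ j) (G j) (GG j)) (hc : 0 < c) (hcw : ∀ x, c ≤ w₀ x)
    (hLw : ∀ x y, |w₀ (x + toTorus y) - w₀ x| ≤ Lw * ‖y‖) (hw₀ : Continuous w₀)
    (hQM : ∀ r, |Q r| ≤ M) (hQL : ∀ r s, |Q r - Q s| ≤ LQ * |r - s|) :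
    ∃ q w, IsCoupled K k δ T u₀ w₀ Q q w := by
  obtain ⟨W, -, hW⟩ := exists_abs_le_of_continuous hw₀
  obtain ⟨q, hqc, hqM, hq⟩ := exists_coupled hK hT hk hδ hu hW hLw hQM hQL
  obtain ⟨B, L, hF⟩ := exists_isField hK hT M hu
  have hF' := hF q hqc hqM
  obtain ⟨Λ, hΛ⟩ := exists_stLip_transport (w₀ := w₀) hT hk hδ B L hW hLw
  refine ⟨q, transport k δ T w₀ (transportVelocity K T u₀ q) (transportDiv K T u₀ q),
    ⟨hqc, M, hqM⟩, hq, ⟨Λ, hΛ _ _ hF'⟩, ?_, ?_, ?_, ?_⟩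
  · exact ⟨_, _, mul_pos hc (Real.exp_pos _), fun t x =>
      ⟨le_transport hF' hT hk hδ hc.le hcw hF'.abs_d_le t x,
        (le_abs_self _).trans (abs_transport_le hF' hT hk hδ hW t x)⟩⟩
  · ext x; exact transport_zero hF' hT x
  · intro t ht x
    exact exists_curve_transport hF' ht x
  · intro c β hc hcw hβ t x
    exact le_transport hF' hT hk hδ hc hcw hβ t x

/-! ### The pressure potential in the variable w. -/

/-- `h` is an entropy for the pressure law `Q`, in the variable `w = ρ^(-k)`. -/
structure IsEntropy (k B C s₀ : ℝ) (Q h h' : ℝ → ℝ) : Prop where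
  hasDerivAt : ∀ r, 0 < r → HasDerivAt h (h' r) r
  continuousOn : ContinuousOn h' (Ioi 0)
  eq : ∀ r, 0 < r → h r + k * r * h' r = -Q r
  deriv_le : ∀ r, 0 < r → k * h' r ≤ B
  le : ∀ r, 0 < r → -B ≤ h r
  le_of_le : ∀ r, s₀ ≤ r → h r ≤ C

/-- With a = 1/k the defining linear equation is solved by h(r) = -r^(-a) ∫₁ʳ s^(a-1) a Q(s) ds. In
terms of the density ρ = r^(-a) this is ρ ∫₁^ρ P(z)/z² dz. All constants depend only on bounds for
`Q` on r ≥ 1 and on r ≥ s₀, never on a cutoff at small r. -/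
lemma exists_isEntropy {k B N s₀ : ℝ} {Q : ℝ → ℝ} (hk : 1 ≤ k) (hQc : Continuous Q)
    (hQ0 : ∀ r, 0 ≤ Q r) (hB : ∀ r, 1 ≤ r → Q r ≤ B * r ^ (-(1 / k))) (hs : 0 < s₀)
    (hs1 : s₀ ≤ 1) (hN : ∀ r, s₀ ≤ r → Q r ≤ N) : ∃ h h', IsEntropy k B (N / s₀) s₀ Q h h' := by
  have hk0 : 0 < k := by linarith
  have hB0 : 0 ≤ B := by simpa using (hQ0 1).trans (hB 1 le_rfl)
  have hN0 : 0 ≤ N := (hQ0 1).trans (hN 1 hs1)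
  set a := 1 / k with ha
  have ha0 : 0 < a := by positivity
  have ha1 : a ≤ 1 := by rw [ha, div_le_one hk0]; exact hk
  have hka : k * a = 1 := by rw [ha]; field_simp
  set I : ℝ → ℝ := fun r => ∫ s in (1 : ℝ)..r, s ^ (a - 1) * (a * Q s) with hI
  have hcont : ∀ r : ℝ, 0 < r → ContinuousAt (fun s : ℝ => s ^ (a - 1) * (a * Q s)) r :=
    fun r hr => (Real.continuousAt_rpow_const r _ (Or.inl hr.ne')).mul (by fun_prop)
  have hco : ContinuousOn (fun s : ℝ => s ^ (a - 1) * (a * Q s)) (Ioi 0) :=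
    fun r hr => (hcont r hr).continuousWithinAt
  have hsub : ∀ x y : ℝ, 0 < x → 0 < y → uIcc x y ⊆ Ioi 0 := fun x y hx hy z hz =>
    (lt_min hx hy).trans_le hz.1
  have hint : ∀ x y : ℝ, 0 < x → 0 < y →
      IntervalIntegrable (fun s : ℝ => s ^ (a - 1) * (a * Q s)) volume x y := fun x y hx hy =>
    (hco.mono (hsub x y hx hy)).intervalIntegrable
  have hId : ∀ r : ℝ, 0 < r → HasDerivAt I (r ^ (a - 1) * (a * Q r)) r := fun r hr =>
    intervalIntegral.integral_hasDerivAt_right (hint 1 r one_pos hr)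
      (hco.stronglyMeasurableAtFilter isOpen_Ioi r hr) (hcont r hr)
  have hnonneg : ∀ s : ℝ, 0 < s → 0 ≤ s ^ (a - 1) * (a * Q s) := fun s hs =>
    mul_nonneg (Real.rpow_nonneg hs.le _) (mul_nonneg ha0.le (hQ0 s))
  set h : ℝ → ℝ := fun r => -(r ^ (-a) * I r) with hh
  have hd : ∀ r, 0 < r → HasDerivAt h (-(Q r + h r) / (k * r)) r := by
    intro r hr
    have h1 := ((Real.hasDerivAt_rpow_const (p := -a) (Or.inl hr.ne')).mul (hId r hr)).neg
    refine h1.congr_deriv ?_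
    have e1 : r ^ (-a - 1) = r ^ (-a) / r := by
      rw [Real.rpow_sub hr, Real.rpow_one]
    have e2 : r ^ (a - 1) = r ^ a / r := by
      rw [Real.rpow_sub hr, Real.rpow_one]
    have e3 : r ^ (-a) * r ^ a = 1 := by
      rw [← Real.rpow_add hr, neg_add_cancel, Real.rpow_zero]
    have e4 : a = 1 / k := ha
    simp only [hh]
    rw [e1, e2]
    have : r ^ (-a) * (r ^ a / r * (a * Q r)) = a * Q r / r := by
      calc _ = (r ^ (-a) * r ^ a) * (a * Q r / r) := by ring
        _ = _ := by rw [e3, one_mul]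
    rw [this]
    generalize r ^ (-a) = X
    generalize I r = Y
    rw [e4]
    field_simp
    ring
  -- For r ≥ 1 the decay of `Q` gives I(r) ≤ a B log r, and r^(-a) log(r^a) ≤ 1. For r ≤ 1 the
  -- integral is oriented backwards, so `h` is nonnegative.
  have hle : ∀ r, 0 < r → -B ≤ h r ∧ (1 ≤ r ∨ 0 ≤ h r) := by
    intro r hr
    rcases le_total 1 r with h1 | h1
    · refine ⟨?_, Or.inl h1⟩
      have hIr : I r ≤ a * B * Real.log r := by
        have h2 : I r ≤ ∫ s in (1 : ℝ)..r, a * B * s⁻¹ := by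
          refine intervalIntegral.integral_mono_on h1 (hint 1 r one_pos hr) ?_ fun s hs => ?_
          · refine ((continuousOn_const (c := a * B)).mul (continuousOn_inv₀.mono
              fun z hz => ?_)).intervalIntegrable
            exact (hsub 1 r one_pos hr hz : (0 : ℝ) < z).ne'
          · have hs0 : 0 < s := one_pos.trans_le hs.1
            calc s ^ (a - 1) * (a * Q s) ≤ s ^ (a - 1) * (a * (B * s ^ (-a))) := by
                  gcongr; exact hB s hs.1
              _ = a * B * (s ^ (a - 1) * s ^ (-a)) := by ring
              _ = _ := by
                rw [← Real.rpow_add hs0, show a - 1 + -a = -1 by ring, Real.rpow_neg_one]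
        rwa [intervalIntegral.integral_const_mul, integral_inv_of_pos one_pos hr, div_one] at h2
      have h3 : r ^ (-a) * (a * Real.log r) ≤ 1 := by
        rw [Real.rpow_neg hr.le, inv_mul_le_iff₀ (by positivity), mul_one, ← Real.log_rpow hr]
        exact Real.log_le_self (by positivity)
      have h4 : r ^ (-a) * I r ≤ r ^ (-a) * (a * B * Real.log r) :=
        mul_le_mul_of_nonneg_left hIr (by positivity)
      have h5 : r ^ (-a) * (a * B * Real.log r) = B * (r ^ (-a) * (a * Real.log r)) := by ring
      have h6 := mul_le_mul_of_nonneg_left h3 hB0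
      simp only [hh]
      linarith
    · have hI0 : I r ≤ 0 := by
        simp only [hI]
        rw [intervalIntegral.integral_symm]
        exact neg_nonpos.2 (intervalIntegral.integral_nonneg h1 fun s hs =>
          hnonneg s (hr.trans_le hs.1))
      have : 0 ≤ h r := by
        simp only [hh]
        exact neg_nonneg.2 (mul_nonpos_of_nonneg_of_nonpos (Real.rpow_nonneg hr.le (-a)) hI0)
      exact ⟨by linarith, Or.inr this⟩
  refine ⟨h, fun r => -(Q r + h r) / (k * r), hd, ?_, ?_, ?_, fun r hr => (hle r hr).1, ?_⟩
  · have hhc : ContinuousOn h (Ioi 0) := fun r hr => (hd r hr).continuousAt.continuousWithinAt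
    refine ((hQc.continuousOn.add hhc).neg).div (by fun_prop) fun r hr => ?_
    exact (mul_pos hk0 hr).ne'
  · intro r hr
    field_simp
    ring
  · intro r hr
    have e : k * (-(Q r + h r) / (k * r)) = -(Q r + h r) / r := by field_simp
    rw [e, div_le_iff₀ hr]
    have hq := hQ0 r
    obtain ⟨h1, h2 | h2⟩ := hle r hr
    · nlinarith
    · have := mul_nonneg hB0 hr.le
      linarith
  · intro r hr
    have hr0 : 0 < r := hs.trans_le hr
    rcases le_total 1 r with h1 | h1
    · have hI0 : 0 ≤ I r := intervalIntegral.integral_nonneg h1 fun s hs =>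
        hnonneg s (one_pos.trans_le hs.1)
      have h2 := mul_nonneg (Real.rpow_nonneg hr0.le (-a)) hI0
      have h3 : 0 ≤ N / s₀ := by positivity
      simp only [hh]
      linarith
    -- The interval [r,1] has length at most one, and the powers s₀^(-a) and s₀^(a-1) multiply to
    -- 1/s₀.
    · have h2 : -I r ≤ ∫ s in r..1, s₀ ^ (a - 1) * N := by
        simp only [hI]
        rw [intervalIntegral.integral_symm, neg_neg]
        refine intervalIntegral.integral_mono_on h1 (hint r 1 hr0 one_pos)
          intervalIntegrable_const fun s hs' => ?_
        have h5 : s₀ ≤ s := hr.trans hs'.1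
        have h3 : s ^ (a - 1) ≤ s₀ ^ (a - 1) :=
          Real.rpow_le_rpow_of_nonpos hs h5 (by linarith)
        have h4 : a * Q s ≤ N := by
          have := mul_le_mul ha1 (hN s h5) (hQ0 s) zero_le_one
          linarith
        exact mul_le_mul h3 h4 (mul_nonneg ha0.le (hQ0 s)) (by positivity)
      rw [intervalIntegral.integral_const, smul_eq_mul] at h2
      have h3 : -I r ≤ s₀ ^ (a - 1) * N := by
        refine h2.trans ?_
        have : 0 ≤ s₀ ^ (a - 1) * N := by positivity
        nlinarith
      have h4 : r ^ (-a) ≤ s₀ ^ (-a) := Real.rpow_le_rpow_of_nonpos hs hr (by linarith)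
      have h5 : r ^ (-a) * -I r ≤ s₀ ^ (-a) * (s₀ ^ (a - 1) * N) :=
        mul_le_mul_of_nonneg h4 h3 (by positivity) (by positivity)
      have h6 : s₀ ^ (-a) * (s₀ ^ (a - 1) * N) = N / s₀ := by
        rw [← mul_assoc, ← Real.rpow_add hs, show -a + (a - 1) = -1 by ring, Real.rpow_neg_one]
        field_simp
      simp only [hh]
      linarith

/-! ### The energy inequality and the bound for the divergence. -/

lemma STLip.integral_sub_eq {L : ℝ} {f : ℝ → T3 → ℝ} (hf : STLip L f) (a b : ℝ) :
    (∫ x, f b x) - ∫ x, f a x = ∫ t in a..b, ∫ x, stDeriv f t x (1, 0) := by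
  have hc : ∀ t, Continuous (f t) := fun t =>
    hf.continuous.comp (f := fun x => (t, x)) (by fun_prop)
  rw [← integral_sub (integrable_of_continuous (hc b)) (integrable_of_continuous (hc a))]
  rw [intervalIntegral_integral_swap]
  · refine integral_congr_ae ?_
    filter_upwards [hf.ae_integral_stDeriv] with x hx
    exact (hx a b).symm
  · have : IsFiniteMeasure ((volume : Measure ℝ).restrict (uIoc a b)) :=
      ⟨by rw [Measure.restrict_apply_univ]; exact measure_Ioc_lt_top⟩
    exact Integrable.of_bound ((measurable_stDeriv f (1, 0)).aestronglyMeasurable) _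
      (Eventually.of_forall fun z => hf.abs_stDeriv_le z.1 z.2 (1, 0))

lemma STLip.intervalIntegrable_integral {L : ℝ} {f : ℝ → T3 → ℝ} (hf : STLip L f) (a b : ℝ) :
    IntervalIntegrable (fun t => ∫ x, stDeriv f t x (1, 0)) volume a b := by
  have h1 : StronglyMeasurable fun t => ∫ x, stDeriv f t x (1, 0) :=
    (measurable_stDeriv f (1, 0)).stronglyMeasurable.integral_prod_right
  refine (intervalIntegrable_const (c := 2 * L * ‖((1, 0) : ℝ × R3)‖)).mono_fun
    h1.aestronglyMeasurable (Eventually.of_forall fun t => ?_)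
  refine (norm_integral_le_of_norm_le_const (Eventually.of_forall fun x =>
    hf.abs_stDeriv_le t x (1, 0))).trans ?_
  simpa using le_abs_self _

lemma conv_neg (K : R3 → ℝ) (f : T3 → ℝ) (x : T3) : conv (fun y => -K y) f x = -conv K f x := by
  simp [conv, integral_neg]

lemma pd_neg_of_even {K : R3 → ℝ} (hK : ∀ y, K (-y) = K y) (i : Fin 3) (y : R3) :
    pd i K (-y) = -pd i K y := by
  have h1 := (ContinuousLinearEquiv.neg ℝ : R3 ≃L[ℝ] R3).comp_right_fderiv (f := K) (x := y)
  have h2 : K ∘ (ContinuousLinearEquiv.neg ℝ : R3 ≃L[ℝ] R3) = K := funext hK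
  rw [h2] at h1
  simp [pd, h1]

/-- An even kernel has odd first derivatives, so differentiated mollification is skew-adjoint. The
work of the pressure on the flow is thereby opposite to the work of the force on the velocity. -/
lemma integral_mul_conv_pd_of_even {K : R3 → ℝ} (hK : IsTestKernel K) (he : ∀ y, K (-y) = K y)
    {f g : T3 → ℝ} (hf : Continuous f) (hg : Continuous g) (i : Fin 3) :
    ∫ x, g x * conv (pd i K) f x = -∫ x, f x * conv (pd i K) g x := by
  rw [integral_mul_conv (hK.pd i) hf hg, ← integral_neg]
  simp only [pd_neg_of_even he i, conv_neg, mul_neg]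

section energy

variable {K : R3 → ℝ} {k δ T B C s₀ : ℝ} {u₀ : Fin 3 → T3 → ℝ} {w₀ : T3 → ℝ} {Q h h' : ℝ → ℝ}
  {q w : ℝ → T3 → ℝ} {G : Fin 3 → Fin 3 → T3 → ℝ} {GG : Fin 3 → Fin 3 → Fin 3 → T3 → ℝ}
  {φ φ' : ℝ → ℝ}

lemma IsCoupled.pos (hc : IsCoupled K k δ T u₀ w₀ Q q w) (t : ℝ) (x : T3) : 0 < w t x := by
  obtain ⟨a, b, ha, hab⟩ := hc.bounds
  exact ha.trans_le (hab t x).1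

lemma IsCoupled.exists_stLip_comp (hc : IsCoupled K k δ T u₀ w₀ Q q w)
    (hφ : ∀ r, 0 < r → HasDerivAt φ (φ' r) r) (hφ' : ContinuousOn φ' (Ioi 0)) :
    (∃ L, STLip L fun t x => φ (w t x)) ∧ ∃ C, ∀ t x, |φ (w t x)| ≤ C := by
  obtain ⟨L, hL⟩ := hc.stLip
  obtain ⟨a, b, ha, hab⟩ := hc.bounds
  exact hL.exists_comp hab (fun r hr => hφ r (ha.trans_le hr.1))
    (hφ'.mono fun r hr => ha.trans_le hr.1)

lemma exists_stLip_conv_velocity (hK : IsTestKernel K) (hT : 0 ≤ T)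
    (hu : ∀ j, IsC2 (u₀ j) (G j) (GG j)) (hq : BddCont q) (i : Fin 3) :
    (∃ L, STLip L fun t x => conv K (velocity K T u₀ q i t) x) ∧
      ∃ C, ∀ t x, |conv K (velocity K T u₀ q i t) x| ≤ C := by
  obtain ⟨L, hL⟩ := exists_stLip_velocity hK hT hu hq i
  exact ⟨⟨_, hL.conv hK⟩, ((bddCont_velocity hK hT hu hq i).conv hK).bounded⟩

lemma IsCoupled.exists_stLip_flux (hc : IsCoupled K k δ T u₀ w₀ Q q w) (hK : IsTestKernel K)
    (hT : 0 ≤ T) (hu : ∀ j, IsC2 (u₀ j) (G j) (GG j))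
    (hφ : ∀ r, 0 < r → HasDerivAt φ (φ' r) r) (hφ' : ContinuousOn φ' (Ioi 0)) (i : Fin 3) :
    (∃ L, STLip L fun t x => φ (w t x) * conv K (velocity K T u₀ q i t) x) ∧
      ∃ C, ∀ t x, |φ (w t x) * conv K (velocity K T u₀ q i t) x| ≤ C := by
  obtain ⟨⟨L, hL⟩, C, hC⟩ := hc.exists_stLip_comp hφ hφ'
  obtain ⟨⟨L', hL'⟩, C', hC'⟩ := exists_stLip_conv_velocity hK hT hu hc.bddCont i
  refine ⟨⟨_, hL.mul hL' hC hC'⟩, C * C', fun t x => ?_⟩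
  rw [abs_mul]
  exact mul_le_mul (hC t x) (hC' t x) (abs_nonneg _) ((abs_nonneg _).trans (hC t x))

/-- The renormalized transport equation. -/
lemma IsCoupled.ae_renormalized (hc : IsCoupled K k δ T u₀ w₀ Q q w) (hK : IsTestKernel K)
    (hT : 0 ≤ T) (hu : ∀ j, IsC2 (u₀ j) (G j) (GG j))
    (hφ : ∀ r, 0 < r → HasDerivAt φ (φ' r) r) (hφ' : ContinuousOn φ' (Ioi 0)) :
    ∀ᵐ z ∂(spaceTime T), stDeriv (fun t x => φ (w t x)) z.1 z.2 (1, 0)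
      + ∑ i, stDeriv (fun t x => φ (w t x) * conv K (velocity K T u₀ q i t) x) z.1 z.2
          (0, unitVec i)
      = φ' (w z.1 z.2) * (k * transportDiv K T u₀ q z.1 z.2 * w z.1 z.2 + k * δ)
        + φ (w z.1 z.2) * transportDiv K T u₀ q z.1 z.2 := by
  obtain ⟨L, hL⟩ := hc.stLip
  obtain ⟨Lφ, hLφ⟩ := (hc.exists_stLip_comp hφ hφ').1
  choose Lv hLv using fun i => (exists_stLip_conv_velocity hK hT hu hc.bddCont i).1
  choose LF hLF using fun i => (hc.exists_stLip_flux hK hT hu hφ hφ' i).1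
  -- At almost every point all the Lipschitz functions involved are differentiable simultaneously,
  -- so the classical chain and product rules apply.
  filter_upwards [ae_spaceTime_mem T, ae_spaceTime_of_ae hL.ae_stDiffAt,
    ae_spaceTime_of_ae hLφ.ae_stDiffAt,
    ae_spaceTime_of_ae (ae_all_iff.2 fun i => (hLv i).ae_stDiffAt),
    ae_spaceTime_of_ae (ae_all_iff.2 fun i => (hLF i).ae_stDiffAt)] with z hz h1 h2 h3 h4
  obtain ⟨ξ, h0, hξ, hw⟩ := hc.curve z.1 hz z.2
  have e1 := h1.stDeriv_curve_eq h0 hξ hw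
  have e2 := h1.stDeriv_comp (hφ _ (hc.pos z.1 z.2)) h2
  have e3 := fun i => (h3 i).stDeriv_space_eq (i := i) ((hasGrad_conv hK
    ((bddCont_velocity hK hT hu hc.bddCont i).continuous_apply z.1)).hasDerivAt_zero z.2 i)
  have e4 := fun i => h2.stDeriv_mul (h3 i) (h4 i)
  simp only [e4, add_apply, smul_apply, smul_eq_mul, e3, e2]
  simp only [transportVelocity, transportDiv, Fin.sum_univ_three] at e1 ⊢
  linear_combination φ' (w z.1 z.2) * e1

/-- The derivative of u ∂ᵢu has zero mean on the torus, so the integral is minus that of (∂ᵢu)².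
Only the sign of the dissipation is kept. -/
lemma integral_velocity_mul_hess_nonpos (hK : IsTestKernel K) (hT : 0 ≤ T)
    (hu : ∀ j, IsC2 (u₀ j) (G j) (GG j)) (hq : BddCont q) (j i : Fin 3) :
    ∀ᵐ t ∂((volume : Measure ℝ).restrict (Ioo 0 T)),
      ∫ x, velocity K T u₀ q j t x * velocityHess K T GG q j i i t x ≤ 0 := by
  have hU := bddCont_velocity hK hT hu hq j
  have hD := bddCont_velocityGrad hK hT hu hq j i
  have hH := bddCont_velocityHess hK hT hu hq j i i
  obtain ⟨A, hA⟩ := hU.bounded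
  obtain ⟨A', hA'⟩ := hD.bounded
  obtain ⟨A'', hA''⟩ := hH.bounded
  have hA0 : 0 ≤ A := (abs_nonneg _).trans (hA 0 0)
  have hA'0 : 0 ≤ A' := (abs_nonneg _).trans (hA' 0 0)
  have h1 := hasWeakSpaceDeriv_of_hasDerivAt (T := T) (i := i)
    (f := fun t x => velocity K T u₀ q j t x * velocityGrad K T G q j i t x)
    (g := fun t x => velocityGrad K T G q j i t x * velocityGrad K T G q j i t x
      + velocity K T u₀ q j t x * velocityHess K T GG q j i i t x)
    (C := A * A') (C' := A' * A' + A * A'')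
    (hU.continuous.mul hD.continuous)
    ((hD.continuous.mul hD.continuous).add (hU.continuous.mul hH.continuous))
    (fun t x => by
      rw [abs_mul]
      exact mul_le_mul (hA t x) (hA' t x) (abs_nonneg _) hA0)
    (fun t x => by
      refine (abs_add_le _ _).trans ?_
      rw [abs_mul, abs_mul]
      exact add_le_add (mul_le_mul (hA' t x) (hA' t x) (abs_nonneg _) hA'0)
        (mul_le_mul (hA t x) (hA'' t x) (abs_nonneg _) hA0))
    (fun t x => by
      have := (hasDerivAt_velocity (T := T) hK hu hq j i t x).fun_mul
        (hasDerivAt_velocityGrad (T := T) hK hu hq j i i t x)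
      simpa [toTorus_zero] using this)
  filter_upwards [h1.2.2] with t ht
  have h2 := ht.integral_eq_zero
  have hi1 : Integrable fun x => velocityGrad K T G q j i t x * velocityGrad K T G q j i t x :=
    integrable_of_continuous ((hD.continuous_apply t).mul (hD.continuous_apply t))
  have hi2 : Integrable fun x => velocity K T u₀ q j t x * velocityHess K T GG q j i i t x :=
    integrable_of_continuous ((hU.continuous_apply t).mul (hH.continuous_apply t))
  rw [integral_add hi1 hi2] at h2
  have h3 : 0 ≤ ∫ x, velocityGrad K T G q j i t x * velocityGrad K T G q j i t x :=
    integral_nonneg fun x => mul_self_nonneg _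
  linarith

lemma exists_stLip_velocity_sq (hK : IsTestKernel K) (hT : 0 ≤ T)
    (hu : ∀ j, IsC2 (u₀ j) (G j) (GG j)) (hq : BddCont q) (j : Fin 3) :
    ∃ L, STLip L fun t x => velocity K T u₀ q j t x * velocity K T u₀ q j t x := by
  obtain ⟨L, hL⟩ := exists_stLip_velocity hK hT hu hq j
  obtain ⟨A, hA⟩ := (bddCont_velocity hK hT hu hq j).bounded
  exact ⟨_, hL.mul hL hA hA⟩

lemma integral_stDeriv_velocity_sq_le (hK : IsTestKernel K) (hT : 0 ≤ T)
    (hu : ∀ j, IsC2 (u₀ j) (G j) (GG j)) (hq : BddCont q) (j : Fin 3) :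
    ∀ᵐ t ∂((volume : Measure ℝ).restrict (Ioo 0 T)),
      ∫ x, stDeriv (fun t x => velocity K T u₀ q j t x * velocity K T u₀ q j t x) t x (1, 0)
        ≤ -2 * ∫ x, velocity K T u₀ q j t x * force K q j t x := by
  obtain ⟨L, hL⟩ := exists_stLip_velocity_sq hK hT hu hq j
  have h1 : ∀ᵐ t ∂((volume : Measure ℝ).restrict (Ioo 0 T)), ∀ᵐ x : T3, t ∈ Ioo 0 T ∧
      STDiffAt (fun t x => velocity K T u₀ q j t x * velocity K T u₀ q j t x) (t, x) :=
    Measure.ae_ae_of_ae_prod ((ae_spaceTime_mem T).and (ae_spaceTime_of_ae hL.ae_stDiffAt))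
  filter_upwards [h1, ae_all_iff.2 fun i => integral_velocity_mul_hess_nonpos hK hT hu hq j i]
    with t ht hneg
  have hU := (bddCont_velocity hK hT hu hq j).continuous_apply t
  have hH := fun i => (bddCont_velocityHess hK hT hu hq j i i).continuous_apply t
  have hF := (hq.force hK j).continuous_apply t
  have e : ∀ᵐ x : T3,
      stDeriv (fun t x => velocity K T u₀ q j t x * velocity K T u₀ q j t x) t x (1, 0)
      = (∑ i, 2 * (velocity K T u₀ q j t x * velocityHess K T GG q j i i t x))
        - 2 * (velocity K T u₀ q j t x * force K q j t x) := by
    filter_upwards [ht] with x hx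
    have h2 := hasDerivAt_velocity_time hK hu hq j hx.1 x
    rw [hx.2.stDeriv_time_eq (h2.mul h2)]
    simp only [Fin.sum_univ_three]
    ring
  rw [integral_congr_ae e, integral_sub, integral_finsetSum]
  · simp only [integral_const_mul]
    have : ∑ i, 2 * ∫ x, velocity K T u₀ q j t x * velocityHess K T GG q j i i t x ≤ 0 :=
      Finset.sum_nonpos fun i _ => by linarith [hneg i]
    linarith
  · exact fun i _ => integrable_of_continuous (continuous_const.mul (hU.mul (hH i)))
  · exact integrable_of_continuous
      (continuous_finsetSum _ fun i _ => continuous_const.mul (hU.mul (hH i)))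
  · exact integrable_of_continuous (continuous_const.mul (hU.mul hF))

lemma continuous_transportDiv (hK : IsTestKernel K) (hT : 0 ≤ T)
    (hu : ∀ j, IsC2 (u₀ j) (G j) (GG j)) (hq : BddCont q) (t : ℝ) :
    Continuous (transportDiv K T u₀ q t) :=
  continuous_finsetSum Finset.univ fun i _ => continuous_conv_apply (hK.pd i)
    ((bddCont_velocity hK hT hu hq i).continuous_apply t)

/-- In the renormalized equation for φ = h the terms with the divergence combine to -q div v by the
defining relation of the entropy. The damping contributes δ k h' ≤ δB, and the flux has zero mean.
-/
lemma IsCoupled.integral_stDeriv_entropy_le (hc : IsCoupled K k δ T u₀ w₀ Q q w)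
    (hK : IsTestKernel K) (hT : 0 ≤ T) (hδ : 0 ≤ δ) (hu : ∀ j, IsC2 (u₀ j) (G j) (GG j))
    (hE : IsEntropy k B C s₀ Q h h') :
    ∀ᵐ t ∂((volume : Measure ℝ).restrict (Ioo 0 T)),
      ∫ x, stDeriv (fun t x => h (w t x)) t x (1, 0)
        ≤ -(∫ x, q t x * transportDiv K T u₀ q t x) + δ * B := by
  obtain ⟨L, hL⟩ := (hc.exists_stLip_comp hE.hasDerivAt hE.continuousOn).1
  choose hF hFb using fun i => hc.exists_stLip_flux hK hT hu hE.hasDerivAt hE.continuousOn i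
  choose LF hLF using hF
  choose CF hCF using hFb
  have h1 : ∀ᵐ t ∂((volume : Measure ℝ).restrict (Ioo 0 T)), ∀ᵐ x : T3, _ :=
    Measure.ae_ae_of_ae_prod (hc.ae_renormalized hK hT hu hE.hasDerivAt hE.continuousOn)
  filter_upwards [h1, ae_all_iff.2 fun i => ((hLF i).hasWeakSpaceDeriv T (hCF i) i).2.2]
    with t ht hflux
  have hq := hc.bddCont.continuous_apply t
  have hd := continuous_transportDiv hK hT hu hc.bddCont t
  have hi1 : Integrable fun x => q t x * transportDiv K T u₀ q t x :=
    integrable_of_continuous (hq.mul hd)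
  have hi1' : Integrable fun x => -(q t x * transportDiv K T u₀ q t x) := hi1.neg
  have hi2 : Integrable fun x => ∑ i, stDeriv
      (fun t x => h (w t x) * conv K (velocity K T u₀ q i t) x) t x (0, unitVec i) :=
    integrable_finsetSum _ fun i _ => (hflux i).2.1
  have hi3 : Integrable fun x => stDeriv (fun t x => h (w t x)) t x (1, 0) :=
    Integrable.of_bound ((measurable_stDeriv _ _).comp measurable_prodMk_left).aestronglyMeasurable
      _ (Eventually.of_forall fun x => hL.abs_stDeriv_le t x (1, 0))
  have h2 : ∫ x, (stDeriv (fun t x => h (w t x)) t x (1, 0) + ∑ i, stDeriv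
      (fun t x => h (w t x) * conv K (velocity K T u₀ q i t) x) t x (0, unitVec i))
      ≤ ∫ x, (-(q t x * transportDiv K T u₀ q t x) + δ * B) := by
    refine integral_mono_ae (hi3.add hi2) (hi1'.add (integrable_const _)) ?_
    filter_upwards [ht] with x hx
    rw [hx]
    have hw := hc.pos t x
    have h3 := hE.eq _ hw
    have h4 := mul_le_mul_of_nonneg_left (hE.deriv_le _ hw) hδ
    have h5 := hc.pressure t x
    have e : h' (w t x) * (k * transportDiv K T u₀ q t x * w t x + k * δ)
        + h (w t x) * transportDiv K T u₀ q t x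
        = (h (w t x) + k * w t x * h' (w t x)) * transportDiv K T u₀ q t x
          + δ * (k * h' (w t x)) := by ring
    rw [e, h3, ← h5]
    linarith
  rw [integral_add hi3 hi2, integral_finsetSum _ fun i _ => (hflux i).2.1,
    Finset.sum_eq_zero fun i _ => (hflux i).integral_eq_zero, add_zero,
    integral_add hi1' (integrable_const _), integral_neg] at h2
  simpa using h2

/-- The energy inequality. -/
theorem IsCoupled.energy_le (hc : IsCoupled K k δ T u₀ w₀ Q q w) (hK : IsTestKernel K)
    (he : ∀ y, K (-y) = K y) (hT : 0 ≤ T) (hδ : 0 ≤ δ) (hu : ∀ j, IsC2 (u₀ j) (G j) (GG j))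
    (hE : IsEntropy k B C s₀ Q h h') {t : ℝ} (ht : t ∈ Icc 0 T) :
    (∑ j, ∫ x, velocity K T u₀ q j t x * velocity K T u₀ q j t x) + 2 * ∫ x, h (w t x)
      ≤ (∑ j, ∫ x, velocity K T u₀ q j 0 x * velocity K T u₀ q j 0 x) + 2 * (∫ x, h (w 0 x))
        + 2 * (δ * B) * t := by
  choose LU hLU using exists_stLip_velocity_sq hK hT hu hc.bddCont
  obtain ⟨L, hL⟩ := (hc.exists_stLip_comp hE.hasDerivAt hE.continuousOn).1
  have h1 := fun j => (hLU j).integral_sub_eq 0 t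
  have h2 := hL.integral_sub_eq 0 t
  have hiU := fun j => (hLU j).intervalIntegrable_integral 0 t
  have hi := hL.intervalIntegrable_integral 0 t
  have hiS : IntervalIntegrable (fun s => ∑ j, ∫ x, stDeriv
      (fun t x => velocity K T u₀ q j t x * velocity K T u₀ q j t x) s x (1, 0)) volume 0 t := by
    have := IntervalIntegrable.sum Finset.univ fun j _ => hiU j
    rwa [Finset.sum_fn] at this
  have h3 : ∫ s in (0 : ℝ)..t, ((∑ j, ∫ x, stDeriv
      (fun t x => velocity K T u₀ q j t x * velocity K T u₀ q j t x) s x (1, 0))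
      + 2 * ∫ x, stDeriv (fun t x => h (w t x)) s x (1, 0))
      ≤ ∫ s in (0 : ℝ)..t, 2 * (δ * B) := by
    refine intervalIntegral.integral_mono_ae_restrict ht.1
      (hiS.add (hi.const_mul 2))
      intervalIntegrable_const ?_
    rw [← Measure.restrict_congr_set Ioo_ae_eq_Icc]
    have hsub := Measure.restrict_mono (μ := (volume : Measure ℝ))
      (Ioo_subset_Ioo_right ht.2 : Ioo 0 t ⊆ Ioo 0 T) le_rfl
    refine ae_mono hsub ?_
    filter_upwards [hc.integral_stDeriv_entropy_le hK hT hδ hu hE,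
      ae_all_iff.2 fun j => integral_stDeriv_velocity_sq_le hK hT hu hc.bddCont j] with s h4 h5
    have hq := hc.bddCont.continuous_apply s
    have hU := fun j => (bddCont_velocity hK hT hu hc.bddCont j).continuous_apply s
    -- The cancellation between pressure work and force work, component by component.
    have h6 : ∫ x, q s x * transportDiv K T u₀ q s x
        = -∑ j, ∫ x, velocity K T u₀ q j s x * force K q j s x := by
      simp only [transportDiv, Finset.mul_sum]
      rw [integral_finsetSum, ← Finset.sum_neg_distrib]
      · refine Finset.sum_congr rfl fun j _ => ?_
        exact integral_mul_conv_pd_of_even hK he (hU j) hq j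
      · exact fun i _ => integrable_of_continuous
          (hq.mul (continuous_conv_apply (hK.pd i) (hU i)))
    have h7 := Finset.sum_le_sum fun j (_ : j ∈ Finset.univ) => h5 j
    rw [← Finset.mul_sum] at h7
    linarith
  rw [intervalIntegral.integral_add hiS (hi.const_mul 2),
    intervalIntegral.integral_finsetSum fun j _ => hiU j, intervalIntegral.integral_const_mul,
    ← h2, Finset.sum_congr rfl fun j _ => (h1 j).symm, Finset.sum_sub_distrib,
    intervalIntegral.integral_const, smul_eq_mul] at h3
  linarith

lemma velocity_clamp (hT : 0 ≤ T) (j : Fin 3) (t : ℝ) :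
    velocity K T u₀ q j (clamp T t) = velocity K T u₀ q j t := by
  ext x
  simp only [velocity, clamp_eq (clamp_mem hT t)]

lemma velocity_zero (hT : 0 ≤ T) (j : Fin 3) (x : T3) : velocity K T u₀ q j 0 x = u₀ j x := by
  simp [velocity, clamp_eq (left_mem_Icc.2 hT), duhamel, heat_of_nonpos]

/-- The a priori bound for the divergence of the mollified velocity. -/
theorem exists_abs_transportDiv_le (hK : IsTestKernel K) (he : ∀ y, K (-y) = K y) (hT : 0 ≤ T)
    (hδ : 0 ≤ δ) (hu : ∀ j, IsC2 (u₀ j) (G j) (GG j)) (hB : 0 ≤ B) (hw₀ : ∀ x, s₀ ≤ w₀ x) :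
    ∃ β, 0 ≤ β ∧ ∀ (Q h h' : ℝ → ℝ) (q w : ℝ → T3 → ℝ), IsCoupled K k δ T u₀ w₀ Q q w →
      IsEntropy k B C s₀ Q h h' → ∀ t x, |transportDiv K T u₀ q t x| ≤ β := by
  choose D hD0 hD using fun i => exists_abs_conv_le_integral (hK.pd i)
  -- The right-hand side of the energy inequality, with `2 * |C|` for the initial entropy and `2 *
  -- B` for the lower bound of the entropy at time t.
  set A := (∑ j, ∫ x, u₀ j x * u₀ j x) + 2 * |C| + 2 * B + 2 * (δ * B) * T with hA
  have hS0 : ∀ f : T3 → ℝ, 0 ≤ ∫ x, f x * f x := fun f => integral_nonneg fun x => mul_self_nonneg _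
  have hA0 : 0 ≤ A := by
    have := Finset.sum_nonneg fun j (_ : j ∈ Finset.univ) => hS0 (u₀ j)
    positivity
  -- The bound is fixed before `Q` is introduced: the pressure enters only through `B`, `C` and
  -- `s₀`.
  refine ⟨∑ i, D i * ((1 + A) / 2), Finset.sum_nonneg fun i _ =>
    mul_nonneg (hD0 i) (by positivity), fun Q h h' q w hc hE t x => ?_⟩
  have hUc := fun j => (bddCont_velocity hK hT hu hc.bddCont j).continuous_apply
  have hw : ∀ t, Continuous fun x => h (w t x) := fun t => by
    obtain ⟨⟨L, hL⟩, -⟩ := hc.exists_stLip_comp hE.hasDerivAt hE.continuousOn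
    exact hL.continuous.comp (f := fun x => (t, x)) (by fun_prop)
  have hsq : ∀ t ∈ Icc 0 T, ∑ j, ∫ x, velocity K T u₀ q j t x * velocity K T u₀ q j t x ≤ A := by
    intro t ht
    have h1 := hc.energy_le hK he hT hδ hu hE ht
    simp only [velocity_zero hT] at h1
    have h2 : -B ≤ ∫ x, h (w t x) := by
      have := integral_mono (μ := (volume : Measure T3)) (integrable_const (-B))
        (integrable_of_continuous (hw t)) fun x => hE.le _ (hc.pos t x)
      simpa using this
    have h3 : ∫ x, h (w 0 x) ≤ |C| := by
      have := integral_mono (μ := (volume : Measure T3)) (integrable_of_continuous (hw 0))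
        (integrable_const |C|) fun x => (hE.le_of_le _ (by rw [hc.initial]; exact hw₀ x)).trans
          (le_abs_self C)
      simpa using this
    have h4 : 2 * (δ * B) * t ≤ 2 * (δ * B) * T := mul_le_mul_of_nonneg_left ht.2 (by positivity)
    linarith
  have hcl : transportDiv K T u₀ q t x = transportDiv K T u₀ q (clamp T t) x := by
    simp only [transportDiv, velocity_clamp hT]
  rw [hcl]
  refine (Finset.abs_sum_le_sum_abs _ _).trans (Finset.sum_le_sum fun i _ => ?_)
  refine (hD i _ (hUc i _) x).trans (mul_le_mul_of_nonneg_left ?_ (hD0 i))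
  set V := velocity K T u₀ q i (clamp T t) with hV
  have h1 : ∫ x, V x * V x ≤ A := (Finset.single_le_sum (f := fun i =>
    ∫ x, velocity K T u₀ q i (clamp T t) x * velocity K T u₀ q i (clamp T t) x)
    (fun j _ => hS0 _) (Finset.mem_univ i)).trans (hsq _ (clamp_mem hT t))
  have hVc : Continuous V := hUc i _
  have hi : Integrable fun x => V x * V x := integrable_of_continuous (hVc.mul hVc)
  -- Passage from L² to L¹ by |V| ≤ (1 + V²)/2; the torus has volume one.
  have h2 : ∫ x, |V x| ≤ ∫ x, (1 + V x * V x) / 2 := by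
    refine integral_mono (integrable_of_continuous hVc.abs)
      (((integrable_const 1).add hi).div_const 2) fun x => ?_
    have := sq_nonneg (|V x| - 1)
    have := abs_mul_abs_self (V x)
    simp only
    nlinarith
  rw [integral_div, integral_add (integrable_const 1) hi] at h2
  simp only [integral_const, probReal_univ, smul_eq_mul, mul_one] at h2
  linarith

end energy

/-! ### Removing the truncation of the pressure. -/

lemma rpow_neg_inv_lipschitz {k c : ℝ} (hk : 0 < k) (hc : 0 < c) :
    ∃ L, 0 ≤ L ∧ ∀ r s, c ≤ r → c ≤ s →
      |r ^ (-(1 / k)) - s ^ (-(1 / k))| ≤ L * |r - s| := by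
  have hk' : 0 < 1 / k := by positivity
  refine ⟨1 / k * c ^ (-(1 / k) - 1), by positivity, fun r s hr hs => ?_⟩
  refine Convex.norm_image_sub_le_of_norm_hasDerivWithin_le (s := Ici c)
    (f := fun r : ℝ => r ^ (-(1 / k))) (f' := fun r => -(1 / k) * r ^ (-(1 / k) - 1))
    (fun x hx => (Real.hasDerivAt_rpow_const
      (Or.inl (hc.trans_le hx).ne')).hasDerivWithinAt) (fun x hx => ?_) (convex_Ici c) hs hr
  have hx0 : 0 < x := hc.trans_le hx
  rw [norm_mul, norm_neg, Real.norm_of_nonneg hk'.le, Real.norm_of_nonneg (by positivity)]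
  exact mul_le_mul_of_nonneg_left (Real.rpow_le_rpow_of_nonpos hc hx (by linarith)) hk'.le

/-- Global existence for the coupled system, for a locally Lipschitz pressure law. -/
theorem exists_isCoupled_of_pressure {K : R3 → ℝ} (hK : IsTestKernel K) (he : ∀ y, K (-y) = K y)
    {P : ℝ → ℝ} (hP : ∀ R, ∃ L, 0 ≤ L ∧ ∀ r ∈ Icc 0 R, ∀ s ∈ Icc 0 R, |P r - P s| ≤ L * |r - s|)
    (hP0 : P 0 = 0) (hPn : ∀ r, 0 ≤ r → 0 ≤ P r) {k δ T s₀ Lw : ℝ} (hk : 1 ≤ k) (hδ : 0 ≤ δ)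
    (hT : 0 ≤ T) {u₀ : Fin 3 → T3 → ℝ} {G : Fin 3 → Fin 3 → T3 → ℝ}
    {GG : Fin 3 → Fin 3 → Fin 3 → T3 → ℝ} (hu : ∀ j, IsC2 (u₀ j) (G j) (GG j)) {w₀ : T3 → ℝ}
    (hs : 0 < s₀) (hs1 : s₀ ≤ 1) (hw₀s : ∀ x, s₀ ≤ w₀ x)
    (hLw : ∀ x y, |w₀ (x + toTorus y) - w₀ x| ≤ Lw * ‖y‖) (hw₀ : Continuous w₀) :
    ∃ Q q w, IsCoupled K k δ T u₀ w₀ Q q w ∧ ∀ t x, q t x = P (w t x ^ (-(1 / k))) := by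
  have hk0 : 0 < k := by linarith
  have hk' : 0 < 1 / k := by positivity
  have hP_le : ∀ R, ∃ L, 0 ≤ L ∧ ∀ r ∈ Icc 0 R, P r ≤ L * r := fun R => by
    obtain ⟨L, hL0, hL⟩ := hP R
    refine ⟨L, hL0, fun r hr => ?_⟩
    have := hL r hr 0 ⟨le_rfl, hr.1.trans hr.2⟩
    rw [hP0, sub_zero, sub_zero, abs_of_nonneg hr.1] at this
    exact (le_abs_self _).trans this
  have hmono : ∀ {c r : ℝ}, 0 < c → c ≤ r → r ^ (-(1 / k)) ∈ Icc 0 (c ^ (-(1 / k))) :=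
    fun {c r} hc hr => ⟨Real.rpow_nonneg (hc.trans_le hr).le _,
      Real.rpow_le_rpow_of_nonpos hc hr (by linarith)⟩
  -- The constants `B` and `N` concern the densities up to 1 and up to s₀^(-1/k). They are fixed
  -- before the cutoff level `c`, and c ≤ s₀ ≤ 1 keeps them valid for the truncated law.
  obtain ⟨B, hB0, hB⟩ := hP_le 1
  obtain ⟨N, hN0, hN⟩ := hP_le (s₀ ^ (-(1 / k)))
  obtain ⟨β, hβ0, hβ⟩ := exists_abs_transportDiv_le (k := k) (C := N * s₀ ^ (-(1 / k)) / s₀)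
    hK he hT hδ hu hB0 hw₀s
  -- This is the lower bound for `w` that follows from |d| ≤ β and w₀ ≥ s₀.
  set c := s₀ * Real.exp (-(k * (β * T))) with hc
  have hc0 : 0 < c := by positivity
  have hcs : c ≤ s₀ := mul_le_of_le_one_right hs.le
    (Real.exp_le_one_iff.2 (neg_nonpos.2 (by positivity)))
  set Q : ℝ → ℝ := fun r => P (max r c ^ (-(1 / k))) with hQ
  obtain ⟨L, hL0, hL⟩ := hP (c ^ (-(1 / k)))
  obtain ⟨L', hL'0, hL'⟩ := rpow_neg_inv_lipschitz hk0 hc0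
  have hQL : ∀ r s, |Q r - Q s| ≤ L * L' * |r - s| := by
    intro r s
    refine (hL _ (hmono hc0 (le_max_right r c)) _ (hmono hc0 (le_max_right s c))).trans ?_
    rw [mul_assoc]
    refine mul_le_mul_of_nonneg_left ?_ hL0
    refine (hL' _ _ (le_max_right r c) (le_max_right s c)).trans ?_
    exact mul_le_mul_of_nonneg_left (abs_max_sub_max_le_abs r s c) hL'0
  have hQ0 : ∀ r, 0 ≤ Q r := fun r => hPn _ (hmono hc0 (le_max_right r c)).1
  have hQc : Continuous Q := by
    have : LipschitzWith (L * L').toNNReal Q := LipschitzWith.of_dist_le' hQL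
    exact this.continuous
  obtain ⟨M, -, hM⟩ := hP_le (c ^ (-(1 / k)))
  have hQM : ∀ r, |Q r| ≤ |M| * c ^ (-(1 / k)) := by
    intro r
    have h1 := hmono hc0 (le_max_right r c)
    rw [abs_of_nonneg (hQ0 r)]
    exact (hM _ h1).trans (mul_le_mul (le_abs_self M) h1.2 h1.1 (abs_nonneg M))
  have hQB : ∀ r, 1 ≤ r → Q r ≤ B * r ^ (-(1 / k)) := by
    intro r hr
    simp only [hQ]
    rw [max_eq_left (hcs.trans (hs1.trans hr))]
    refine hB _ ?_
    simpa using hmono one_pos hr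
  have hQN : ∀ r, s₀ ≤ r → Q r ≤ N * s₀ ^ (-(1 / k)) := by
    intro r hr
    have h1 := hmono hs (hr.trans (le_max_left r c))
    exact (hN _ h1).trans (mul_le_mul_of_nonneg_left h1.2 hN0)
  obtain ⟨h, h', hE⟩ := exists_isEntropy hk hQc hQ0 hQB hs hs1 hQN
  obtain ⟨q, w, hqw⟩ := exists_isCoupled hK hT hk0.le hδ hu hs hw₀s hLw hw₀ hQM hQL
  refine ⟨Q, q, w, hqw, fun t x => ?_⟩
  -- The solution never goes below the cutoff level, so the truncated law agrees with `P` along it.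
  have hw := hqw.lower s₀ β hs.le hw₀s (hβ Q h h' q w hqw hE) t x
  rw [hqw.pressure]
  simp only [hQ]
  rw [max_eq_left hw]

/-! ### Verification of the weak formulation and of the regularity classes. -/

lemma IsPressureLaw.exists_lipschitz {π : ℝ → ℝ} {γ μ Γ : ℝ} (hπ : IsPressureLaw π γ)
    (hΓ : 1 ≤ Γ) (R : ℝ) : ∃ L, 0 ≤ L ∧ ∀ r ∈ Icc 0 R, ∀ s ∈ Icc 0 R,
      |modifiedPressure π μ Γ r - modifiedPressure π μ Γ s| ≤ L * |r - s| := by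
  have h1 : ContDiffOn ℝ 1 (modifiedPressure π μ Γ) (Icc 0 R) := by
    refine (hπ.contDiffOn_one.mono Icc_subset_Ici_self).add (contDiffOn_const.mul ?_)
    exact (Real.contDiff_rpow_const_of_le (n := 1) (by simpa using hΓ)).contDiffOn
  obtain ⟨L, hL⟩ := h1.exists_lipschitzOnWith one_ne_zero (convex_Icc 0 R) isCompact_Icc
  exact ⟨L, L.2, fun r hr s hs => hL.dist_le_mul r hr s hs⟩

lemma IsMollifierKernel.isTestKernel {κ : R3 → ℝ} (hκ : IsMollifierKernel κ) {ε : ℝ} (hε : 0 < ε) :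
    IsTestKernel (scaledKernel κ ε) := by
  refine ⟨contDiff_const.mul (hκ.smooth.comp (contDiff_const_smul ε⁻¹)), ?_⟩
  exact (hκ.compactSupport.comp_smul (inv_ne_zero hε.ne')).mul_left

lemma IsMollifierKernel.scaledKernel_neg {κ : R3 → ℝ} (hκ : IsMollifierKernel κ) (ε : ℝ) (y : R3) :
    scaledKernel κ ε (-y) = scaledKernel κ ε y := by
  simp [scaledKernel, hκ.even]

section regularity

variable {L : ℝ} {f : ℝ → T3 → ℝ}

lemma STLip.hasInitialValue (hf : STLip L f) {f₀ : T3 → ℝ} (h0 : f 0 = f₀) (T : ℝ) :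
    HasInitialValue T f f₀ := by
  refine ⟨fun p _ _ t _ => ⟨?_, ?_⟩, Eventually.of_forall fun x => congr_fun h0 x⟩
  · have hc : Continuous (f t) := hf.continuous.comp (f := fun x => (t, x)) (by fun_prop)
    obtain ⟨C, -, hC⟩ := exists_abs_le_of_continuous hc
    exact MemLp.of_bound hc.aestronglyMeasurable C (Eventually.of_forall hC)
  · have h1 : Tendsto (fun s => ENNReal.ofReal (L * |s - t|)) (𝓝[Icc 0 T] t) (𝓝 0) := by
      have h2 : Continuous fun s => ENNReal.ofReal (L * |s - t|) :=
        ENNReal.continuous_ofReal.comp (by fun_prop)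
      have := (h2.tendsto t).mono_left (nhdsWithin_le_nhds (s := Icc 0 T))
      simpa using this
    refine tendsto_of_tendsto_of_tendsto_of_le_of_le tendsto_const_nhds h1 (fun _ => zero_le)
      fun s => ?_
    refine (eLpNorm_le_of_ae_bound (C := L * |s - t|) (Eventually.of_forall fun x => ?_)).trans ?_
    · simpa [toTorus_zero] using hf s t x 0
    · simp

lemma STLip.memW1Lp (hf : STLip L f) {T : ℝ} (hT : 0 ≤ T) {C : ℝ} (hC : ∀ t x, |f t x| ≤ C)
    (p : ENNReal) : MemW1Lp T p f :=
  ⟨hf.abs_le_of_memLp T hC p, _, hf.hasWeakTimeDeriv hT hC, memLpLp_stDeriv hf T p _⟩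

lemma STLip.memLpW_one (hf : STLip L f) (T : ℝ) {C : ℝ} (hC : ∀ t x, |f t x| ≤ C)
    (p : ENNReal) : MemLpW T p 1 f :=
  ⟨hf.abs_le_of_memLp T hC p, fun i => ⟨_, hf.hasWeakSpaceDeriv T hC i, memLpLp_stDeriv hf T p _⟩⟩

lemma BddCont.memLpLp (hf : BddCont f) (T : ℝ) (p : ENNReal) : MemLpLp T p f := by
  obtain ⟨C, hC⟩ := hf.bounded
  exact memLpLp_of_bound hf.continuous.measurable hC

lemma BddCont.hasWeakSpaceDeriv {g : ℝ → T3 → ℝ} (hf : BddCont f) (hg : BddCont g) {i : Fin 3}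
    (hd : ∀ t x, HasDerivAt (fun s : ℝ => f t (x + toTorus (s • unitVec i))) (g t x) 0) (T : ℝ) :
    HasWeakSpaceDeriv T i f g := by
  obtain ⟨C, hC⟩ := hf.bounded
  obtain ⟨C', hC'⟩ := hg.bounded
  exact hasWeakSpaceDeriv_of_hasDerivAt hf.continuous hg.continuous hC hC' hd

variable {K : R3 → ℝ} {k δ T : ℝ} {u₀ : Fin 3 → T3 → ℝ} {w₀ : T3 → ℝ} {Q P : ℝ → ℝ}
  {q w : ℝ → T3 → ℝ} {G : Fin 3 → Fin 3 → T3 → ℝ} {GG : Fin 3 → Fin 3 → Fin 3 → T3 → ℝ}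

lemma memLpW_two_velocity (hK : IsTestKernel K) (hT : 0 ≤ T)
    (hu : ∀ j, IsC2 (u₀ j) (G j) (GG j)) (hq : BddCont q) (p : ENNReal) (j : Fin 3) :
    MemLpW T p 2 (velocity K T u₀ q j) := by
  have hU := bddCont_velocity hK hT hu hq j
  have hD := bddCont_velocityGrad hK hT hu hq j
  have hH := bddCont_velocityHess hK hT hu hq j
  exact ⟨hU.memLpLp T p, fun i => ⟨_, hU.hasWeakSpaceDeriv (hD i)
    (hasDerivAt_velocity hK hu hq j i) T, (hD i).memLpLp T p, fun l => ⟨_,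
    (hD i).hasWeakSpaceDeriv (hH i l) (hasDerivAt_velocityGrad hK hu hq j i l) T,
    (hH i l).memLpLp T p⟩⟩⟩

lemma momentumEq_of_isCoupled {κ : R3 → ℝ} {ε : ℝ} (hK : IsTestKernel (scaledKernel κ ε))
    (hT : 0 ≤ T) (hu : ∀ j, IsC2 (u₀ j) (G j) (GG j)) (hq : BddCont q) {ρ : ℝ → T3 → ℝ}
    (hρ : ∀ t x, q t x = P (ρ t x)) :
    MomentumEq κ ε P T ρ fun t x =>
      WithLp.toLp 2 fun j => velocity (scaledKernel κ ε) T u₀ q j t x := by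
  intro j
  have hU := bddCont_velocity hK hT hu hq j
  have hD := bddCont_velocityGrad hK hT hu hq j
  have hH := bddCont_velocityHess hK hT hu hq j
  obtain ⟨L, hL⟩ := exists_stLip_velocity hK hT hu hq j
  obtain ⟨C, hC⟩ := hU.bounded
  have hp : (fun t x => mollify κ ε (fun y => P (ρ t y)) x)
      = fun t x => conv (scaledKernel κ ε) (q t) x := by
    simp only [← hρ]
    rfl
  refine ⟨_, force (scaledKernel κ ε) q j, velocityGrad (scaledKernel κ ε) T G q j,
    fun i => velocityHess (scaledKernel κ ε) T GG q j i i, hL.hasWeakTimeDeriv hT hC, ?_,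
    fun i => hU.hasWeakSpaceDeriv (hD i) (hasDerivAt_velocity hK hu hq j i) T,
    fun i => (hD i).hasWeakSpaceDeriv (hH i i) (hasDerivAt_velocityGrad hK hu hq j i i) T, ?_⟩
  · rw [hp]
    exact (hq.conv hK).hasWeakSpaceDeriv (hq.force hK j)
      (fun t x => (hasGrad_conv hK (hq.continuous_apply t)).hasDerivAt_zero x j) T
  · filter_upwards [ae_spaceTime_mem T, ae_spaceTime_of_ae hL.ae_stDiffAt] with z hz h1
    rw [h1.stDeriv_time_eq (hasDerivAt_velocity_time hK hu hq j hz z.2)]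
    ring

lemma hasDerivAt_rpow_neg_inv (k r : ℝ) (hr : 0 < r) :
    HasDerivAt (fun r : ℝ => r ^ (-(1 / k))) (-(1 / k) * r ^ (-(1 / k) - 1)) r :=
  Real.hasDerivAt_rpow_const (Or.inl hr.ne')

lemma continuousOn_deriv_rpow_neg_inv (k : ℝ) :
    ContinuousOn (fun r : ℝ => -(1 / k) * r ^ (-(1 / k) - 1)) (Ioi 0) := fun r hr =>
  (continuousAt_const.mul
    (Real.continuousAt_rpow_const r _ (Or.inl (ne_of_gt hr)))).continuousWithinAt

/-- Take φ(w) = w^(-1/k) in the renormalized equation. Since k w φ' = -φ, the divergence terms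
cancel, and k δ φ' = -δ w^(-1/k-1) is -δρ^m because m = k + 1. -/
lemma continuityEq_of_isCoupled {κ : R3 → ℝ} {ε m : ℝ} (hK : IsTestKernel (scaledKernel κ ε))
    (hT : 0 ≤ T) (hk : 1 ≤ k) (hm : m = k + 1) (hu : ∀ j, IsC2 (u₀ j) (G j) (GG j))
    (hc : IsCoupled (scaledKernel κ ε) k δ T u₀ w₀ Q q w) :
    ContinuityEq κ ε δ m T (fun t x => w t x ^ (-(1 / k))) fun t x =>
      WithLp.toLp 2 fun j => velocity (scaledKernel κ ε) T u₀ q j t x := by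
  have hk0 : 0 < k := by linarith
  obtain ⟨⟨L, hL⟩, C, hC⟩ := hc.exists_stLip_comp (hasDerivAt_rpow_neg_inv k)
    (continuousOn_deriv_rpow_neg_inv k)
  choose hF hFb using fun i => hc.exists_stLip_flux hK hT hu (hasDerivAt_rpow_neg_inv k)
    (continuousOn_deriv_rpow_neg_inv k) i
  choose LF hLF using hF
  choose CF hCF using hFb
  refine ⟨_, _, hL.hasWeakTimeDeriv hT hC, fun i => (hLF i).hasWeakSpaceDeriv T (hCF i) i, ?_⟩
  filter_upwards [hc.ae_renormalized hK hT hu (hasDerivAt_rpow_neg_inv k)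
    (continuousOn_deriv_rpow_neg_inv k)] with z hz
  rw [hz]
  have hw := hc.pos z.1 z.2
  have e1 : (w z.1 z.2 ^ (-(1 / k))) ^ m = w z.1 z.2 ^ (-(1 / k) - 1) := by
    rw [← Real.rpow_mul hw.le, hm]
    congr 1
    field_simp
    ring
  have e2 : w z.1 z.2 ^ (-(1 / k)) = w z.1 z.2 ^ (-(1 / k) - 1) * w z.1 z.2 := by
    rw [← Real.rpow_add_one hw.ne', sub_add_cancel]
  rw [e1, e2]
  generalize w z.1 z.2 ^ (-(1 / k) - 1) = Y
  field_simp
  ring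

end regularity

end RegularizedFlow

end

/-! ### Assembly of the solution. -/

theorem theorem3
    (κ : RegularizedFlow.R3 → ℝ) (hκ : RegularizedFlow.IsMollifierKernel κ)
    (π : ℝ → ℝ) (γ : ℝ) (hπ : RegularizedFlow.IsPressureLaw π γ)
    (Γ m : ℝ) (hΓ : 3 < Γ) (hm : m ∈ Set.Ioo (5 / 2 * Γ + 1) (5 / 2 * Γ + 2))
    (ε δ μ T : ℝ) (hε : 0 < ε) (hδ : 0 < δ) (hμ : 0 < μ) (hT : 0 < T)
    (ρ₀ : RegularizedFlow.T3 → ℝ) (u₀ : RegularizedFlow.T3 → RegularizedFlow.R3)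
    (hρ₀ : RegularizedFlow.TorusContDiff 2 ρ₀)
    (hρ₀_bounds : ∃ a b : ℝ, 0 < a ∧ ∀ x, a ≤ ρ₀ x ∧ ρ₀ x ≤ b)
    (hu₀ : RegularizedFlow.TorusContDiff 2 u₀) :
    ∃ (ρ : ℝ → RegularizedFlow.T3 → ℝ) (u : ℝ → RegularizedFlow.T3 → RegularizedFlow.R3),
      RegularizedFlow.IsStrongSolution κ ε δ m
        (RegularizedFlow.modifiedPressure π μ Γ) T ρ₀ u₀ ρ u ∧
      ∀ p : ENNReal, 1 ≤ p → p ≠ ⊤ →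
        (RegularizedFlow.MemW1Lp T p ρ ∧ RegularizedFlow.MemLpW T p 1 ρ) ∧
        ∀ j : Fin 3,
          RegularizedFlow.MemW1Lp T p (fun t x => u t x j) ∧
          RegularizedFlow.MemLpW T p 2 (fun t x => u t x j) := by
  open RegularizedFlow in
  obtain ⟨a, b, ha, hab⟩ := hρ₀_bounds
  have hb : 0 < b := ha.trans_le ((hab 0).1.trans (hab 0).2)
  have hΓ0 : 0 < Γ := by linarith
  set k := m - 1 with hk
  have hk1 : 1 ≤ k := by have := hm.1; linarith
  have hk0 : 0 < k := by linarith
  have hK := hκ.isTestKernel hε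
  choose G GG hu using fun j => TorusContDiff.exists_isC2 (g := fun x => u₀ x j)
    ((EuclideanSpace.proj j : R3 →L[ℝ] ℝ).contDiff.comp hu₀)
  obtain ⟨Gρ, hGρ, hGρ'⟩ := TorusContDiff.exists_hasGrad (n := 1) (f := ρ₀) hρ₀
  choose Cρ hCρ0 hCρ using fun i => exists_abs_le_of_continuous (hGρ' i).continuous
  -- The initial density is regarded as a function constant in time, so that composition with r ↦
  -- r^(-k) is covered by the space-time lemma.
  have hρL : STLip (3 * ∑ i, Cρ i + 0) fun _ : ℝ => ρ₀ := stLip_of_space_of_time le_rfl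
    (fun _ => hGρ.abs_sub_le fun i x => (hCρ i x).trans
      (Finset.single_le_sum (fun i _ => hCρ0 i) (Finset.mem_univ i)))
    (fun s t x => by simp)
  obtain ⟨⟨Lw, hLw⟩, -⟩ := hρL.exists_comp (fun _ => hab) (φ := fun r => r ^ (-k))
    (φ' := fun r => -k * r ^ (-k - 1))
    (fun r hr => Real.hasDerivAt_rpow_const (Or.inl (ha.trans_le hr.1).ne'))
    (fun r hr => (continuousAt_const.mul (Real.continuousAt_rpow_const r _
      (Or.inl (ha.trans_le hr.1).ne'))).continuousWithinAt)
  -- The upper bound `b` for the density is a lower bound for w₀; the minimum with 1 meets the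
  -- normalisation s₀ ≤ 1 of the entropy.
  obtain ⟨Q, q, w, hc, hP⟩ := exists_isCoupled_of_pressure (P := modifiedPressure π μ Γ)
    (w₀ := fun x => ρ₀ x ^ (-k)) (Lw := Lw) (s₀ := min 1 (b ^ (-k))) hK
    (hκ.scaledKernel_neg ε) (hπ.exists_lipschitz (by linarith))
    (by simp [modifiedPressure, hπ.zero, Real.zero_rpow hΓ0.ne'])
    (fun r hr => by
      refine add_nonneg ?_ (mul_nonneg hμ.le (Real.rpow_nonneg hr Γ))
      rcases hr.eq_or_lt with h | h
      · rw [← h, hπ.zero]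
      · exact (hπ.pos r h).le)
    hk1 hδ.le hT.le hu (lt_min one_pos (Real.rpow_pos_of_pos hb _)) (min_le_left _ _)
    (fun x => (min_le_right _ _).trans (Real.rpow_le_rpow_of_nonpos (ha.trans_le (hab x).1)
      (hab x).2 (by linarith)))
    (fun x y => by simpa using hLw 0 0 x y)
    (hLw.continuous.comp (f := fun x => ((0 : ℝ), x)) (by fun_prop))
  obtain ⟨⟨L, hL⟩, C, hC⟩ := hc.exists_stLip_comp (hasDerivAt_rpow_neg_inv k)
    (continuousOn_deriv_rpow_neg_inv k)
  choose LU hLU using exists_stLip_velocity hK hT.le hu hc.bddCont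
  choose CU hCU using fun j => (bddCont_velocity hK hT.le hu hc.bddCont j).bounded
  refine ⟨fun t x => w t x ^ (-(1 / k)), fun t x =>
    WithLp.toLp 2 fun j => velocity (scaledKernel κ ε) T (fun j x => u₀ x j) q j t x,
    ⟨?_, ?_, ?_, ?_, ?_⟩, fun p _ _ => ⟨⟨hL.memW1Lp hT.le hC p, hL.memLpW_one T hC p⟩,
      fun j => ⟨(hLU j).memW1Lp hT.le (hCU j) p,
        memLpW_two_velocity hK hT.le hu hc.bddCont p j⟩⟩⟩
  · exact fun t _ => Filter.Eventually.of_forall fun x => Real.rpow_nonneg (hc.pos t x).le _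
  · exact continuityEq_of_isCoupled hK hT.le hk1 (by rw [hk]; ring) hu hc
  · exact momentumEq_of_isCoupled hK hT.le hu hc.bddCont hP
  · refine hL.hasInitialValue ?_ T
    ext x
    have hx : 0 ≤ ρ₀ x := ha.le.trans (hab x).1
    simp only [hc.initial]
    rw [← Real.rpow_mul hx, show -k * -(1 / k) = 1 by field_simp, Real.rpow_one]
  · exact fun j => (hLU j).hasInitialValue (funext fun x => velocity_zero hT.le j x) T
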